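/- Let $P$ be a centrally symmetric convex decagon in the Euclidean plane (a centrally symmetric convex polygon with exactly ten vertices, its centre being any point). For a positive integer $k$, call $P$ a $k$-fold lattice tile if there is a two-dimensional lattice $\Lambda\subset\mathbb{R}^2$ such that every point of the plane belongs to at least $k$ of the translates $P+\mathbf{w}$, $\mathbf{w}\in\Lambda$, and every point of the plane belongs to at most $k$ of the translates ${\rm int}(P)+\mathbf{w}$, $\mathbf{w}\in\Lambda$. Let $\tau^*(P)$ be the smallest positive integer $k$ such that $P$ is a $k$-fold lattice tile, with $\tau^*(P)=\infty$ if there is no such $k$. Then $$\tau^*(P)\ge 5,$$ and $\tau^*(P)=5$ holds if and only if there is a non-singular affine transformation $\sigma$ of the plane such that the set of the middle points of the ten edges of $\sigma(P)$ is $$\left\{\pm(0,1),\ \pm(1,1),\ \pm\left(\tfrac32,\tfrac12\right),\ \pm\left(\tfrac32,0\right),\ \pm\left(1,-\tfrac12\right)\right\}.$$ -/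

import Mathlib

/-- The Euclidean plane. -/
abbrev Plane : Type := EuclideanSpace ℝ (Fin 2)

/-- The determinant of two plane vectors; it is positive exactly when `b` points strictly to the
left of `a`. -/
noncomputable def cross (a b : Plane) : ℝ := a 0 * b 1 - a 1 * b 0

/-- For `n ≥ 3`: `P` is the convex `n`-gon whose vertices, enumerated counterclockwise (cyclically, indices
modulo `n`), are `v i`: it is the convex hull of the `v i`, and for every `i` all vertices other
than `v i` and `v (i + 1)` lie strictly to the left of the directed line from `v i` to `v (i + 1)`.
So the edges of `P` are the segments from `v i` to `v (i + 1)`, and there are exactly `n` of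
them. -/
structure IsConvexPolygon (n : ℕ) (P : Set Plane) (v : ZMod n → Plane) : Prop where
  eq_convexHull : P = convexHull ℝ (Set.range v)
  convexPosition : ∀ i j : ZMod n, j ≠ i → j ≠ i + 1 →
    0 < cross (v (i + 1) - v i) (v j - v i)

/-- `P` is centrally symmetric about some point `c`, which need not be the origin. -/
def IsCentrallySymmetric (P : Set Plane) : Prop :=
  ∃ c : Plane, ∀ x ∈ P, AffineEquiv.pointReflection ℝ c x ∈ P

/-- The set of the middle points of the edges of the polygon with cyclically enumerated
vertices `v`. -/
noncomputable def edgeMidpoints {n : ℕ} (v : ZMod n → Plane) : Set Plane :=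
  Set.range fun i : ZMod n => midpoint ℝ (v i) (v (i + 1))

/-- `K + Λ` is a `k`-fold tiling of the plane: every point lies in at least `k` of the translates
`K + w`, `w ∈ Λ`, and in at most `k` of the translates `int K + w`, `w ∈ Λ`. -/
def IsKFoldTiling (k : ℕ) (K Λ : Set Plane) : Prop :=
  ∀ x : Plane,
    (k : ℕ∞) ≤ {w ∈ Λ | x - w ∈ K}.encard ∧ {w ∈ Λ | x - w ∈ interior K}.encard ≤ (k : ℕ∞)

/-- `K` is a `k`-fold lattice tile: `k` is positive and `K + Λ` is a `k`-fold tiling for some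
two-dimensional lattice `Λ`. -/
def IsKFoldLatticeTile (k : ℕ) (K : Set Plane) : Prop :=
  0 < k ∧ ∃ (Λ : Submodule ℤ Plane) (_ : DiscreteTopology Λ) (_ : IsZLattice ℝ Λ),
    IsKFoldTiling k K (Λ : Set Plane)

/-- `τ*(K)`: the smallest `k` such that `K` is a `k`-fold lattice tile, and `⊤` if there is no
such `k`. -/
noncomputable def tauStar (K : Set Plane) : ℕ∞ :=
  sInf {m : ℕ∞ | ∃ k : ℕ, m = (k : ℕ∞) ∧ IsKFoldLatticeTile k K}

/-- The ten points `±(0, 1)`, `±(1, 1)`, `±(3/2, 1/2)`, `±(3/2, 0)`, `±(1, -1/2)`. -/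
def specialMidpoints : Set Plane :=
  {!₂[0, 1], !₂[1, 1], !₂[3 / 2, 1 / 2], !₂[3 / 2, 0], !₂[1, -1 / 2],
    -!₂[0, 1], -!₂[1, 1], -!₂[3 / 2, 1 / 2], -!₂[3 / 2, 0], -!₂[1, -1 / 2]}

/-! Centre the decagon at the origin, with vertices `v i`, edge vectors `e i` and doubled edge
midpoints `m i = v i + v (i + 1)`, and let `δ` be the determinant of the lattice.

Lower bound. When a generic point crosses edge lines of one direction only, as many translates are
entered as are left. Along the line of an edge this compares two families of unit windows, one for
the edge and one for its opposite, and forces `m i ∈ Λ`, or else `e i ∈ Λ` together with a lattice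
point on `m i + ℝ e i` (`twoMid_mem_or_edge_mem`). The overlap bound gives area at most `k δ`
(`sum_cross_le`), so it remains to bound the area below by `5 δ`. If some `m i` is not in `Λ`, then
`m 0 - m 1 + m 2 - m 3 + m 4 = 0` makes a second one fail. Seven of the ten determinants of pairs of
edges, whose sum is the area, are then at least `δ`, so the area exceeds `5 δ`
(`det_lt_of_twoMid_notMem`). If every `m i` is in `Λ`, the short diagonals `v (i + 2) - v i = m (i +
1) - m i` are lattice vectors. Their determinants, divided by `δ`, are positive integers subject to
five linear relations, one for each way of writing the area, and five Plücker relations. A finite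
search shows that the area is at least `5 δ`, and that equality forces the cyclic pattern 2, 1, 1,
1, 2 (`diagonals_of_twoMid_mem`), which fixes the midpoints up to a linear map
(`exists_linearEquiv`).

Sharpness. A convex quadrilateral and its point reflection together tile the plane under the lattice
generated by its two diagonals (`existsUnique_mem_quad`). The decagon is cut into two quadrilaterals
and their reflections in the centre. For the special decagon, the diagonals of the first
quadrilateral generate `Λ` and those of the second a sublattice of index 4, so the decagon tiles 1 +
4 = 5 times (`isKFoldTiling_five`). -/

open Set Filter Topology MeasureTheory

/-! ### Algebra of the plane determinant. -/

section Cross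

lemma cross_add_left (a b c : Plane) : cross (a + b) c = cross a c + cross b c := by
  simp [cross]; ring

lemma cross_add_right (a b c : Plane) : cross a (b + c) = cross a b + cross a c := by
  simp [cross]; ring

lemma cross_sub_left (a b c : Plane) : cross (a - b) c = cross a c - cross b c := by
  simp [cross]; ring

lemma cross_sub_right (a b c : Plane) : cross a (b - c) = cross a b - cross a c := by
  simp [cross]; ring

lemma cross_neg_left (a b : Plane) : cross (-a) b = -cross a b := by
  simp [cross]; ring

lemma cross_neg_right (a b : Plane) : cross a (-b) = -cross a b := by
  simp [cross]; ring

lemma cross_smul_left (r : ℝ) (a b : Plane) : cross (r • a) b = r * cross a b := by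
  simp [cross]; ring

lemma cross_smul_right (r : ℝ) (a b : Plane) : cross a (r • b) = r * cross a b := by
  simp [cross]; ring

lemma cross_same (a : Plane) : cross a a = 0 := by
  simp [cross]; ring

lemma cross_swap (a b : Plane) : cross b a = -cross a b := by
  simp [cross]; ring

lemma cross_zero_right (a : Plane) : cross a 0 = 0 := by
  simp [cross]

lemma cross_zero_left (a : Plane) : cross 0 a = 0 := by
  simp [cross]

lemma continuous_cross (a : Plane) : Continuous (cross a) := by
  unfold cross; fun_prop

/-- Cramer's rule in the plane. -/
lemma cross_smul_eq (a b x : Plane) : cross a b • x = cross x b • a + cross a x • b := by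
  ext i
  fin_cases i <;> simp [cross] <;> ring

/-- The Plücker relation between three directions of the plane and a fourth vector. -/
lemma cross_plucker (a b c x : Plane) :
    cross a c * cross b x = cross a b * cross c x + cross b c * cross a x := by
  simp [cross]; ring

lemma eq_smul_of_cross_eq_zero {a x : Plane} {b : Plane} (hab : cross a b ≠ 0)
    (h : cross a x = 0) : x = (cross x b / cross a b) • a := by
  have := cross_smul_eq a b x
  rw [h, zero_smul, add_zero] at this
  rw [div_eq_inv_mul, mul_smul, ← this, smul_smul, inv_mul_cancel₀ hab, one_smul]

lemma convex_setOf_le_cross (a : Plane) (r : ℝ) : Convex ℝ {x | r ≤ cross a x} := by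
  intro x hx y hy s t hs ht hst
  simp only [mem_ofPred_eq, cross_add_right, cross_smul_right] at *
  calc r = s * r + t * r := by rw [← add_mul, hst, one_mul]
    _ ≤ _ := by gcongr

end Cross

/-! ### Decagons centred at the origin: signs of determinants and half-planes. -/

/-- `v` enumerates counterclockwise the vertices of a convex decagon which is symmetric about the
origin. -/
structure IsCenteredDecagon (v : ZMod 10 → Plane) : Prop where
  antipode : ∀ i, v (i + 5) = -v i
  convexPosition : ∀ i j : ZMod 10, j ≠ i → j ≠ i + 1 →
    0 < cross (v (i + 1) - v i) (v j - v i)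

/-- The `i`-th edge vector of a closed polygon. -/
def edge (v : ZMod 10 → Plane) (i : ZMod 10) : Plane := v (i + 1) - v i

/-- Twice the midpoint of the `i`-th edge of a closed polygon. -/
def twoMid (v : ZMod 10 → Plane) (i : ZMod 10) : Plane := v i + v (i + 1)

lemma add_ten_ne : ∀ i : ZMod 10, i + 1 + 1 ≠ i ∧ i + 2 + 5 ≠ i ∧ i + 2 + 5 ≠ i + 1 ∧
    i + 1 + 5 ≠ i + 2 ∧ i + 1 + 5 ≠ i + 2 + 1 := by
  decide

namespace IsCenteredDecagon

variable {v : ZMod 10 → Plane}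

lemma rotate (hv : IsCenteredDecagon v) (r : ZMod 10) :
    IsCenteredDecagon (fun i => v (i + r)) where
  antipode i := by
    rw [show i + 5 + r = i + r + 5 by ring, hv.antipode]
  convexPosition i j hji hji' := by
    have := hv.convexPosition (i + r) (j + r) (by simpa using hji)
      (fun h => hji' (by linear_combination h))
    rwa [show i + r + 1 = i + 1 + r by ring] at this

lemma edge_rotate (v : ZMod 10 → Plane) (r i : ZMod 10) :
    edge (fun i => v (i + r)) i = edge v (i + r) := by
  simp only [edge]; rw [show i + 1 + r = i + r + 1 by ring]

lemma twoMid_rotate (v : ZMod 10 → Plane) (r i : ZMod 10) :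
    twoMid (fun i => v (i + r)) i = twoMid v (i + r) := by
  simp only [twoMid]; rw [show i + 1 + r = i + r + 1 by ring]

lemma range_rotate (v : ZMod 10 → Plane) (r : ZMod 10) :
    range (fun i => v (i + r)) = range v :=
  (Equiv.addRight r).surjective.range_comp v

variable (hv : IsCenteredDecagon v)
include hv

lemma edge_add_five (i : ZMod 10) : edge v (i + 5) = -edge v i := by
  simp only [edge]
  rw [show i + 5 + 1 = i + 1 + 5 by ring, hv.antipode, hv.antipode]; abel

lemma twoMid_add_five (i : ZMod 10) : twoMid v (i + 5) = -twoMid v i := by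
  simp only [twoMid]
  rw [show i + 5 + 1 = i + 1 + 5 by ring, hv.antipode, hv.antipode]; abel

lemma cross_succ_pos (i : ZMod 10) : 0 < cross (v i) (v (i + 1)) := by
  have h := hv.convexPosition i (i + 5) (by simp; decide) (by simp; decide)
  rw [hv.antipode] at h
  simp only [cross_sub_left, cross_sub_right, cross_neg_right, cross_same] at h
  rw [cross_swap (v i) (v (i + 1))] at h
  linarith

lemma neg_le_cross_edge (i j : ZMod 10) : -cross (v i) (v (i + 1)) ≤ cross (edge v i) (v j) := by
  have key : cross (edge v i) (v i) = -cross (v i) (v (i + 1)) := by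
    simp only [edge, cross_sub_left, cross_same]; rw [cross_swap (v i)]; ring
  by_cases h1 : j = i
  · rw [h1, key]
  by_cases h2 : j = i + 1
  · rw [h2]; simp only [edge, cross_sub_left, cross_same]; linarith
  have := hv.convexPosition i j h1 h2
  rw [cross_sub_right] at this
  change 0 < cross (edge v i) (v j) - cross (edge v i) (v i) at this
  linarith

lemma neg_lt_cross_edge {i j : ZMod 10} (h1 : j ≠ i) (h2 : j ≠ i + 1) :
    -cross (v i) (v (i + 1)) < cross (edge v i) (v j) := by
  have key : cross (edge v i) (v i) = -cross (v i) (v (i + 1)) := by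
    simp only [edge, cross_sub_left, cross_same]; rw [cross_swap (v i)]; ring
  have := hv.convexPosition i j h1 h2
  rw [cross_sub_right] at this
  change 0 < cross (edge v i) (v j) - cross (edge v i) (v i) at this
  linarith

omit hv in
lemma cross_edge_self (v : ZMod 10 → Plane) (i : ZMod 10) :
    cross (edge v i) (v i) = -cross (v i) (v (i + 1)) := by
  simp only [edge, cross_sub_left, cross_same]; rw [cross_swap (v i)]; ring

omit hv in
lemma cross_edge_succ (v : ZMod 10 → Plane) (i : ZMod 10) :
    cross (edge v i) (v (i + 1)) = -cross (v i) (v (i + 1)) := by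
  simp only [edge, cross_sub_left, cross_same]; ring

lemma cross_edge_one (i : ZMod 10) : 0 < cross (edge v i) (edge v (i + 1)) := by
  have h := hv.neg_lt_cross_edge (i := i) (j := i + 1 + 1)
    (add_ten_ne i).1 (by simp; decide)
  have h' := cross_edge_succ v i
  rw [edge.eq_def v (i + 1), cross_sub_right]
  linarith

/-- Plücker's relation is tested on twice the midpoint of the edge opposite to the middle one. That
point is strictly inside the half-planes of the two outer edges, so both products on the right are
positive, and so is the factor on the left coming from the middle edge. -/
lemma cross_edge_two (i : ZMod 10) : 0 < cross (edge v i) (edge v (i + 2)) := by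
  have p := cross_plucker (edge v i) (edge v (i + 1)) (edge v (i + 2)) (-(v (i + 1) + v (i + 2)))
  have h01 := hv.cross_edge_one i
  have h12 := hv.cross_edge_one (i + 1)
  have e12 : i + 1 + 1 = i + 2 := by ring
  have a0 := cross_edge_succ v i
  have a1 := cross_edge_self v (i + 1)
  have a2 := cross_edge_succ v (i + 1)
  have a3 := cross_edge_self v (i + 2)
  have s1 := hv.cross_succ_pos (i + 1)
  have b0 : cross (edge v i) (v (i + 2)) < cross (v i) (v (i + 1)) := by
    have := hv.neg_lt_cross_edge (i := i) (j := i + 2 + 5) (add_ten_ne i).2.1 (add_ten_ne i).2.2.1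
    rw [hv.antipode, cross_neg_right] at this; linarith
  have b2 : cross (edge v (i + 2)) (v (i + 1)) < cross (v (i + 2)) (v (i + 2 + 1)) := by
    have := hv.neg_lt_cross_edge (i := i + 2) (j := i + 1 + 5)
      (add_ten_ne i).2.2.2.1 (add_ten_ne i).2.2.2.2
    rw [hv.antipode, cross_neg_right] at this; linarith
  simp only [e12] at *
  simp only [cross_neg_right, cross_add_right] at p
  rw [a1, a2, a0, a3] at p
  have q1 : 0 < cross (edge v i) (edge v (i + 1)) *
      (cross (v (i + 2)) (v (i + 2 + 1)) - cross (edge v (i + 2)) (v (i + 1))) :=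
    mul_pos h01 (by linarith)
  have q2 : 0 < cross (edge v (i + 1)) (edge v (i + 2)) *
      (cross (v i) (v (i + 1)) - cross (edge v i) (v (i + 2))) :=
    mul_pos h12 (by linarith)
  have q3 : 0 < cross (edge v i) (edge v (i + 2)) * (2 * cross (v (i + 1)) (v (i + 2))) := by
    linarith
  exact pos_of_mul_pos_left q3 (by linarith)

/-- Since `edge v (i + 5) = -edge v i`, three steps forward amount to two steps from `i + 3` to `i +
5`. -/
lemma cross_edge_three (i : ZMod 10) : 0 < cross (edge v i) (edge v (i + 3)) := by
  have := hv.cross_edge_two (i + 3)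
  rwa [show i + 3 + 2 = i + 5 by ring, hv.edge_add_five, cross_neg_right, ← cross_swap] at this

lemma cross_edge_four (i : ZMod 10) : 0 < cross (edge v i) (edge v (i + 4)) := by
  have := hv.cross_edge_one (i + 4)
  rwa [show i + 4 + 1 = i + 5 by ring, hv.edge_add_five, cross_neg_right, ← cross_swap] at this

omit hv in
lemma eq_add_edge (v : ZMod 10 → Plane) (i : ZMod 10) : v (i + 1) = v i + edge v i := by
  simp [edge]

/-- Half of the boundary leads from `v i` to its antipode `-v i`. -/
lemma two_smul_vertex (i : ZMod 10) : (2 : ℝ) • v i =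
    -(edge v i + edge v (i + 1) + edge v (i + 2) + edge v (i + 3) + edge v (i + 4)) := by
  simp only [edge]
  rw [show i + 1 + 1 = i + 2 by ring, show i + 2 + 1 = i + 3 by ring,
    show i + 3 + 1 = i + 4 by ring, show i + 4 + 1 = i + 5 by ring, hv.antipode, two_smul]
  abel

/-- Expanding `2 • v i` in edges leaves only determinants of edges fewer than five steps apart, all
of the right sign. -/
lemma cross_two_pos (i : ZMod 10) : 0 < cross (v i) (v (i + 2)) := by
  have h2 : v (i + 2) = v i + edge v i + edge v (i + 1) := by
    simp only [edge]; rw [show i + 1 + 1 = i + 2 by ring]; abel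
  have h : 2 * cross (v i) (v (i + 2)) = cross ((2 : ℝ) • v i) (edge v i + edge v (i + 1)) := by
    rw [h2, cross_smul_left, add_assoc, cross_add_right _ (v i), cross_same, zero_add]
  rw [hv.two_smul_vertex] at h
  simp only [cross_neg_left, cross_add_left, cross_add_right, cross_same] at h
  rw [cross_swap (edge v i) (edge v (i + 1)), cross_swap (edge v i) (edge v (i + 2)),
    cross_swap (edge v i) (edge v (i + 3)), cross_swap (edge v i) (edge v (i + 4)),
    cross_swap (edge v (i + 1)) (edge v (i + 2)), cross_swap (edge v (i + 1)) (edge v (i + 3)),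
    cross_swap (edge v (i + 1)) (edge v (i + 4))] at h
  have := hv.cross_edge_two i
  have := hv.cross_edge_three i
  have := hv.cross_edge_four i
  have b1 := hv.cross_edge_one (i + 1)
  have b2 := hv.cross_edge_two (i + 1)
  have b3 := hv.cross_edge_three (i + 1)
  rw [show i + 1 + 1 = i + 2 by ring] at b1
  rw [show i + 1 + 2 = i + 3 by ring] at b2
  rw [show i + 1 + 3 = i + 4 by ring] at b3
  linarith

lemma cross_three_pos (i : ZMod 10) : 0 < cross (v i) (v (i + 3)) := by
  have := hv.cross_two_pos (i + 3)
  rwa [show i + 3 + 2 = i + 5 by ring, hv.antipode, cross_neg_right, ← cross_swap] at this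

lemma cross_four_pos (i : ZMod 10) : 0 < cross (v i) (v (i + 4)) := by
  have := hv.cross_succ_pos (i + 4)
  rwa [show i + 4 + 1 = i + 5 by ring, hv.antipode, cross_neg_right, ← cross_swap] at this

/-- Every vector lies in a cone spanned by two consecutive vertices. -/
lemma exists_cone (x : Plane) :
    ∃ i, ∃ s t : ℝ, 0 ≤ s ∧ 0 ≤ t ∧ x = s • v i + t • v (i + 1) := by
  -- Otherwise a nonnegative sign at one vertex becomes positive at the next, and so on for five
  -- steps, up to the antipode, where the sign must be reversed.
  obtain ⟨i, hi, hi'⟩ : ∃ i, 0 ≤ cross (v i) x ∧ cross (v (i + 1)) x ≤ 0 := by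
    by_contra! H
    obtain ⟨i, hi⟩ : ∃ i, 0 ≤ cross (v i) x := by
      rcases le_total 0 (cross (v 0) x) with h | h
      · exact ⟨0, h⟩
      · refine ⟨0 + 5, ?_⟩
        rw [hv.antipode, cross_neg_left]; linarith
    have h1 := H i hi
    have h2 := H _ h1.le
    have h3 := H _ h2.le
    have h4 := H _ h3.le
    have h5 := H _ h4.le
    rw [show i + 1 + 1 + 1 + 1 + 1 = i + 5 by ring, hv.antipode, cross_neg_left] at h5
    linarith
  have hpos := hv.cross_succ_pos i
  refine ⟨i, cross x (v (i + 1)) / cross (v i) (v (i + 1)),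
    cross (v i) x / cross (v i) (v (i + 1)), ?_, div_nonneg hi hpos.le, ?_⟩
  · rw [cross_swap (v (i + 1)) x]
    exact div_nonneg (by linarith) hpos.le
  · have := cross_smul_eq (v i) (v (i + 1)) x
    rw [div_eq_inv_mul, div_eq_inv_mul, mul_smul, mul_smul, ← smul_add, ← this, smul_smul,
      inv_mul_cancel₀ hpos.ne', one_smul]

lemma zero_mem : (0 : Plane) ∈ convexHull ℝ (range v) := by
  have h0 : v 0 ∈ convexHull ℝ (range v) := subset_convexHull ℝ _ ⟨0, rfl⟩
  have h5 : -v 0 ∈ convexHull ℝ (range v) := by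
    rw [← hv.antipode]; exact subset_convexHull ℝ _ ⟨_, rfl⟩
  have := (convex_convexHull ℝ (range v)) h0 h5 (a := 1/2) (b := 1/2)
    (by norm_num) (by norm_num) (by norm_num)
  simpa using this

lemma cone_mem (i : ZMod 10) {s t : ℝ} (hs : 0 ≤ s) (ht : 0 ≤ t) (hst : s + t ≤ 1) :
    s • v i + t • v (i + 1) ∈ convexHull ℝ (range v) := by
  have h0 : v i ∈ convexHull ℝ (range v) := subset_convexHull ℝ _ ⟨i, rfl⟩
  have h1 : v (i + 1) ∈ convexHull ℝ (range v) := subset_convexHull ℝ _ ⟨i + 1, rfl⟩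
  have h2 := hv.zero_mem
  have := (convex_convexHull ℝ (range v)).sum_mem (t := Finset.univ) (w := ![s, t, 1 - s - t])
    (z := ![v i, v (i + 1), 0]) (by intro j _; fin_cases j <;> simp <;> linarith)
    (by simp [Fin.sum_univ_three]) (by intro j _; fin_cases j <;> simpa)
  simpa [Fin.sum_univ_three] using this

/-- A centred decagon is the intersection of the half-planes given by its edges. -/
lemma mem_iff (x : Plane) : x ∈ convexHull ℝ (range v) ↔
    ∀ i, -cross (v i) (v (i + 1)) ≤ cross (edge v i) x := by
  constructor
  · intro hx i
    have : range v ⊆ {x | -cross (v i) (v (i + 1)) ≤ cross (edge v i) x} := by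
      rintro _ ⟨j, rfl⟩
      exact hv.neg_le_cross_edge i j
    exact convexHull_min this (convex_setOf_le_cross _ _) hx
  · intro H
    obtain ⟨i, s, t, hs, ht, rfl⟩ := hv.exists_cone x
    refine hv.cone_mem i hs ht ?_
    have := H i
    rw [cross_add_right, cross_smul_right, cross_smul_right, cross_edge_self,
      cross_edge_succ] at this
    have hpos := hv.cross_succ_pos i
    by_contra! h
    nlinarith

lemma mem_interior {x : Plane} (h : ∀ i, -cross (v i) (v (i + 1)) < cross (edge v i) x) :
    x ∈ interior (convexHull ℝ (range v)) := by
  rw [_root_.mem_interior]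
  refine ⟨⋂ i, {x | -cross (v i) (v (i + 1)) < cross (edge v i) x}, ?_, ?_, by simpa using h⟩
  · intro y hy
    rw [hv.mem_iff]
    intro i
    exact (mem_iInter.1 hy i).le
  · exact isOpen_iInter_of_finite fun i => isOpen_lt continuous_const (continuous_cross _)

lemma neg_mem {x : Plane} (hx : x ∈ convexHull ℝ (range v)) : -x ∈ convexHull ℝ (range v) := by
  rw [hv.mem_iff] at hx ⊢
  intro i
  have := hx (i + 5)
  rw [hv.edge_add_five, cross_neg_left, show i + 5 + 1 = i + 1 + 5 by ring, hv.antipode,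
    hv.antipode, cross_neg_left (v i), cross_neg_right, neg_neg] at this
  rwa [cross_neg_right]

/-- The face of a centred decagon in the direction of an edge is that edge. -/
lemma exists_of_cross_edge_eq {x : Plane} (hx : x ∈ convexHull ℝ (range v)) {i : ZMod 10}
    (h : cross (edge v i) x = -cross (v i) (v (i + 1))) :
    ∃ s : ℝ, 0 ≤ s ∧ s ≤ 1 ∧ x = v i + s • edge v i := by
  have h1 := hv.cross_edge_one i
  have h0 : cross (edge v i) (x - v i) = 0 := by
    rw [cross_sub_right, h, cross_edge_self]; ring
  have hs := eq_smul_of_cross_eq_zero h1.ne' h0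
  set s := cross (x - v i) (edge v (i + 1)) / cross (edge v i) (edge v (i + 1))
  have hx' : x = v i + s • edge v i := by rw [← hs]; abel
  rw [hv.mem_iff] at hx
  refine ⟨s, ?_, ?_, hx'⟩
  -- The two neighbouring edges bound the parameter: the preceding one gives `0 ≤ s`, the following
  -- one `s ≤ 1`.
  · obtain ⟨j, rfl⟩ : ∃ j, i = j + 1 := ⟨i - 1, by ring⟩
    have hj := hx j
    have hj1 := hv.cross_edge_one j
    rw [hx', cross_add_right, cross_smul_right, cross_edge_succ] at hj
    by_contra! hneg
    nlinarith
  · have hj := hx (i + 1)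
    rw [show x = v (i + 1) + (s - 1) • edge v i by rw [hx', eq_add_edge v i]; module,
      cross_add_right, cross_smul_right, cross_edge_self,
      cross_swap (edge v i) (edge v (i + 1))] at hj
    by_contra! hneg
    nlinarith

end IsCenteredDecagon

/-! ### Semicontinuity of the covering by lattice translates. -/

section Translates

variable {K : Set Plane} (Λ : Submodule ℤ Plane) [DiscreteTopology Λ]

lemma lattice_countable : (Λ : Set Plane).Countable := by
  have : Countable Λ := countable_of_Lindelof_of_discrete
  exact Set.to_countable _

lemma lattice_inter_finite {s : Set Plane} (hs : Bornology.IsBounded s) :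
    (s ∩ (Λ : Set Plane)).Finite := by
  refine Metric.finite_isBounded_inter_isClosed DiscreteTopology.isDiscrete hs ?_
  rw [← Submodule.coe_toAddSubgroup]
  have : DiscreteTopology Λ.toAddSubgroup := inferInstanceAs (DiscreteTopology Λ)
  exact AddSubgroup.isClosed_of_discrete

lemma translates_near_finite (hK : IsCompact K) (x : Plane) :
    {w ∈ (Λ : Set Plane) | ∃ y ∈ Metric.closedBall x 1, y - w ∈ K}.Finite := by
  have hb : Bornology.IsBounded ((fun p : Plane × Plane => p.1 - p.2) ''
      (Metric.closedBall x 1 ×ˢ K)) :=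
    (((isCompact_closedBall x 1).prod hK).image (by fun_prop)).isBounded
  refine (lattice_inter_finite Λ hb).subset ?_
  rintro w ⟨hw, y, hy, hyw⟩
  exact ⟨⟨(y, y - w), ⟨hy, hyw⟩, by simp⟩, hw⟩

lemma translates_finite (hK : IsCompact K) (x : Plane) :
    {w ∈ (Λ : Set Plane) | x - w ∈ K}.Finite :=
  (translates_near_finite Λ hK x).subset fun _ hw =>
    ⟨hw.1, x, Metric.mem_closedBall_self zero_le_one, hw.2⟩

/-- Upper semicontinuity: only finitely many translates come near `x`, and each closed one that
misses `x` also misses a neighbourhood of it. -/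
lemma eventually_translates_subset (hK : IsCompact K) (x : Plane) :
    ∀ᶠ y in 𝓝 x, {w ∈ (Λ : Set Plane) | y - w ∈ K} ⊆ {w ∈ (Λ : Set Plane) | x - w ∈ K} := by
  have hfin := translates_near_finite Λ hK x
  have h1 : ∀ᶠ y in 𝓝 x,
      ∀ w ∈ {w ∈ (Λ : Set Plane) | ∃ y ∈ Metric.closedBall x 1, y - w ∈ K},
        x - w ∉ K → y - w ∉ K := by
    rw [eventually_all_finite hfin]
    intro w _
    by_cases hxw : x - w ∈ K
    · simp [hxw]
    · have : ∀ᶠ z in 𝓝 (x - w), z ∉ K := hK.isClosed.isOpen_compl.mem_nhds hxw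
      have hc : Tendsto (fun y => y - w) (𝓝 x) (𝓝 (x - w)) :=
        (continuous_id.sub continuous_const).tendsto x
      filter_upwards [hc.eventually this] with y hy _ using hy
  filter_upwards [h1, Metric.closedBall_mem_nhds x zero_lt_one] with y hy hyb w hw
  by_contra hcon
  exact hy w ⟨hw.1, y, hyb, hw.2⟩ (fun h => hcon ⟨hw.1, h⟩) hw.2

/-- Lower semicontinuity for the open translates: the finitely many that contain `x` contain a
common neighbourhood. -/
lemma eventually_subset_translates_interior (hK : IsCompact K) (x : Plane) :
    ∀ᶠ y in 𝓝 x, {w ∈ (Λ : Set Plane) | x - w ∈ interior K} ⊆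
      {w ∈ (Λ : Set Plane) | y - w ∈ interior K} := by
  have hfin : {w ∈ (Λ : Set Plane) | x - w ∈ interior K}.Finite :=
    (translates_finite Λ hK x).subset fun w hw => ⟨hw.1, interior_subset hw.2⟩
  have h1 : ∀ᶠ y in 𝓝 x, ∀ w ∈ {w ∈ (Λ : Set Plane) | x - w ∈ interior K},
      y - w ∈ interior K := by
    rw [eventually_all_finite hfin]
    intro w hw
    have hc : Tendsto (fun y => y - w) (𝓝 x) (𝓝 (x - w)) :=
      (continuous_id.sub continuous_const).tendsto x
    exact hc.eventually (isOpen_interior.mem_nhds hw.2)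
  filter_upwards [h1] with y hy w hw using ⟨hw.1, hy w hw⟩

end Translates

/-! ### The lattice condition on each edge. -/

/-- If almost all unit windows contain as many points of `G` as of `C`, then `C` begins where
`G` does. -/
lemma zero_mem_of_ncard_window_eq {G C B : Set ℝ} (hB : B.Countable)
    (hG : ∀ a b, (G ∩ Icc a b).Finite) (hC : ∀ a b, (C ∩ Icc a b).Finite)
    (h : ∀ t ∉ B, (G ∩ Icc (t - 1) t).ncard = (C ∩ Icc (t - 1) t).ncard)
    (h0 : (0 : ℝ) ∈ G) (h1 : (-1 : ℝ) ∉ G) : (0 : ℝ) ∈ C := by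
  -- As `t` increases through 0, the window `[t - 1, t]` gains the point 0 of `G` and loses none,
  -- because `-1 ∉ G`. If `0 ∉ C`, then `C` gains nothing there, so the two counts cannot agree on
  -- both sides. Density of the complement of `B` supplies admissible `t` on each side.
  by_contra hC0
  have shrink : ∀ X : Set ℝ, (∀ a b, (X ∩ Icc a b).Finite) →
      ∀ᶠ t in 𝓝 (0 : ℝ), X ∩ Icc (t - 1) t ⊆ X ∩ Icc (-1) 0 := by
    intro X hX
    have h1 : ∀ᶠ t in 𝓝 (0 : ℝ), ∀ g ∈ X ∩ Icc (-2) 1,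
        g ∉ Icc (-1 : ℝ) 0 → g ∉ Icc (t - 1) t := by
      rw [eventually_all_finite (hX _ _)]
      intro g _
      by_cases hg : g ∈ Icc (-1 : ℝ) 0
      · simp [hg]
      · rw [mem_Icc, not_and_or, not_le, not_le] at hg
        rcases hg with hg | hg
        · filter_upwards [lt_mem_nhds (show g + 1 < 0 by linarith)] with t ht _ hgt
          linarith [hgt.1]
        · filter_upwards [gt_mem_nhds hg] with t ht _ hgt
          linarith [hgt.2]
    filter_upwards [h1, lt_mem_nhds (show (-1 : ℝ) < 0 by norm_num),
      gt_mem_nhds (show (0 : ℝ) < 1 by norm_num)] with t ht ht1 ht2 g hg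
    by_contra hcon
    exact ht g ⟨hg.1, by linarith [hg.2.1], by linarith [hg.2.2]⟩ (fun h => hcon ⟨hg.1, h⟩) hg.2
  have gen : ∀ X : Set ℝ, (∀ a b, (X ∩ Icc a b).Finite) →
      ∀ t, (X ∩ Icc (t - 1) t).Finite := fun X hX t => hX _ _
  have hd : Dense Bᶜ := hB.dense_compl ℝ
  -- windows just to the right of the origin
  have hr : ∀ᶠ t in 𝓝[>] (0 : ℝ), G ∩ Icc (-1) 0 ⊆ G ∩ Icc (t - 1) t := by
    have : ∀ᶠ t in 𝓝[>] (0 : ℝ), ∀ g ∈ G ∩ Icc (-1) 0, t - 1 ≤ g := by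
      rw [eventually_all_finite (hG _ _)]
      rintro g ⟨hgG, hg⟩
      have hg1 : 0 < g + 1 := by
        rcases hg.1.eq_or_lt with h | h
        · exact absurd (h ▸ hgG) h1
        · linarith
      filter_upwards [mem_nhdsWithin_of_mem_nhds (gt_mem_nhds hg1)] with t ht
      linarith
    filter_upwards [this, self_mem_nhdsWithin] with t ht htpos g hg
    exact ⟨hg.1, ht g hg, hg.2.2.trans (le_of_lt htpos)⟩
  have hl : ∀ᶠ t in 𝓝[<] (0 : ℝ), C ∩ Icc (-1) 0 ⊆ C ∩ Icc (t - 1) t := by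
    have : ∀ᶠ t in 𝓝[<] (0 : ℝ), ∀ g ∈ C ∩ Icc (-1) 0, g ≤ t := by
      rw [eventually_all_finite (hC _ _)]
      rintro g ⟨hgG, hg⟩
      have hg1 : g < 0 := by
        rcases hg.2.eq_or_lt with h | h
        · exact absurd (h ▸ hgG) hC0
        · exact h
      filter_upwards [mem_nhdsWithin_of_mem_nhds (lt_mem_nhds hg1)] with t ht
      exact le_of_lt ht
    filter_upwards [this, self_mem_nhdsWithin] with t ht htneg g hg
    have htneg : t < 0 := htneg
    exact ⟨hg.1, by linarith [hg.2.1], ht g hg⟩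
  obtain ⟨b, hb, hbr⟩ := (mem_nhdsGT_iff_exists_Ioo_subset (a := (0 : ℝ))).1
    (hr.and (mem_nhdsWithin_of_mem_nhds (shrink C hC)))
  obtain ⟨t, htB, ht⟩ := hd.exists_between hb
  obtain ⟨a, ha, hal⟩ := (mem_nhdsLT_iff_exists_Ioo_subset (a := (0 : ℝ))).1
    (hl.and (mem_nhdsWithin_of_mem_nhds (shrink G hG)))
  obtain ⟨t', htB', ht'⟩ := hd.exists_between ha
  obtain ⟨r1, r2⟩ := hbr ht
  obtain ⟨l1, l2⟩ := hal ht'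
  have i1 := ncard_le_ncard r1 (hG _ _)
  have i2 := ncard_le_ncard r2 (hC _ _)
  have i3 := ncard_le_ncard l1 (hC _ _)
  have i4 : (G ∩ Icc (t' - 1) t').ncard < (G ∩ Icc (-1) 0).ncard := by
    refine ncard_lt_ncard ⟨l2, fun hsub => ?_⟩ (hG _ _)
    have := (hsub ⟨h0, by norm_num, le_rfl⟩).2.2
    linarith [ht'.2]
  have := h t htB
  have := h t' htB'
  omega

namespace IsCenteredDecagon

lemma isCompact_hull (v : ZMod 10 → Plane) : IsCompact (convexHull ℝ (range v)) :=
  (finite_range v).isCompact_convexHull ℝ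

variable {v : ZMod 10 → Plane} (hv : IsCenteredDecagon v)

include hv

lemma cross_edge_ne_zero {i j : ZMod 10} (h : j ≠ i) (h' : j ≠ i + 5) :
    cross (edge v j) (edge v i) ≠ 0 := by
  have key : ∀ d : ZMod 10, d = 0 ∨ d = 1 ∨ d = 2 ∨ d = 3 ∨ d = 4 ∨ d = 5 ∨ d = 1 + 5 ∨
      d = 2 + 5 ∨ d = 3 + 5 ∨ d = 4 + 5 := by decide
  obtain ⟨d, rfl⟩ : ∃ d, j = i + d := ⟨j - i, by ring⟩
  have h1 := hv.cross_edge_one i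
  have h2 := hv.cross_edge_two i
  have h3 := hv.cross_edge_three i
  have h4 := hv.cross_edge_four i
  rw [cross_swap (edge v i), neg_ne_zero]
  rcases key d with rfl | rfl | rfl | rfl | rfl | rfl | rfl | rfl | rfl | rfl
  · simp at h
  · exact h1.ne'
  · exact h2.ne'
  · exact h3.ne'
  · exact h4.ne'
  · exact absurd rfl h'
  all_goals
    rw [← add_assoc, hv.edge_add_five, cross_neg_right, neg_ne_zero]
    apply ne_of_gt; assumption

variable {Λ : Submodule ℤ Plane} [DiscreteTopology Λ] {k : ℕ}

/-- Moving a point that lies on translates of one pair of opposite edges only across these edges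
shows how many translates it lies in without being on the first edge. -/
lemma encard_translates_off_edge
    (hT : IsKFoldTiling k (convexHull ℝ (range v)) (Λ : Set Plane)) {i : ZMod 10} {x : Plane}
    (hx : ∀ w ∈ Λ, ∀ j, j ≠ i → j ≠ i + 5 →
      cross (edge v j) (x - w) ≠ -cross (v j) (v (j + 1))) :
    {w ∈ (Λ : Set Plane) | x - w ∈ convexHull ℝ (range v) ∧
      cross (edge v i) (x - w) ≠ -cross (v i) (v (i + 1))}.encard = k := by
  set S := {w ∈ (Λ : Set Plane) | x - w ∈ convexHull ℝ (range v) ∧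
      cross (edge v i) (x - w) ≠ -cross (v i) (v (i + 1))} with hS
  have hSfin : S.Finite := (translates_finite Λ (isCompact_hull v) x).subset
    fun w hw => ⟨hw.1, hw.2.1⟩
  have hm := hv.cross_edge_one i
  have hlim : Tendsto (fun ε : ℝ => x - ε • edge v (i + 1)) (𝓝[>] 0) (𝓝 x) := by
    have : Continuous (fun ε : ℝ => x - ε • edge v (i + 1)) := by fun_prop
    have := this.tendsto 0
    simp only [zero_smul, sub_zero] at this
    exact this.mono_left nhdsWithin_le_nhds
  have hstrict : ∀ᶠ ε in 𝓝[>] (0 : ℝ), ∀ w ∈ S, ∀ j, j ≠ i + 5 →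
      -cross (v j) (v (j + 1)) < cross (edge v j) (x - ε • edge v (i + 1) - w) := by
    rw [eventually_all_finite hSfin]
    intro w hw
    rw [eventually_all]
    intro j
    by_cases hj5 : j = i + 5
    · simp [hj5]
    have h0 : -cross (v j) (v (j + 1)) < cross (edge v j) (x - w) := by
      refine lt_of_le_of_ne ((hv.mem_iff _).1 hw.2.1 j) (Ne.symm ?_)
      by_cases hj : j = i
      · rw [hj]; exact hw.2.2
      · exact hx w hw.1 j hj hj5
    have hc : Tendsto (fun y => cross (edge v j) (y - w)) (𝓝 x)
        (𝓝 (cross (edge v j) (x - w))) :=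
      ((continuous_cross _).comp (continuous_id.sub continuous_const)).tendsto x
    filter_upwards [(hc.comp hlim).eventually (lt_mem_nhds h0)] with ε hε _ using hε
  have hself : ∀ᶠ ε in 𝓝[>] (0 : ℝ), 0 < ε := self_mem_nhdsWithin
  -- Shifting by `-ε • edge v (i + 1)` leaves the polygon across edge `i` and enters it across edge
  -- `i + 5`. Translates with `x` on edge `i` are lost, and those counted in `S` acquire the shifted
  -- point as an interior point.
  obtain ⟨ε, hε, hsub, hst⟩ := (hself.and
    ((hlim.eventually (eventually_translates_subset Λ (isCompact_hull v) x)).and hstrict)).exists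
  have move : ∀ w, cross (edge v i) (x - ε • edge v (i + 1) - w) =
      cross (edge v i) (x - w) - ε * cross (edge v i) (edge v (i + 1)) := by
    intro w
    rw [show x - ε • edge v (i + 1) - w = (x - w) - ε • edge v (i + 1) by abel, cross_sub_right,
      cross_smul_right]
  have hpos := mul_pos hε hm
  apply le_antisymm
  · refine (encard_le_encard ?_).trans (hT (x - ε • edge v (i + 1))).2
    intro w hw
    refine ⟨hw.1, hv.mem_interior fun j => ?_⟩
    by_cases hj5 : j = i + 5
    · have := (hv.mem_iff _).1 hw.2.1 j
      subst hj5
      rw [hv.edge_add_five, cross_neg_left] at this ⊢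
      rw [move]
      linarith
    · exact hst w hw j hj5
  · refine (hT (x - ε • edge v (i + 1))).1.trans (encard_le_encard ?_)
    intro w hw
    refine ⟨hw.1, (hsub hw).2, fun h => ?_⟩
    have := (hv.mem_iff _).1 hw.2 i
    rw [move, h] at this
    linarith

/-- Either count, increased by `k`, is the number of all translates containing `x`. -/
lemma ncard_translates_on_edge
    (hT : IsKFoldTiling k (convexHull ℝ (range v)) (Λ : Set Plane)) {i : ZMod 10} {x : Plane}
    (hx : ∀ w ∈ Λ, ∀ j, j ≠ i → j ≠ i + 5 →
      cross (edge v j) (x - w) ≠ -cross (v j) (v (j + 1))) :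
    {w ∈ (Λ : Set Plane) | x - w ∈ convexHull ℝ (range v) ∧
      cross (edge v i) (x - w) = -cross (v i) (v (i + 1))}.ncard =
    {w ∈ (Λ : Set Plane) | x - w ∈ convexHull ℝ (range v) ∧
      cross (edge v (i + 5)) (x - w) = -cross (v (i + 5)) (v (i + 5 + 1))}.ncard := by
  have hfin := translates_finite Λ (isCompact_hull v) x
  have key : ∀ q : Plane → Prop,
      {w ∈ (Λ : Set Plane) | x - w ∈ convexHull ℝ (range v) ∧ ¬ q w}.encard = k →
      {w ∈ (Λ : Set Plane) | x - w ∈ convexHull ℝ (range v) ∧ q w}.ncard + k =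
        {w ∈ (Λ : Set Plane) | x - w ∈ convexHull ℝ (range v)}.ncard := by
    intro q hq
    have hq' : {w ∈ (Λ : Set Plane) | x - w ∈ convexHull ℝ (range v) ∧ ¬ q w}.ncard = k := by
      rw [ncard, hq]; rfl
    rw [← hq', ← ncard_union_eq ?_ (hfin.subset fun w hw => ⟨hw.1, hw.2.1⟩)
      (hfin.subset fun w hw => ⟨hw.1, hw.2.1⟩)]
    · congr 1
      ext w
      simp only [mem_union, mem_ofPred_eq]
      tauto
    · rw [disjoint_left]
      rintro w ⟨_, _, h⟩ ⟨_, _, h'⟩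
      exact h' h
  have h1 := key _ (hv.encard_translates_off_edge hT hx)
  have h2 := key _ (hv.encard_translates_off_edge (i := i + 5) hT fun w hw j hj hj' =>
    hx w hw j (by rwa [add_assoc, show (5 + 5 : ZMod 10) = 0 from rfl, add_zero] at hj') hj)
  omega

-- A translate whose edge `i` passes through a point of the line of edge `i` is displaced along this
-- line; the edge being a unit interval in the parameter, the displacements fill a unit window.
omit [DiscreteTopology Λ] in
lemma translates_on_edge_eq_image (i : ZMod 10) (t : ℝ) :
    {w ∈ (Λ : Set Plane) | v i + t • edge v i - w ∈ convexHull ℝ (range v) ∧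
      cross (edge v i) (v i + t • edge v i - w) = -cross (v i) (v (i + 1))} =
    (fun g : ℝ => g • edge v i) '' ({g | g • edge v i ∈ Λ} ∩ Icc (t - 1) t) := by
  ext w
  constructor
  · rintro ⟨hw, hP, hc⟩
    obtain ⟨s, hs0, hs1, hs⟩ := hv.exists_of_cross_edge_eq hP hc
    have : (t - s) • edge v i = w := by
      have : w = v i + t • edge v i - (v i + s • edge v i) := by rw [← hs]; abel
      rw [this]; module
    exact ⟨t - s, ⟨by rw [mem_ofPred_eq, this]; exact hw, by linarith, by linarith⟩, this⟩
  · rintro ⟨g, ⟨hg, hg1, hg2⟩, rfl⟩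
    have e : v i + t • edge v i - g • edge v i = (1 - (t - g)) • v i + (t - g) • v (i + 1) := by
      rw [eq_add_edge v i]; module
    refine ⟨hg, ?_, ?_⟩
    · simp only [e]
      exact hv.cone_mem i (by linarith) (by linarith) (by linarith)
    · simp only [e, cross_add_right, cross_smul_right, cross_edge_self, cross_edge_succ]; ring

-- Measuring displacements from the doubled midpoint yields the same window `[t - 1, t]` for the
-- opposite edge.
omit [DiscreteTopology Λ] in
lemma translates_on_opposite_edge_eq_image (i : ZMod 10) (t : ℝ) :
    {w ∈ (Λ : Set Plane) | v i + t • edge v i - w ∈ convexHull ℝ (range v) ∧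
      cross (edge v (i + 5)) (v i + t • edge v i - w) =
        -cross (v (i + 5)) (v (i + 5 + 1))} =
    (fun c : ℝ => twoMid v i + c • edge v i) ''
      ({c | twoMid v i + c • edge v i ∈ Λ} ∩ Icc (t - 1) t) := by
  have e5 : v (i + 5 + 1) = -v (i + 1) := by
    rw [show i + 5 + 1 = i + 1 + 5 by ring, hv.antipode]
  ext w
  constructor
  · rintro ⟨hw, hP, hc⟩
    obtain ⟨s, hs0, hs1, hs⟩ := hv.exists_of_cross_edge_eq hP hc
    rw [hv.antipode, hv.edge_add_five] at hs
    have : twoMid v i + (t + s - 1) • edge v i = w := by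
      have : w = v i + t • edge v i - (-v i + s • -edge v i) := by rw [← hs]; abel
      rw [this, twoMid, eq_add_edge v i]; module
    exact ⟨t + s - 1, ⟨by rw [mem_ofPred_eq, this]; exact hw, by linarith, by linarith⟩, this⟩
  · rintro ⟨c, ⟨hc, hc1, hc2⟩, rfl⟩
    have e : v i + t • edge v i - (twoMid v i + c • edge v i) =
        (1 - (c + 1 - t)) • v (i + 5) + (c + 1 - t) • v (i + 5 + 1) := by
      rw [e5, hv.antipode, twoMid, eq_add_edge v i]; module
    refine ⟨hc, ?_, ?_⟩
    · simp only [e]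
      exact hv.cone_mem _ (by linarith) (by linarith) (by linarith)
    · simp only [e, cross_add_right, cross_smul_right, cross_edge_self, cross_edge_succ]; ring

/-- Each edge of a multiple lattice tile has its midpoint in half the lattice, or is itself a
lattice vector and meets half the lattice. -/
theorem twoMid_mem_or_edge_mem
    (hT : IsKFoldTiling k (convexHull ℝ (range v)) (Λ : Set Plane)) (i : ZMod 10) :
    twoMid v i ∈ Λ ∨ (edge v i ∈ Λ ∧ ∃ c : ℝ, twoMid v i + c • edge v i ∈ Λ) := by
  -- The exceptional parameters: the point is on the line of a non-parallel edge of some translate.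
  -- Each translate and edge contributes at most one `t`.
  set B : Set ℝ := {t | ∃ w ∈ Λ, ∃ j, j ≠ i ∧ j ≠ i + 5 ∧
    cross (edge v j) (v i + t • edge v i - w) = -cross (v j) (v (j + 1))} with hBdef
  have hB : B.Countable := by
    have : B ⊆ ⋃ w ∈ (Λ : Set Plane), ⋃ j, {t | j ≠ i ∧ j ≠ i + 5 ∧
        cross (edge v j) (v i + t • edge v i - w) = -cross (v j) (v (j + 1))} := by
      rintro t ⟨w, hw, j, h⟩
      simp only [mem_iUnion]
      exact ⟨w, hw, j, h⟩
    refine Countable.mono this ((lattice_countable Λ).biUnion fun w _ => countable_iUnion fun j =>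
      Subsingleton.countable ?_)
    rintro t ⟨h, h', ht⟩ t' ⟨_, _, ht'⟩
    have hne := hv.cross_edge_ne_zero h h'
    simp only [cross_sub_right, cross_add_right, cross_smul_right] at ht ht'
    exact mul_right_cancel₀ hne (by linarith)
  have e0 : edge v i ≠ 0 := by
    intro h
    have := hv.cross_edge_one i
    rw [h, cross_zero_left] at this
    exact this.false
  have injG : Function.Injective (fun g : ℝ => g • edge v i) := smul_left_injective ℝ e0
  have injC : Function.Injective (fun c : ℝ => twoMid v i + c • edge v i) :=
    (add_right_injective _).comp injG
  have hwin : ∀ t ∉ B, ({g | g • edge v i ∈ Λ} ∩ Icc (t - 1) t).ncard =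
      ({c | twoMid v i + c • edge v i ∈ Λ} ∩ Icc (t - 1) t).ncard := by
    intro t ht
    have := hv.ncard_translates_on_edge (i := i) (x := v i + t • edge v i) hT
      (fun w hw j hj hj' h => ht ⟨w, hw, j, hj, hj', h⟩)
    rw [hv.translates_on_edge_eq_image, hv.translates_on_opposite_edge_eq_image,
      ncard_image_of_injective _ injG, ncard_image_of_injective _ injC] at this
    exact this
  have hfin : ∀ p : Plane, ∀ a b, ({g : ℝ | p + g • edge v i ∈ Λ} ∩ Icc a b).Finite := by
    intro p a b
    have inj : Function.Injective (fun g : ℝ => p + g • edge v i) :=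
      (add_right_injective p).comp injG
    have hb : IsCompact ((fun g : ℝ => p + g • edge v i) '' Icc a b) :=
      isCompact_Icc.image (by fun_prop)
    refine Finite.of_finite_image ((lattice_inter_finite Λ hb.isBounded).subset ?_)
      (inj.injOn)
    rintro _ ⟨g, ⟨hg, hg'⟩, rfl⟩
    exact ⟨⟨g, hg', rfl⟩, hg⟩
  have hfinG : ∀ a b, ({g : ℝ | g • edge v i ∈ Λ} ∩ Icc a b).Finite := by
    simpa using hfin 0
  -- If the edge is a lattice vector, equal counts only show that the second set is nonempty.
  -- Otherwise `-1` is not in the first set, and the window lemma places 0 in the second.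
  by_cases he : edge v i ∈ Λ
  · right
    refine ⟨he, ?_⟩
    obtain ⟨t, htB, ht⟩ := (hB.dense_compl ℝ).exists_between (show (0 : ℝ) < 1 by norm_num)
    have hpos : 0 < ({g | g • edge v i ∈ Λ} ∩ Icc (t - 1) t).ncard := by
      rw [ncard_pos (hfinG _ _)]
      exact ⟨0, by simp, by linarith [ht.2], ht.1.le⟩
    rw [hwin t htB, ncard_pos (hfin _ _ _)] at hpos
    obtain ⟨c, hc, _⟩ := hpos
    exact ⟨c, hc⟩
  · left
    have := zero_mem_of_ncard_window_eq hB hfinG (hfin (twoMid v i)) hwin (by simp)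
      (by simpa using he)
    simpa using this

end IsCenteredDecagon

/-! ### Comparison of the area of the decagon with the determinant of the lattice. -/

/-- The linear map with columns `p` and `q`. -/
noncomputable def planeMap (p q : Plane) : Plane →ₗ[ℝ] Plane where
  toFun u := u 0 • p + u 1 • q
  map_add' u w := by simp only [PiLp.add_apply]; module
  map_smul' r u := by simp only [PiLp.smul_apply, smul_eq_mul, RingHom.id_apply]; module

lemma planeMap_apply (p q u : Plane) : planeMap p q u = u 0 • p + u 1 • q := rfl

lemma det_planeMap (p q : Plane) : LinearMap.det (planeMap p q) = cross p q := by
  rw [← LinearMap.det_toMatrix (EuclideanSpace.basisFun (Fin 2) ℝ).toBasis, Matrix.det_fin_two]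
  simp [LinearMap.toMatrix_apply, planeMap_apply, cross]
  ring

lemma volume_setOf_cross_eq {a : Plane} (ha : a ≠ 0) (c : ℝ) :
    volume {x | cross a x = c} = 0 := by
  rcases {x | cross a x = c}.eq_empty_or_nonempty with h | ⟨x₀, hx₀⟩
  · rw [h, measure_empty]
  let ℓ : Plane →ₗ[ℝ] ℝ :=
    { toFun := cross a
      map_add' := cross_add_right a
      map_smul' := fun r x => cross_smul_right r a x }
  have hset : {x | cross a x = c} = (fun x => x + -x₀) ⁻¹' (LinearMap.ker ℓ : Set Plane) := by
    ext x
    have hx₀ : cross a x₀ = c := hx₀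
    change cross a x = c ↔ cross a (x + -x₀) = 0
    rw [cross_add_right, cross_neg_right, hx₀, add_neg_eq_zero]
  rw [hset, measure_preimage_add_right]
  refine Measure.addHaar_submodule volume _ fun htop => ha ?_
  have hall : ∀ x, cross a x = 0 := fun x => by
    have : x ∈ LinearMap.ker ℓ := htop ▸ Submodule.mem_top
    exact this
  have h0 := hall !₂[1, 0]
  have h1 := hall !₂[0, 1]
  simp [cross] at h0 h1
  ext i
  fin_cases i <;> simpa

/-- The half-open unit square. -/
def unitSquare : Set Plane := {u | 0 ≤ u 0 ∧ u 0 < 1 ∧ 0 ≤ u 1 ∧ u 1 < 1}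

/-- The open standard triangle. -/
def unitTriangle : Set Plane := {u | 0 < u 0 ∧ 0 < u 1 ∧ u 0 + u 1 < 1}

lemma isOpen_unitTriangle : IsOpen unitTriangle := by
  have h0 : IsOpen {u : Plane | 0 < u 0} := isOpen_lt continuous_const (by fun_prop)
  have h1 : IsOpen {u : Plane | 0 < u 1} := isOpen_lt continuous_const (by fun_prop)
  have h2 : IsOpen {u : Plane | u 0 + u 1 < 1} := isOpen_lt (by fun_prop) continuous_const
  exact h0.inter (h1.inter h2)

lemma volume_unitTriangle_pos : 0 < volume unitTriangle :=
  isOpen_unitTriangle.measure_pos volume ⟨!₂[1 / 3, 1 / 3], by simp [unitTriangle]; norm_num⟩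

lemma volume_unitTriangle_lt_top : volume unitTriangle < ⊤ := by
  have : unitTriangle ⊆ planeMap !₂[1, 0] !₂[0, 1] ''
      (Metric.closedBall (0 : Plane) 2) := by
    rintro u ⟨h0, h1, h2⟩
    refine ⟨u, ?_, ?_⟩
    · rw [mem_closedBall_zero_iff, EuclideanSpace.norm_eq, Real.sqrt_le_left (by norm_num)]
      simp only [Real.norm_eq_abs, sq_abs, Fin.sum_univ_two]
      nlinarith
    · ext i
      fin_cases i <;> simp [planeMap_apply]
  refine (measure_mono this).trans_lt ?_
  have hc : IsCompact (planeMap !₂[1, 0] !₂[0, 1] '' (Metric.closedBall (0 : Plane) 2)) :=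
    (isCompact_closedBall _ _).image (LinearMap.continuous_of_finiteDimensional _)
  exact hc.measure_lt_top

/-- Up to two sides and the diagonal `u 0 + u 1 = 1`, the square is the triangle and its point
reflection. Only this ratio of volumes is needed, not their values. -/
lemma volume_unitSquare_le : volume unitSquare ≤ 2 * volume unitTriangle := by
  have hsub : unitSquare ⊆ (unitTriangle ∪ (fun u => !₂[1, 1] - u) ⁻¹' unitTriangle) ∪
      ({u | cross !₂[1, 0] u = 0} ∪ {u | cross !₂[0, 1] u = 0} ∪
        {u | cross !₂[1, -1] u = 1}) := by
    rintro u ⟨h0, h1, h2, h3⟩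
    simp only [mem_union, unitTriangle, mem_preimage, mem_ofPred_eq, cross, PiLp.sub_apply]
    simp only [Matrix.cons_val_zero, Matrix.cons_val_one]
    rcases h0.eq_or_lt with h | h
    · right; left; right; linarith
    rcases h2.eq_or_lt with h' | h'
    · right; left; left; linarith
    rcases lt_trichotomy (u 0 + u 1) 1 with h'' | h'' | h''
    · left; left; exact ⟨h, h', h''⟩
    · right; right; linarith
    · left; right; refine ⟨?_, ?_, ?_⟩ <;> linarith
  have hne : ∀ a b : ℝ, a ≠ 0 ∨ b ≠ 0 → (!₂[a, b] : Plane) ≠ 0 := by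
    rintro a b h h0
    have e0 := congrFun (congrArg WithLp.ofLp h0) 0
    have e1 := congrFun (congrArg WithLp.ofLp h0) 1
    simp at e0 e1
    tauto
  have hmp : volume ((fun u : Plane => !₂[1, 1] - u) ⁻¹' unitTriangle) = volume unitTriangle :=
    (Measure.measurePreserving_sub_left volume (!₂[1, 1] : Plane)).measure_preimage
      isOpen_unitTriangle.measurableSet.nullMeasurableSet
  calc volume unitSquare
      ≤ _ := measure_mono hsub
    _ ≤ _ := measure_union_le _ _
    _ ≤ (volume unitTriangle + volume unitTriangle) + (0 + 0 + 0) := by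
        gcongr
        · exact (measure_union_le _ _).trans (by rw [hmp])
        · refine (measure_union_le _ _).trans ?_
          gcongr
          · refine (measure_union_le _ _).trans ?_
            gcongr
            · exact (volume_setOf_cross_eq (hne _ _ (by simp)) _).le
            · exact (volume_setOf_cross_eq (hne _ _ (by simp)) _).le
          · exact (volume_setOf_cross_eq (hne _ _ (by simp)) _).le
    _ = 2 * volume unitTriangle := by simp [two_mul]

section Lattice

variable (Λ : Submodule ℤ Plane) [DiscreteTopology Λ] [IsZLattice ℝ Λ]

lemma exists_lattice_basis : ∃ p q : Plane, 0 < cross p q ∧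
    (∀ x, x ∈ Λ ↔ ∃ m n : ℤ, x = (m : ℝ) • p + (n : ℝ) • q) ∧
    IsAddFundamentalDomain Λ (planeMap p q '' unitSquare) volume := by
  have : Module.Finite ℤ Λ := ZLattice.module_finite ℝ Λ
  have : Module.Free ℤ Λ := ZLattice.module_free ℝ Λ
  have hrank : Module.finrank ℤ Λ = 2 := by
    rw [ZLattice.rank ℝ Λ, finrank_euclideanSpace_fin]
  have main : ∀ b : Module.Basis (Fin 2) ℤ Λ,
      (∀ x, x ∈ Λ ↔ ∃ m n : ℤ, x = (m : ℝ) • (b 0 : Plane) + (n : ℝ) • (b 1 : Plane)) ∧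
      IsAddFundamentalDomain Λ (planeMap (b 0) (b 1) '' unitSquare) volume := by
    intro b
    constructor
    · intro x
      constructor
      · intro hx
        refine ⟨b.repr ⟨x, hx⟩ 0, b.repr ⟨x, hx⟩ 1, ?_⟩
        have := congrArg Subtype.val (b.sum_repr ⟨x, hx⟩)
        rw [Fin.sum_univ_two] at this
        simpa [Int.cast_smul_eq_zsmul] using this.symm
      · rintro ⟨m, n, rfl⟩
        rw [Int.cast_smul_eq_zsmul, Int.cast_smul_eq_zsmul]
        exact Λ.add_mem (Λ.smul_mem _ (b 0).2) (Λ.smul_mem _ (b 1).2)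
    · have := ZLattice.isAddFundamentalDomain b (volume : Measure Plane)
      convert this using 1
      set B := b.ofZLatticeBasis ℝ with hB
      have hB0 : (b 0 : Plane) = B 0 := by simp [hB]
      have hB1 : (b 1 : Plane) = B 1 := by simp [hB]
      ext x
      rw [ZSpan.mem_fundamentalDomain, Fin.forall_fin_two]
      constructor
      · rintro ⟨u, ⟨h0, h1, h2, h3⟩, rfl⟩
        simp only [planeMap_apply, hB0, hB1, map_add, map_smul, Finsupp.coe_add, Finsupp.coe_smul,
          Pi.add_apply, Pi.smul_apply, Module.Basis.repr_self]
        simp [h0, h1, h2, h3]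
      · rintro ⟨h0, h1⟩
        refine ⟨!₂[B.repr x 0, B.repr x 1], ⟨?_, ?_, ?_, ?_⟩, ?_⟩
        · simpa using h0.1
        · simpa using h0.2
        · simpa using h1.1
        · simpa using h1.2
        · have := B.sum_repr x
          rw [Fin.sum_univ_two] at this
          rw [planeMap_apply, hB0, hB1]
          simpa using this
  have hne : ∀ b : Module.Basis (Fin 2) ℤ Λ, cross (b 0 : Plane) (b 1) ≠ 0 := by
    intro b h
    set B := b.ofZLatticeBasis ℝ with hB
    have hB0 : (b 0 : Plane) = B 0 := by simp [hB]
    have hB1 : (b 1 : Plane) = B 1 := by simp [hB]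
    rw [hB0, hB1] at h
    have hall : ∀ x, cross (B 0) x = 0 := by
      intro x
      rw [← B.sum_repr x, Fin.sum_univ_two, cross_add_right, cross_smul_right, cross_smul_right,
        h, cross_same]
      ring
    refine B.ne_zero 0 ?_
    have h0 := hall !₂[1, 0]
    have h1 := hall !₂[0, 1]
    simp [cross] at h0 h1
    ext i
    fin_cases i <;> simpa
  let b := Module.finBasisOfFinrankEq ℤ Λ hrank
  -- A negatively oriented basis is corrected by exchanging its two vectors.
  rcases lt_or_gt_of_ne (hne b) with h | h
  · refine ⟨b 1, b 0, by rw [cross_swap]; linarith, ?_⟩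
    simpa using main (b.reindex (Equiv.swap 0 1))
  · exact ⟨b 0, b 1, h, main b⟩

variable {Λ}

omit [IsZLattice ℝ Λ] in
/-- A set whose translates by the lattice overlap at most `k`-fold has at most `k` times the area
of a fundamental domain. -/
lemma volume_le_of_encard_le {F S : Set Plane} (hF : IsAddFundamentalDomain Λ F volume)
    (hS : MeasurableSet S) {k : ℕ}
    (h : ∀ x, {w ∈ (Λ : Set Plane) | x - w ∈ S}.encard ≤ (k : ℕ∞)) :
    volume S ≤ k * volume F := by
  have : Countable Λ := (lattice_countable Λ).to_subtype
  have : VAddInvariantMeasure Λ Plane volume :=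
    (inferInstance : VAddInvariantMeasure Λ.toAddSubgroup Plane volume)
  -- Unfolding: the volume of `S` is the integral over `F` of the number of translates of `S`
  -- covering a point.
  have h1 := hF.lintegral_eq_tsum' (S.indicator 1)
  rw [lintegral_indicator_one hS] at h1
  rw [h1, ← lintegral_tsum]
  · calc ∫⁻ x in F, ∑' g : Λ, S.indicator 1 (-g +ᵥ x)
        ≤ ∫⁻ _ in F, (k : ENNReal) := by
          refine lintegral_mono fun x => ?_
          have e : ∀ g : Λ, S.indicator (1 : Plane → ENNReal) (-g +ᵥ x) =
              ({g : Λ | x - (g : Plane) ∈ S}).indicator 1 g := by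
            intro g
            have : ((-g : Λ) : Plane) + x = x - (g : Plane) := by
              rw [Submodule.coe_neg]; abel
            change S.indicator 1 (((-g : Λ) : Plane) + x) = _
            rw [this]
            simp [indicator]
          simp_rw [e]
          rw [← tsum_subtype]
          simp only [Pi.one_apply]
          rw [ENNReal.tsum_set_one]
          have hinj : ({g : Λ | x - (g : Plane) ∈ S}).encard =
              {w ∈ (Λ : Set Plane) | x - w ∈ S}.encard := by
            rw [← Subtype.val_injective.encard_image]
            congr 1
            ext w
            simp [and_comm]
          rw [hinj]
          have := h x
          calc _ ≤ (((k : ℕ∞)) : ENNReal) := by exact_mod_cast this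
            _ = _ := by simp
      _ = _ := by rw [lintegral_const, Measure.restrict_apply_univ]
  · intro g
    exact ((measurable_one.indicator hS).comp (measurable_const_vadd _)).aemeasurable

end Lattice

namespace IsCenteredDecagon

variable {v : ZMod 10 → Plane} (hv : IsCenteredDecagon v)
include hv

lemma fan_subset_interior (i : ZMod 10) :
    planeMap (v i) (v (i + 1)) '' unitTriangle ⊆ interior (convexHull ℝ (range v)) := by
  rintro _ ⟨u, ⟨h0, h1, h2⟩, rfl⟩
  refine hv.mem_interior fun j => ?_
  rw [planeMap_apply, cross_add_right, cross_smul_right, cross_smul_right]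
  have a := hv.neg_le_cross_edge j i
  have b := hv.neg_le_cross_edge j (i + 1)
  have c := hv.cross_succ_pos j
  nlinarith

/-- The line through the centre and `v (i + d)` separates the two open triangles. -/
lemma cone_disjoint {i d : ZMod 10} (h : 0 ≤ cross (v i) (v (i + d)))
    (h' : 0 ≤ cross (v (i + 1)) (v (i + d))) (x : Plane)
    (hx : x ∈ planeMap (v i) (v (i + 1)) '' unitTriangle)
    (hx' : x ∈ planeMap (v (i + d)) (v (i + d + 1)) '' unitTriangle) : False := by
  obtain ⟨u, ⟨u0, u1, _⟩, rfl⟩ := hx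
  obtain ⟨w, ⟨_, w1, _⟩, hw⟩ := hx'
  have hpos := hv.cross_succ_pos (i + d)
  have := congrArg (cross (v (i + d))) hw
  simp only [planeMap_apply, cross_add_right, cross_smul_right, cross_same] at this
  rw [cross_swap (v i), cross_swap (v (i + 1))] at this
  nlinarith [mul_pos w1 hpos, mul_nonneg u0.le h, mul_nonneg u1.le h']

lemma fan_pairwise_disjoint :
    Pairwise (Function.onFun Disjoint
      fun i : ZMod 10 => planeMap (v i) (v (i + 1)) '' unitTriangle) := by
  have key : ∀ i d : ZMod 10, d = 1 ∨ d = 2 ∨ d = 3 ∨ d = 4 ∨ d = 5 → ∀ x,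
      x ∈ planeMap (v i) (v (i + 1)) '' unitTriangle →
      x ∈ planeMap (v (i + d)) (v (i + d + 1)) '' unitTriangle → False := by
    intro i d hd
    have h1 := hv.cross_succ_pos (i + 1)
    have h2 := hv.cross_two_pos (i + 1)
    have h3 := hv.cross_three_pos (i + 1)
    have h4 := hv.cross_four_pos (i + 1)
    rw [show i + 1 + 1 = i + 2 by ring] at h1
    rw [show i + 1 + 2 = i + 3 by ring] at h2
    rw [show i + 1 + 3 = i + 4 by ring] at h3
    rw [show i + 1 + 4 = i + 5 by ring] at h4
    rcases hd with rfl | rfl | rfl | rfl | rfl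
    · exact hv.cone_disjoint (hv.cross_succ_pos i).le (cross_same _).ge
    · exact hv.cone_disjoint (hv.cross_two_pos i).le h1.le
    · exact hv.cone_disjoint (hv.cross_three_pos i).le h2.le
    · exact hv.cone_disjoint (hv.cross_four_pos i).le h3.le
    · refine hv.cone_disjoint ?_ h4.le
      rw [hv.antipode, cross_neg_right, cross_same, neg_zero]
  intro i j hij
  rw [Function.onFun, disjoint_left]
  intro x hx hx'
  have cases : ∀ d : ZMod 10, d = 0 ∨ (d = 1 ∨ d = 2 ∨ d = 3 ∨ d = 4 ∨ d = 5) ∨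
      (-d = 1 ∨ -d = 2 ∨ -d = 3 ∨ -d = 4 ∨ -d = 5) := by decide
  rcases cases (j - i) with h | h | h
  · exact hij (sub_eq_zero.1 h).symm
  · exact key i (j - i) h x hx (by simpa using hx')
  · exact key j (-(j - i)) h x hx' (by simpa using hx)

/-- The area of a `k`-fold lattice tile is at most `k` times the determinant of the lattice. -/
theorem sum_cross_le {Λ : Submodule ℤ Plane} [DiscreteTopology Λ] {k : ℕ}
    (hT : IsKFoldTiling k (convexHull ℝ (range v)) (Λ : Set Plane)) {p q : Plane}
    (hpq : 0 < cross p q)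
    (hF : IsAddFundamentalDomain Λ (planeMap p q '' unitSquare) volume) :
    ∑ i, cross (v i) (v (i + 1)) ≤ 2 * k * cross p q := by
  have h1 := volume_le_of_encard_le hF isOpen_interior.measurableSet (fun x => (hT x).2)
  have hmeas : ∀ i : ZMod 10,
      MeasurableSet (planeMap (v i) (v (i + 1)) '' unitTriangle) := by
    intro i
    have hdet : LinearMap.det (planeMap (v i) (v (i + 1))) ≠ 0 := by
      rw [det_planeMap]; exact (hv.cross_succ_pos i).ne'
    have hinj : Function.Injective (planeMap (v i) (v (i + 1))) :=
      (LinearMap.equivOfDetNeZero _ hdet).injective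
    exact isOpen_unitTriangle.measurableSet.image_of_continuousOn_injOn
      (LinearMap.continuous_of_finiteDimensional _).continuousOn hinj.injOn
  have h2 : ∑ i, volume (planeMap (v i) (v (i + 1)) '' unitTriangle) ≤
      volume (interior (convexHull ℝ (range v))) := by
    rw [← tsum_fintype (L := SummationFilter.unconditional _),
      ← measure_iUnion hv.fan_pairwise_disjoint hmeas]
    exact measure_mono (iUnion_subset hv.fan_subset_interior)
  simp only [Measure.addHaar_image_linearMap, det_planeMap] at h1 h2
  rw [← Finset.sum_mul] at h2
  -- All volumes are now multiples of that of the standard triangle, which cancels. The factor 2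
  -- comes from comparing triangles with a parallelogram.
  have h3 : (∑ i, ENNReal.ofReal |cross (v i) (v (i + 1))|) * volume unitTriangle ≤
      (k * (ENNReal.ofReal |cross p q| * 2)) * volume unitTriangle := by
    refine (h2.trans h1).trans ?_
    rw [mul_assoc, mul_assoc]
    gcongr
    exact volume_unitSquare_le
  rw [ENNReal.mul_le_mul_iff_left volume_unitTriangle_pos.ne' volume_unitTriangle_lt_top.ne,
    ← ENNReal.ofReal_sum_of_nonneg fun i _ => abs_nonneg _, abs_of_pos hpq,
    ← ENNReal.ofReal_natCast, show (2 : ENNReal) = ENNReal.ofReal 2 by simp,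
    ← ENNReal.ofReal_mul hpq.le, ← ENNReal.ofReal_mul k.cast_nonneg,
    ENNReal.ofReal_le_ofReal_iff (by positivity)] at h3
  simp only [abs_of_pos (hv.cross_succ_pos _)] at h3
  linarith

end IsCenteredDecagon

/-! ### Lower bounds for the area from integrality of determinants. -/

lemma sum_zmod_ten {M : Type*} [AddCommMonoid M] (f : ZMod 10 → M) :
    ∑ i, f i = f 0 + f 1 + f 2 + f 3 + f 4 + f 5 + f 6 + f 7 + f 8 + f 9 := by
  have h : ∀ g : Fin 10 → M,
      ∑ i, g i = g 0 + g 1 + g 2 + g 3 + g 4 + g 5 + g 6 + g 7 + g 8 + g 9 := fun g => by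
    simp only [Fin.sum_univ_castSucc, Fin.sum_univ_zero, zero_add]
    rfl
  exact h f

set_option synthInstance.maxSize 1000 in
set_option synthInstance.maxHeartbeats 200000 in
set_option maxRecDepth 10000 in
/-- The solutions of the equations between the determinants of the short diagonals of a lattice
decagon whose area is at most five. -/
lemma diagonal_determinants {K a b c d e A B C D E : ℤ}
    (ha : 0 < a) (hb : 0 < b) (hc : 0 < c) (hd : 0 < d) (he : 0 < e)
    (hA : 0 < A) (hB : 0 < B) (hC : 0 < C) (hD : 0 < D) (hE : 0 < E)
    (h1 : K = A + c + e) (h2 : K = B + d + a) (h3 : K = C + e + b) (h4 : K = D + a + c)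
    (h5 : K = E + b + d)
    (p1 : A * B = a * c + b * D) (p2 : B * C = b * d + c * E) (p3 : C * D = c * e + d * A)
    (p4 : D * E = d * a + e * B) (p5 : E * A = e * b + a * C) (hK : K ≤ 5) :
    K = 5 ∧ ((a = 2 ∧ b = 1 ∧ c = 1 ∧ d = 1 ∧ e = 2) ∨ (a = 2 ∧ b = 2 ∧ c = 1 ∧ d = 1 ∧ e = 1) ∨
      (a = 1 ∧ b = 2 ∧ c = 2 ∧ d = 1 ∧ e = 1) ∨ (a = 1 ∧ b = 1 ∧ c = 2 ∧ d = 2 ∧ e = 1) ∨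
      (a = 1 ∧ b = 1 ∧ c = 1 ∧ d = 2 ∧ e = 2)) := by
  obtain rfl : A = K - c - e := by omega
  obtain rfl : B = K - d - a := by omega
  obtain rfl : C = K - e - b := by omega
  obtain rfl : D = K - a - c := by omega
  obtain rfl : E = K - b - d := by omega
  -- Each linear relation writes `K` as a sum of three positive integers, so `3 ≤ K ≤ 5` and none of
  -- the summands exceeds 3.
  have key : ∀ K ∈ [3, 4, 5], ∀ a ∈ [1, 2, 3], ∀ b ∈ [1, 2, 3], ∀ c ∈ [1, 2, 3],
      ∀ d ∈ [1, 2, 3], ∀ e ∈ [(1 : ℤ), 2, 3],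
      0 < K - c - e → 0 < K - d - a → 0 < K - e - b → 0 < K - a - c → 0 < K - b - d →
      (K - c - e) * (K - d - a) = a * c + b * (K - a - c) →
      (K - d - a) * (K - e - b) = b * d + c * (K - b - d) →
      (K - e - b) * (K - a - c) = c * e + d * (K - c - e) →
      (K - a - c) * (K - b - d) = d * a + e * (K - d - a) →
      (K - b - d) * (K - c - e) = e * b + a * (K - e - b) →
      K = 5 ∧ ((a = 2 ∧ b = 1 ∧ c = 1 ∧ d = 1 ∧ e = 2) ∨
        (a = 2 ∧ b = 2 ∧ c = 1 ∧ d = 1 ∧ e = 1) ∨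
        (a = 1 ∧ b = 2 ∧ c = 2 ∧ d = 1 ∧ e = 1) ∨ (a = 1 ∧ b = 1 ∧ c = 2 ∧ d = 2 ∧ e = 1) ∨
        (a = 1 ∧ b = 1 ∧ c = 1 ∧ d = 2 ∧ e = 2)) := by
    decide
  have mem3 : ∀ x : ℤ, 0 < x → x ≤ 3 → x ∈ [(1 : ℤ), 2, 3] := by
    intro x h h'
    simp only [List.mem_cons, List.not_mem_nil, or_false]
    omega
  have memK : K ∈ [(3 : ℤ), 4, 5] := by
    simp only [List.mem_cons, List.not_mem_nil, or_false]
    omega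
  exact key K memK a (mem3 a ha (by omega)) b (mem3 b hb (by omega)) c (mem3 c hc (by omega))
    d (mem3 d hd (by omega)) e (mem3 e he (by omega)) hA hB hC hD hE p1 p2 p3 p4 p5

lemma exists_int_cross {Λ : Submodule ℤ Plane} {p q : Plane}
    (hmem : ∀ x, x ∈ Λ ↔ ∃ m n : ℤ, x = (m : ℝ) • p + (n : ℝ) • q) {x y : Plane}
    (hx : x ∈ Λ) (hy : y ∈ Λ) : ∃ n : ℤ, cross x y = n * cross p q := by
  obtain ⟨m, n, rfl⟩ := (hmem x).1 hx
  obtain ⟨m', n', rfl⟩ := (hmem y).1 hy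
  refine ⟨m * n' - n * m', ?_⟩
  simp only [cross_add_left, cross_add_right, cross_smul_left, cross_smul_right, cross_same]
  rw [cross_swap p q]
  push_cast
  ring

namespace IsCenteredDecagon

lemma sum_cross_rotate (v : ZMod 10 → Plane) (r : ZMod 10) :
    ∑ i, cross (v (i + r)) (v (i + 1 + r)) = ∑ i, cross (v i) (v (i + 1)) := by
  rw [← Equiv.sum_comp (Equiv.addRight r) (fun i => cross (v i) (v (i + 1)))]
  simp only [Equiv.coe_addRight]
  exact Finset.sum_congr rfl fun i _ => by rw [show i + 1 + r = i + r + 1 by ring]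

variable {v : ZMod 10 → Plane} (hv : IsCenteredDecagon v)
include hv

lemma vertices : v 5 = -v 0 ∧ v 6 = -v 1 ∧ v 7 = -v 2 ∧ v 8 = -v 3 ∧ v 9 = -v 4 :=
  ⟨hv.antipode 0, hv.antipode 1, hv.antipode 2, hv.antipode 3, hv.antipode 4⟩

lemma sum_cross_eq : ∑ i, cross (v i) (v (i + 1)) =
    2 * (cross (v 0) (v 1) + cross (v 1) (v 2) + cross (v 2) (v 3) + cross (v 3) (v 4) +
      cross (v 0) (v 4)) := by
  obtain ⟨h5, h6, h7, h8, h9⟩ := hv.vertices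
  rw [sum_zmod_ten]
  change cross (v 0) (v 1) + cross (v 1) (v 2) + cross (v 2) (v 3) + cross (v 3) (v 4) +
    cross (v 4) (v 5) + cross (v 5) (v 6) + cross (v 6) (v 7) + cross (v 7) (v 8) +
    cross (v 8) (v 9) + cross (v 9) (v 0) = _
  rw [h5, h6, h7, h8, h9]
  simp only [cross_neg_left, cross_neg_right, neg_neg]
  rw [cross_swap (v 0) (v 4)]
  ring

/-- The area of a centred decagon is the sum of the determinants of pairs of edges. -/
lemma sum_cross_eq_edges : ∑ i, cross (v i) (v (i + 1)) =
    2 * (cross (edge v 0) (edge v 1) + cross (edge v 0) (edge v 2) + cross (edge v 0) (edge v 3) +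
      cross (edge v 0) (edge v 4) + cross (edge v 1) (edge v 2) + cross (edge v 1) (edge v 3) +
      cross (edge v 1) (edge v 4) + cross (edge v 2) (edge v 3) + cross (edge v 2) (edge v 4) +
      cross (edge v 3) (edge v 4)) := by
  rw [hv.sum_cross_eq]
  have e0 : edge v 0 = v 1 - v 0 := rfl
  have e1 : edge v 1 = v 2 - v 1 := rfl
  have e2 : edge v 2 = v 3 - v 2 := rfl
  have e3 : edge v 3 = v 4 - v 3 := rfl
  have e4 : edge v 4 = -v 0 - v 4 := by rw [← hv.vertices.1]; rfl
  rw [e0, e1, e2, e3, e4]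
  simp [cross]
  ring

variable {Λ : Submodule ℤ Plane} {p q : Plane}

/-- If the midpoint of an edge is not in half the lattice, then the determinants of this edge with
all others are multiples of the determinant of the lattice. -/
lemma det_le_cross_edge (hpq : 0 < cross p q)
    (hmem : ∀ x, x ∈ Λ ↔ ∃ m n : ℤ, x = (m : ℝ) • p + (n : ℝ) • q)
    (H : ∀ i, twoMid v i ∈ Λ ∨ (edge v i ∈ Λ ∧ ∃ c : ℝ, twoMid v i + c • edge v i ∈ Λ))
    {i : ZMod 10} (hi : twoMid v i ∉ Λ) :
    cross p q ≤ cross (edge v i) (edge v (i + 1)) ∧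
    cross p q ≤ cross (edge v i) (edge v (i + 2)) ∧
    cross p q ≤ cross (edge v i) (edge v (i + 3)) ∧
    cross p q ≤ cross (edge v i) (edge v (i + 4)) := by
  obtain ⟨he, c, hc⟩ := (H i).resolve_left hi
  have r1 : edge v (i + 1) = twoMid v (i + 1) - twoMid v i - edge v i := by
    simp only [edge, twoMid]; abel
  have r2 : edge v (i + 2) =
      twoMid v (i + 2) - twoMid v i - edge v i - edge v (i + 1) - edge v (i + 1) := by
    simp only [edge, twoMid]; rw [show i + 1 + 1 = i + 2 by ring]; abel
  have r3 : edge v (i + 3) = -twoMid v i - edge v (i + 1) - edge v (i + 2) - edge v (i + 4) := by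
    simp only [edge, twoMid]
    rw [show i + 1 + 1 = i + 2 by ring, show i + 2 + 1 = i + 3 by ring,
      show i + 3 + 1 = i + 4 by ring, show i + 4 + 1 = i + 5 by ring, hv.antipode]; abel
  have r4 : edge v (i + 4) = edge v i - twoMid v i - twoMid v (i + 4) := by
    simp only [edge, twoMid]
    rw [show i + 4 + 1 = i + 5 by ring, hv.antipode]; abel
  -- The multiple `c • edge v i` does not affect the determinant with `edge v i`, so `twoMid v i`
  -- behaves here like a lattice vector.
  obtain ⟨n0, hn0⟩ : ∃ n : ℤ, cross (edge v i) (twoMid v i) = n * cross p q := by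
    obtain ⟨n, hn⟩ := exists_int_cross hmem he hc
    rw [cross_add_right, cross_smul_right, cross_same, mul_zero, add_zero] at hn
    exact ⟨n, hn⟩
  obtain ⟨n1, hn1⟩ : ∃ n : ℤ, cross (edge v i) (edge v (i + 1)) = n * cross p q := by
    rcases H (i + 1) with h | ⟨h, _⟩
    · obtain ⟨n, hn⟩ := exists_int_cross hmem he h
      refine ⟨n - n0, ?_⟩
      rw [r1, cross_sub_right, cross_sub_right, cross_same, hn, hn0]; push_cast; ring
    · exact exists_int_cross hmem he h
  obtain ⟨n4, hn4⟩ : ∃ n : ℤ, cross (edge v i) (edge v (i + 4)) = n * cross p q := by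
    rcases H (i + 4) with h | ⟨h, _⟩
    · obtain ⟨n, hn⟩ := exists_int_cross hmem he h
      refine ⟨-n0 - n, ?_⟩
      rw [r4, cross_sub_right, cross_sub_right, cross_same, hn, hn0]; push_cast; ring
    · exact exists_int_cross hmem he h
  obtain ⟨n2, hn2⟩ : ∃ n : ℤ, cross (edge v i) (edge v (i + 2)) = n * cross p q := by
    rcases H (i + 2) with h | ⟨h, _⟩
    · obtain ⟨n, hn⟩ := exists_int_cross hmem he h
      refine ⟨n - n0 - n1 - n1, ?_⟩
      simp only [r2, cross_sub_right, cross_same, hn, hn0, hn1]; push_cast; ring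
    · exact exists_int_cross hmem he h
  obtain ⟨n3, hn3⟩ : ∃ n : ℤ, cross (edge v i) (edge v (i + 3)) = n * cross p q := by
    refine ⟨-n0 - n1 - n2 - n4, ?_⟩
    simp only [r3, cross_sub_right, cross_neg_right, hn0, hn1, hn2, hn4]; push_cast; ring
  have key : ∀ {r : ℝ} {n : ℤ}, 0 < r → r = n * cross p q → cross p q ≤ r := by
    rintro r n hr rfl
    have : (0 : ℝ) < n := pos_of_mul_pos_left hr hpq.le
    have : (1 : ℝ) ≤ n := by exact_mod_cast this
    nlinarith
  exact ⟨key (hv.cross_edge_one i) hn1, key (hv.cross_edge_two i) hn2,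
    key (hv.cross_edge_three i) hn3, key (hv.cross_edge_four i) hn4⟩

/-- The alternating sum of the five doubled midpoints vanishes, so a second edge `j` among 1, ..., 4
is bad as well. Of the ten pairs of edges 4 + 4 - 1 = 7 involve edge 0 or edge `j`; each contributes
at least `cross p q`, and the other three are positive. -/
lemma det_lt_of_twoMid_notMem (hpq : 0 < cross p q)
    (hmem : ∀ x, x ∈ Λ ↔ ∃ m n : ℤ, x = (m : ℝ) • p + (n : ℝ) • q)
    (H : ∀ i, twoMid v i ∈ Λ ∨ (edge v i ∈ Λ ∧ ∃ c : ℝ, twoMid v i + c • edge v i ∈ Λ))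
    (h0 : twoMid v 0 ∉ Λ) :
    2 * 5 * cross p q < ∑ i, cross (v i) (v (i + 1)) := by
  have hrel : twoMid v 0 = twoMid v 1 - twoMid v 2 + twoMid v 3 - twoMid v 4 := by
    change v 0 + v 1 = v 1 + v 2 - (v 2 + v 3) + (v 3 + v 4) - (v 4 + v 5)
    rw [hv.vertices.1]; abel
  obtain ⟨a1, a2, a3, a4⟩ : cross p q ≤ cross (edge v 0) (edge v 1) ∧
      cross p q ≤ cross (edge v 0) (edge v 2) ∧ cross p q ≤ cross (edge v 0) (edge v 3) ∧
      cross p q ≤ cross (edge v 0) (edge v 4) := hv.det_le_cross_edge hpq hmem H h0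
  have p01 : 0 < cross (edge v 1) (edge v 2) := hv.cross_edge_one 1
  have p02 : 0 < cross (edge v 1) (edge v 3) := hv.cross_edge_two 1
  have p03 : 0 < cross (edge v 1) (edge v 4) := hv.cross_edge_three 1
  have p12 : 0 < cross (edge v 2) (edge v 3) := hv.cross_edge_one 2
  have p13 : 0 < cross (edge v 2) (edge v 4) := hv.cross_edge_two 2
  have p23 : 0 < cross (edge v 3) (edge v 4) := hv.cross_edge_one 3
  have e6 : edge v 6 = -edge v 1 := hv.edge_add_five 1
  have e7 : edge v 7 = -edge v 2 := hv.edge_add_five 2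
  have e8 : edge v 8 = -edge v 3 := hv.edge_add_five 3
  rw [hv.sum_cross_eq_edges]
  by_cases h1 : twoMid v 1 ∈ Λ
  · by_cases h2 : twoMid v 2 ∈ Λ
    · by_cases h3 : twoMid v 3 ∈ Λ
      · have h4 : twoMid v 4 ∉ Λ := fun h4 => h0 <| by
          rw [hrel]; exact Λ.sub_mem (Λ.add_mem (Λ.sub_mem h1 h2) h3) h4
        obtain ⟨-, b2, b3, b4⟩ : cross p q ≤ cross (edge v 4) (edge v 5) ∧
          cross p q ≤ cross (edge v 4) (edge v 6) ∧ cross p q ≤ cross (edge v 4) (edge v 7) ∧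
          cross p q ≤ cross (edge v 4) (edge v 8) := hv.det_le_cross_edge hpq hmem H h4
        rw [e6, cross_neg_right, ← cross_swap] at b2
        rw [e7, cross_neg_right, ← cross_swap] at b3
        rw [e8, cross_neg_right, ← cross_swap] at b4
        linarith
      · obtain ⟨b1, -, b3, b4⟩ : cross p q ≤ cross (edge v 3) (edge v 4) ∧
          cross p q ≤ cross (edge v 3) (edge v 5) ∧ cross p q ≤ cross (edge v 3) (edge v 6) ∧
          cross p q ≤ cross (edge v 3) (edge v 7) := hv.det_le_cross_edge hpq hmem H h3
        rw [e6, cross_neg_right, ← cross_swap] at b3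
        rw [e7, cross_neg_right, ← cross_swap] at b4
        linarith
    · obtain ⟨b1, b2, -, b4⟩ : cross p q ≤ cross (edge v 2) (edge v 3) ∧
        cross p q ≤ cross (edge v 2) (edge v 4) ∧ cross p q ≤ cross (edge v 2) (edge v 5) ∧
        cross p q ≤ cross (edge v 2) (edge v 6) := hv.det_le_cross_edge hpq hmem H h2
      rw [e6, cross_neg_right, ← cross_swap] at b4
      linarith
  · obtain ⟨b1, b2, b3, -⟩ : cross p q ≤ cross (edge v 1) (edge v 2) ∧
      cross p q ≤ cross (edge v 1) (edge v 3) ∧ cross p q ≤ cross (edge v 1) (edge v 4) ∧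
      cross p q ≤ cross (edge v 1) (edge v 5) := hv.det_le_cross_edge hpq hmem H h1
    linarith

omit hv in
lemma diagonal_eq (v : ZMod 10 → Plane) (i : ZMod 10) :
    v (i + 2) - v i = twoMid v (i + 1) - twoMid v i := by
  simp only [twoMid]; rw [show i + 1 + 1 = i + 2 by ring]; abel

lemma cross_diagonal_pos (i : ZMod 10) :
    0 < cross (v (i + 2) - v i) (v (i + 3) - v (i + 1)) := by
  have e0 : v (i + 2) - v i = edge v i + edge v (i + 1) := by
    simp only [edge]; rw [show i + 1 + 1 = i + 2 by ring]; abel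
  have e1 : v (i + 3) - v (i + 1) = edge v (i + 1) + edge v (i + 2) := by
    simp only [edge]; rw [show i + 1 + 1 = i + 2 by ring, show i + 2 + 1 = i + 3 by ring]; abel
  have h1 := hv.cross_edge_one i
  have h2 := hv.cross_edge_two i
  have h3 := hv.cross_edge_one (i + 1)
  rw [show i + 1 + 1 = i + 2 by ring] at h3
  simp only [e0, e1, cross_add_left, cross_add_right, cross_same]
  linarith

lemma cross_diagonal_two_pos (i : ZMod 10) :
    0 < cross (v (i + 2) - v i) (v (i + 4) - v (i + 2)) := by
  have e0 : v (i + 2) - v i = edge v i + edge v (i + 1) := by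
    simp only [edge]; rw [show i + 1 + 1 = i + 2 by ring]; abel
  have e1 : v (i + 4) - v (i + 2) = edge v (i + 2) + edge v (i + 3) := by
    simp only [edge]; rw [show i + 3 + 1 = i + 4 by ring, show i + 2 + 1 = i + 3 by ring]; abel
  have h1 := hv.cross_edge_two i
  have h2 := hv.cross_edge_three i
  have h3 := hv.cross_edge_one (i + 1)
  have h4 := hv.cross_edge_two (i + 1)
  rw [show i + 1 + 1 = i + 2 by ring] at h3
  rw [show i + 1 + 2 = i + 3 by ring] at h4
  simp only [e0, e1, cross_add_left, cross_add_right]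
  linarith

/-- A centred decagon whose edges have their midpoints in half a lattice has an area of at least
five times the determinant of the lattice. In the case of equality the short diagonals have, up to
rotation, known determinants. -/
lemma diagonals_of_twoMid_mem (hpq : 0 < cross p q)
    (hmem : ∀ x, x ∈ Λ ↔ ∃ m n : ℤ, x = (m : ℝ) • p + (n : ℝ) • q)
    (H : ∀ i, twoMid v i ∈ Λ)
    (hle : ∑ i, cross (v i) (v (i + 1)) ≤ 2 * 5 * cross p q) :
    ∑ i, cross (v i) (v (i + 1)) = 2 * 5 * cross p q ∧
    ∃ r : ZMod 10,
      cross (v (2 + r) - v r) (v (3 + r) - v (1 + r)) = 2 * cross p q ∧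
      cross (v (3 + r) - v (1 + r)) (v (4 + r) - v (2 + r)) = cross p q ∧
      cross (v (4 + r) - v (2 + r)) (v (5 + r) - v (3 + r)) = cross p q ∧
      cross (v (5 + r) - v (3 + r)) (v (6 + r) - v (4 + r)) = cross p q ∧
      cross (v (6 + r) - v (4 + r)) (v (7 + r) - v (5 + r)) = 2 * cross p q := by
  have hmemdiag : ∀ i, v (i + 2) - v i ∈ Λ := fun i => by
    rw [diagonal_eq]; exact Λ.sub_mem (H _) (H _)
  have hd : ∀ i, ∃ n : ℤ, 0 < n ∧
      cross (v (i + 2) - v i) (v (i + 3) - v (i + 1)) = n * cross p q := by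
    intro i
    have h' : v (i + 3) - v (i + 1) ∈ Λ := by
      have := hmemdiag (i + 1); rwa [show i + 1 + 2 = i + 3 by ring] at this
    obtain ⟨n, hn⟩ := exists_int_cross hmem (hmemdiag i) h'
    have := hv.cross_diagonal_pos i
    rw [hn] at this
    exact ⟨n, by exact_mod_cast pos_of_mul_pos_left this hpq.le, hn⟩
  have hD : ∀ i, ∃ n : ℤ, 0 < n ∧
      cross (v (i + 2) - v i) (v (i + 4) - v (i + 2)) = n * cross p q := by
    intro i
    have h' : v (i + 4) - v (i + 2) ∈ Λ := by
      have := hmemdiag (i + 2); rwa [show i + 2 + 2 = i + 4 by ring] at this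
    obtain ⟨n, hn⟩ := exists_int_cross hmem (hmemdiag i) h'
    have := hv.cross_diagonal_two_pos i
    rw [hn] at this
    exact ⟨n, by exact_mod_cast pos_of_mul_pos_left this hpq.le, hn⟩
  choose d hdpos hdeq using hd
  choose D hDpos hDeq using hD
  obtain ⟨h5, h6, h7, h8, h9⟩ := hv.vertices
  have d0 : cross (v 2 - v 0) (v 3 - v 1) = d 0 * cross p q := hdeq 0
  have d1 : cross (v 3 - v 1) (v 4 - v 2) = d 1 * cross p q := hdeq 1
  have d2 : cross (v 4 - v 2) (v 5 - v 3) = d 2 * cross p q := hdeq 2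
  have d3 : cross (v 5 - v 3) (v 6 - v 4) = d 3 * cross p q := hdeq 3
  have d4 : cross (v 6 - v 4) (v 7 - v 5) = d 4 * cross p q := hdeq 4
  have D0 : cross (v 2 - v 0) (v 4 - v 2) = D 0 * cross p q := hDeq 0
  have D1 : cross (v 3 - v 1) (v 5 - v 3) = D 1 * cross p q := hDeq 1
  have D2 : cross (v 4 - v 2) (v 6 - v 4) = D 2 * cross p q := hDeq 2
  have D3 : cross (v 5 - v 3) (v 7 - v 5) = D 3 * cross p q := hDeq 3
  have D4 : cross (v 6 - v 4) (v 8 - v 6) = D 4 * cross p q := hDeq 4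
  have hne := hpq.ne'
  set δ := cross p q with hδ
  -- the area in terms of the determinants of the diagonals
  have area : ∀ n m l : ℤ,
      cross (v 0) (v 1) + cross (v 1) (v 2) + cross (v 2) (v 3) + cross (v 3) (v 4) +
        cross (v 0) (v 4) = n * δ + m * δ + l * δ →
      ∀ K : ℤ, cross (v 0) (v 1) + cross (v 1) (v 2) + cross (v 2) (v 3) + cross (v 3) (v 4) +
        cross (v 0) (v 4) = K * δ → K = n + m + l := by
    intro n m l h K hK
    rw [h, ← add_mul, ← add_mul] at hK
    exact_mod_cast (mul_right_cancel₀ hne hK).symm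
  have plu : ∀ a b c e f g : ℤ, (a * δ) * (b * δ) = (c * δ) * (e * δ) + (f * δ) * (g * δ) →
      a * b = c * e + f * g := by
    intro a b c e f g h
    have h2 : ((a * b : ℤ) : ℝ) * (δ * δ) = ((c * e + f * g : ℤ) : ℝ) * (δ * δ) := by
      push_cast; linarith
    exact_mod_cast mul_right_cancel₀ (mul_ne_zero hne hne) h2
  -- The area of the decagon, written in five ways through the determinants `d` of consecutive short
  -- diagonals and `D` of short diagonals two steps apart.
  have A0 : cross (v 0) (v 1) + cross (v 1) (v 2) + cross (v 2) (v 3) + cross (v 3) (v 4) +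
      cross (v 0) (v 4) = D 0 * δ + d 2 * δ + d 4 * δ := by
    rw [← D0, ← d2, ← d4, h5, h6, h7]; simp [cross]; ring
  have A1 : cross (v 0) (v 1) + cross (v 1) (v 2) + cross (v 2) (v 3) + cross (v 3) (v 4) +
      cross (v 0) (v 4) = D 1 * δ + d 3 * δ + d 0 * δ := by
    rw [← D1, ← d3, ← d0, h5, h6]; simp [cross]; ring
  have A2 : cross (v 0) (v 1) + cross (v 1) (v 2) + cross (v 2) (v 3) + cross (v 3) (v 4) +
      cross (v 0) (v 4) = D 2 * δ + d 4 * δ + d 1 * δ := by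
    rw [← D2, ← d4, ← d1, h5, h6, h7]; simp [cross]; ring
  have A3 : cross (v 0) (v 1) + cross (v 1) (v 2) + cross (v 2) (v 3) + cross (v 3) (v 4) +
      cross (v 0) (v 4) = D 3 * δ + d 0 * δ + d 2 * δ := by
    rw [← D3, ← d0, ← d2, h5, h7]; simp [cross]; ring
  have A4 : cross (v 0) (v 1) + cross (v 1) (v 2) + cross (v 2) (v 3) + cross (v 3) (v 4) +
      cross (v 0) (v 4) = D 4 * δ + d 1 * δ + d 3 * δ := by
    rw [← D4, ← d1, ← d3, h5, h6, h8]; simp [cross]; ring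
  have hK : cross (v 0) (v 1) + cross (v 1) (v 2) + cross (v 2) (v 3) + cross (v 3) (v 4) +
      cross (v 0) (v 4) = ((D 0 + d 2 + d 4 : ℤ) : ℝ) * δ := by
    rw [A0]; push_cast; ring
  have sum := hv.sum_cross_eq
  rw [hK] at sum
  have hK5 : D 0 + d 2 + d 4 ≤ 5 := by
    rw [sum] at hle
    have : ((D 0 + d 2 + d 4 : ℤ) : ℝ) ≤ 5 := by nlinarith
    exact_mod_cast this
  obtain ⟨hK, hsol⟩ := diagonal_determinants (hdpos 0) (hdpos 1) (hdpos 2) (hdpos 3) (hdpos 4)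
    (hDpos 0) (hDpos 1) (hDpos 2) (hDpos 3) (hDpos 4) rfl (area _ _ _ A1 _ hK)
    (area _ _ _ A2 _ hK) (area _ _ _ A3 _ hK) (area _ _ _ A4 _ hK)
    (plu _ _ _ _ _ _ <| by
      rw [← D0, ← D1, ← d0, ← d2, ← d1, ← D3, h5, h7]; simp [cross]; ring)
    (plu _ _ _ _ _ _ <| by
      rw [← D1, ← D2, ← d1, ← d3, ← d2, ← D4, h5, h6, h8]; simp [cross]; ring)
    (plu _ _ _ _ _ _ <| by
      rw [← D2, ← D3, ← d2, ← d4, ← d3, ← D0, h5, h6, h7]; simp [cross]; ring)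
    (plu _ _ _ _ _ _ <| by
      rw [← D3, ← D4, ← d3, ← d0, ← d4, ← D1, h5, h6, h7, h8]; simp [cross]; ring)
    (plu _ _ _ _ _ _ <| by
      rw [← D4, ← D0, ← d4, ← d1, ← d0, ← D2, h5, h6, h7, h8]; simp [cross]; ring)
    hK5
  -- Opposite diagonals differ in sign, so `d` has period five. This serves the rotations, which
  -- turn each of the five solutions into 2, 1, 1, 1, 2.
  have c5 : cross (v 7 - v 5) (v 8 - v 6) = d 0 * δ := by
    rw [← d0, h5, h6, h7, h8]; simp [cross]; ring
  have c6 : cross (v 8 - v 6) (v 9 - v 7) = d 1 * δ := by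
    rw [← d1, h6, h7, h8, h9]; simp [cross]; ring
  have c7 : cross (v 9 - v 7) (v 0 - v 8) = d 2 * δ := by
    rw [← d2, h5, h7, h8, h9]; simp [cross]; ring
  have c8 : cross (v 0 - v 8) (v 1 - v 9) = d 3 * δ := by
    rw [← d3, h5, h6, h8, h9]; simp [cross]; ring
  refine ⟨by rw [sum, hK]; push_cast; ring, ?_⟩
  rcases hsol with ⟨s0, s1, s2, s3, s4⟩ | ⟨s0, s1, s2, s3, s4⟩ | ⟨s0, s1, s2, s3, s4⟩ |
    ⟨s0, s1, s2, s3, s4⟩ | ⟨s0, s1, s2, s3, s4⟩ <;>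
    simp only [s0, s1, s2, s3, s4, Int.cast_one, Int.cast_ofNat, one_mul]
      at d0 d1 d2 d3 d4 c5 c6 c7 c8
  · exact ⟨0, d0, d1, d2, d3, d4⟩
  · exact ⟨1, d1, d2, d3, d4, c5⟩
  · exact ⟨2, d2, d3, d4, c5, c6⟩
  · exact ⟨3, d3, d4, c5, c6, c7⟩
  · exact ⟨4, d4, c5, c6, c7, c8⟩

end IsCenteredDecagon

/-! ### The centre of symmetry and the pairing of the vertices. -/

section Center

variable {v : ZMod 10 → Plane}
  (hv : ∀ i j : ZMod 10, j ≠ i → j ≠ i + 1 → 0 < cross (v (i + 1) - v i) (v j - v i))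
include hv

lemma injective_of_convexPosition : Function.Injective v := by
  intro i j hij
  by_contra hne
  by_cases h : j = i + 1
  · have := hv i (i + 2) (by simp; decide) (by rw [Ne, add_right_inj]; decide)
    rw [← h, ← hij, sub_self, cross_zero_left] at this
    exact this.false
  · have := hv i j (Ne.symm hne) h
    rw [hij, sub_self, cross_zero_right] at this
    exact this.false

/-- Every vertex is the unique minimum of a linear functional. -/
lemma eq_vertex_of_cross_le {i : ZMod 10} {y : Plane} (hy : y ∈ convexHull ℝ (range v))
    (h : cross (v (i + 1 + 1) - v i) y ≤ cross (v (i + 1 + 1) - v i) (v (i + 1))) :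
    y = v (i + 1) := by
  -- `m` is the sum of the two edges at `v (i + 1)`. The functionals of both edges are minimal at
  -- this vertex, and no other vertex lies on both edges.
  set m := v (i + 1 + 1) - v i
  have hvert : ∀ j, j ≠ i + 1 → cross m (v (i + 1)) < cross m (v j) := by
    intro j hj
    have e1 : j ≠ i + 1 + 1 → 0 < cross (v (i + 1 + 1) - v (i + 1)) (v j - v (i + 1)) :=
      hv (i + 1) j hj
    have e2 : j ≠ i → 0 < cross (v (i + 1) - v i) (v j - v i) := fun h => hv i j h hj
    have hm : m = (v (i + 1 + 1) - v (i + 1)) + (v (i + 1) - v i) := by simp [m]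
    have e3 : cross (v (i + 1) - v i) (v j - v i) =
        cross (v (i + 1) - v i) (v j) - cross (v (i + 1) - v i) (v (i + 1)) := by
      simp [cross]; ring
    rw [cross_sub_right] at e1
    rw [e3] at e2
    rw [hm, cross_add_left, cross_add_left]
    by_cases h1 : j = i
    · have := e1 (by rw [h1]; exact (add_ten_ne i).1.symm)
      rw [h1] at this ⊢
      have : cross (v (i + 1) - v i) (v i) = cross (v (i + 1) - v i) (v (i + 1)) := by
        simp [cross]; ring
      linarith
    · have e2 := e2 h1
      by_cases h2 : j = i + 1 + 1
      · rw [h2] at e2 ⊢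
        have : cross (v (i + 1 + 1) - v (i + 1)) (v (i + 1 + 1)) =
            cross (v (i + 1 + 1) - v (i + 1)) (v (i + 1)) := by
          simp [cross]; ring
        linarith
      · linarith [e1 h2]
  have hconv : Convex ℝ {z | z = v (i + 1) ∨ cross m (v (i + 1)) < cross m z} := by
    rw [convex_iff_forall_pos]
    rintro x hx z hz s t hs ht hst
    have key : cross m (s • x + t • z) - cross m (v (i + 1)) =
        s * (cross m x - cross m (v (i + 1))) + t * (cross m z - cross m (v (i + 1))) := by
      rw [cross_add_right, cross_smul_right, cross_smul_right]
      linear_combination (cross m (v (i + 1))) * hst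
    rcases hx with rfl | hx
    · rcases hz with rfl | hz
      · left; rw [← add_smul, hst, one_smul]
      · right; nlinarith
    · right
      have : cross m (v (i + 1)) ≤ cross m z := by
        rcases hz with rfl | hz
        · exact le_rfl
        · exact hz.le
      nlinarith
  have hsub : range v ⊆ {z | z = v (i + 1) ∨ cross m (v (i + 1)) < cross m z} := by
    rintro _ ⟨j, rfl⟩
    by_cases hj : j = i + 1
    · left; rw [hj]
    · right; exact hvert j hj
  rcases convexHull_min hsub hconv hy with h' | h'
  · exact h'
  · exact absurd h (not_le.2 h')

/-- The reflection of a vertex that minimizes a functional maximizes it, and some vertex attains at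
least this maximum. Reflecting that vertex back gives a point at the unique minimum. -/
lemma exists_reflect_eq {c : Plane}
    (hc : ∀ x ∈ convexHull ℝ (range v), c + c - x ∈ convexHull ℝ (range v)) (i : ZMod 10) :
    ∃ j, c + c - v i = v j := by
  obtain ⟨i, rfl⟩ : ∃ j, i = j + 1 := ⟨i - 1, by ring⟩
  set m := v (i + 1 + 1) - v i with hm
  have hmem : ∀ j, v j ∈ convexHull ℝ (range v) := fun j => subset_convexHull ℝ _ ⟨j, rfl⟩
  obtain ⟨j, hj⟩ : ∃ j, cross m (c + c - v (i + 1)) ≤ cross m (v j) := by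
    by_contra! H
    have hconv : Convex ℝ {z | cross m z < cross m (c + c - v (i + 1))} := by
      rw [convex_iff_forall_pos]
      intro x hx y hy s t hs ht hst
      rw [mem_ofPred_eq] at hx hy ⊢
      rw [cross_add_right, cross_smul_right, cross_smul_right]
      calc _ < s * cross m (c + c - v (i + 1)) + t * cross m (c + c - v (i + 1)) := by gcongr
        _ = _ := by rw [← add_mul, hst, one_mul]
    have := convexHull_min (s := range v) (by rintro _ ⟨j, rfl⟩; exact H j) hconv
      (hc _ (hmem (i + 1)))
    exact lt_irrefl (cross m (c + c - v (i + 1))) this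
  refine ⟨j, ?_⟩
  have := eq_vertex_of_cross_le hv (i := i) (hc _ (hmem j)) (by
    change cross m _ ≤ cross m _
    simp only [cross_sub_right m] at hj ⊢
    linarith)
  rw [← this]; abel

/-- The vertices of a centrally symmetric convex decagon are paired by the symmetry. -/
lemma exists_isCenteredDecagon (hP : IsCentrallySymmetric (convexHull ℝ (range v))) :
    ∃ c : Plane, IsCenteredDecagon fun i => v i - c := by
  obtain ⟨c, hc⟩ := hP
  have hc' : ∀ x ∈ convexHull ℝ (range v), c + c - x ∈ convexHull ℝ (range v) := by
    intro x hx
    have := hc x hx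
    rw [AffineEquiv.pointReflection_apply, vsub_eq_sub, vadd_eq_add] at this
    rwa [show c + c - x = c - x + c by abel]
  have hinj := injective_of_convexPosition hv
  choose ρ hρ using exists_reflect_eq hv hc'
  have hinv : ∀ i, ρ (ρ i) = i := fun i => hinj <| by
    rw [← hρ, ← hρ]; abel
  have hsub : ∀ i j, v (ρ i) - v (ρ j) = -(v i - v j) := fun i j => by
    rw [← hρ, ← hρ]; abel
  -- The reflection preserves orientation. If it failed to carry edge `i` to edge `ρ i`, convexity
  -- at these two edges would give opposite signs to the same determinant.
  have hsucc : ∀ i, ρ (i + 1) = ρ i + 1 := by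
    intro i
    by_contra hne
    have h1 : ρ (ρ i + 1) ≠ i + 1 := fun h => hne (by rw [← h, hinv])
    have h2 : ρ (ρ i + 1) ≠ i := fun h => by
      have h' := hinv (ρ i + 1)
      rw [h] at h'
      exact absurd h' (by simp; decide)
    have h3 : ρ (i + 1) ≠ ρ i := fun h => by
      have h' := congrArg ρ h
      rw [hinv, hinv] at h'
      exact absurd h' (by simp; decide)
    have p1 := hv i (ρ (ρ i + 1)) h2 h1
    have p2 := hv (ρ i) (ρ (i + 1)) h3 hne
    have e1 := hsub (i + 1) i
    have e2 := hsub (ρ (ρ i + 1)) i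
    rw [hinv] at e2
    rw [e1, e2, cross_neg_left, cross_neg_right, neg_neg, cross_swap] at p2
    linarith
  have hnat : ∀ n : ℕ, ρ (n : ZMod 10) = n + ρ 0 := by
    intro n
    induction n with
    | zero => simp
    | succ n ih => push_cast; rw [hsucc, ih]; ring
  have hadd : ∀ i, ρ i = i + ρ 0 := fun i => by
    have := hnat i.val
    rwa [ZMod.natCast_zmod_val] at this
  -- `ρ` is a rotation of the indices and an involution. The trivial rotation would put all vertices
  -- at the centre.
  have h0 : ρ 0 = 0 ∨ ρ 0 = 5 := by
    have h := hinv 0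
    rw [hadd (ρ 0)] at h
    have key : ∀ r : ZMod 10, r + r = 0 → r = 0 ∨ r = 5 := by decide
    exact key _ h
  have h5 : ρ 0 = 5 := by
    refine h0.resolve_left fun h => ?_
    have e : ∀ i, (2 : ℝ) • v i = c + c := fun i => by
      have := hρ i
      rw [hadd, h, add_zero] at this
      rw [two_smul]; nth_rewrite 1 [← this]; abel
    have : v 0 = v 1 := smul_right_injective _ (two_ne_zero' ℝ) ((e 0).trans (e 1).symm)
    exact absurd (hinj this) (by decide)
  refine ⟨c, fun i => ?_, fun i j h h' => ?_⟩
  · rw [← h5, ← hadd, ← hρ]; abel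
  · simpa using hv i j h h'

end Center

lemma isKFoldTiling_preimage_add (k : ℕ) (K Λ : Set Plane) (c : Plane) :
    IsKFoldTiling k ((fun x => x + c) ⁻¹' K) Λ ↔ IsKFoldTiling k K Λ := by
  have hint : interior ((fun x => x + c) ⁻¹' K) = (fun x => x + c) ⁻¹' interior K :=
    ((Homeomorph.addRight c).preimage_interior K).symm
  unfold IsKFoldTiling
  rw [hint]
  constructor
  · intro h x
    have := h (x - c)
    simpa only [mem_preimage, show ∀ w, x - c - w + c = x - w from fun w => by abel] using this
  · intro h x
    have := h (x + c)
    simpa only [mem_preimage, show ∀ w, x + c - w = x - w + c from fun w => by abel] using this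

lemma convexHull_range_sub (v : ZMod 10 → Plane) (c : Plane) :
    convexHull ℝ (range fun i => v i - c) = (fun x => x + c) ⁻¹' convexHull ℝ (range v) := by
  have h := AffineMap.image_convexHull (𝕜 := ℝ)
    (f := (AffineEquiv.constVAdd ℝ Plane (-c)).toAffineMap) (range v)
  have e : (AffineEquiv.constVAdd ℝ Plane (-c)).toAffineMap '' range v =
      range fun i => v i - c := by
    rw [← range_comp]
    congr 1
    ext1 i
    simp [sub_eq_neg_add]
  rw [e] at h
  rw [← h]
  ext x
  constructor
  · rintro ⟨y, hy, rfl⟩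
    simpa using hy
  · intro hx
    exact ⟨x + c, hx, by simp⟩

lemma isKFoldTiling_convexHull_range_sub (k : ℕ) (v : ZMod 10 → Plane) (c : Plane)
    (Λ : Set Plane) :
    IsKFoldTiling k (convexHull ℝ (range fun i => v i - c)) Λ ↔
      IsKFoldTiling k (convexHull ℝ (range v)) Λ := by
  rw [convexHull_range_sub, isKFoldTiling_preimage_add]

/-! ### The bound five and the normal form in the case of equality. -/

namespace IsCenteredDecagon

/-- A decagon whose short diagonals have the given determinants is affinely equivalent to one with
special edge midpoints. -/
lemma exists_linearEquiv {v : ZMod 10 → Plane} (hv : IsCenteredDecagon v) {δ : ℝ} (hδ : 0 < δ)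
    (hsum : ∑ i, cross (v i) (v (i + 1)) = 2 * 5 * δ)
    (d0 : cross (v 2 - v 0) (v 3 - v 1) = 2 * δ) (d1 : cross (v 3 - v 1) (v 4 - v 2) = δ)
    (d2 : cross (v 4 - v 2) (v 5 - v 3) = δ) (d3 : cross (v 5 - v 3) (v 6 - v 4) = δ)
    (d4 : cross (v 6 - v 4) (v 7 - v 5) = 2 * δ) :
    ∃ L : Plane ≃ₗ[ℝ] Plane, L (twoMid v 0) = (2 : ℝ) • !₂[0, 1] ∧
      L (twoMid v 1) = (2 : ℝ) • !₂[1, 1] ∧ L (twoMid v 2) = (2 : ℝ) • !₂[3 / 2, 1 / 2] ∧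
      L (twoMid v 3) = (2 : ℝ) • !₂[3 / 2, 0] ∧ L (twoMid v 4) = (2 : ℝ) • !₂[1, -1 / 2] := by
  obtain ⟨h5, h6, h7, -, -⟩ := hv.vertices
  rw [hv.sum_cross_eq] at hsum
  -- The area `5 * δ` less the two consecutive determinants in the same area formula. The remaining
  -- diagonals are then expressed in `a1` and `a2` by Cramer's rule.
  have D0 : cross (v 2 - v 0) (v 4 - v 2) = 2 * δ := by
    have : cross (v 2 - v 0) (v 4 - v 2) + cross (v 4 - v 2) (v 5 - v 3) +
        cross (v 6 - v 4) (v 7 - v 5) = cross (v 0) (v 1) + cross (v 1) (v 2) +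
        cross (v 2) (v 3) + cross (v 3) (v 4) + cross (v 0) (v 4) := by
      rw [h5, h6, h7]; simp [cross]; ring
    linarith
  have D1 : cross (v 3 - v 1) (v 5 - v 3) = 2 * δ := by
    have : cross (v 3 - v 1) (v 5 - v 3) + cross (v 5 - v 3) (v 6 - v 4) +
        cross (v 2 - v 0) (v 3 - v 1) = cross (v 0) (v 1) + cross (v 1) (v 2) +
        cross (v 2) (v 3) + cross (v 3) (v 4) + cross (v 0) (v 4) := by
      rw [h5, h6]; simp [cross]; ring
    linarith
  set a1 := v 3 - v 1 with ha1
  set a2 := v 4 - v 2 with ha2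
  have ha3 : v 5 - v 3 = -a1 + (2 : ℝ) • a2 := by
    have := cross_smul_eq a1 a2 (v 5 - v 3)
    rw [cross_swap a2 (v 5 - v 3), d1, d2, D1] at this
    refine smul_right_injective _ hδ.ne' (this.trans ?_)
    module
  have ha0 : v 2 - v 0 = (2 : ℝ) • a1 - (2 : ℝ) • a2 := by
    have := cross_smul_eq a1 a2 (v 2 - v 0)
    rw [cross_swap (v 2 - v 0) a1, d1, d0, D0] at this
    refine smul_right_injective _ hδ.ne' (this.trans ?_)
    module
  have u0 : twoMid v 0 = -(a1 + (v 5 - v 3)) := by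
    change v 0 + v 1 = _; rw [h5, ha1]; abel
  have u1 : twoMid v 1 = twoMid v 0 + (v 2 - v 0) := by
    change v 1 + v 2 = v 0 + v 1 + _; abel
  have u2 : twoMid v 2 = twoMid v 1 + a1 := by
    change v 2 + v 3 = v 1 + v 2 + _; rw [ha1]; abel
  have u3 : twoMid v 3 = twoMid v 2 + a2 := by
    change v 3 + v 4 = v 2 + v 3 + _; rw [ha2]; abel
  have u4 : twoMid v 4 = twoMid v 3 + (v 5 - v 3) := by
    change v 4 + v 5 = v 3 + v 4 + _; abel
  have hA : LinearMap.det (planeMap a1 a2) ≠ 0 := by rw [det_planeMap, d1]; exact hδ.ne'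
  have hM : LinearMap.det (planeMap !₂[1, -1] !₂[0, -1]) ≠ 0 := by
    rw [det_planeMap]; simp [cross]
  -- `a1` and `a2` are differences of consecutive doubled midpoints; `(1, -1)` and `(0, -1)` are the
  -- corresponding differences for the special points.
  let L : Plane ≃ₗ[ℝ] Plane :=
    (LinearMap.equivOfDetNeZero _ hA).symm.trans (LinearMap.equivOfDetNeZero _ hM)
  have hL : ∀ s t : ℝ, L (s • a1 + t • a2) = s • !₂[1, -1] + t • !₂[0, -1] := by
    intro s t
    have h1 : LinearMap.equivOfDetNeZero _ hA !₂[s, t] = s • a1 + t • a2 := by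
      change planeMap a1 a2 !₂[s, t] = _
      simp [planeMap_apply]
    have h2 : LinearMap.equivOfDetNeZero _ hM !₂[s, t] = s • !₂[1, -1] + t • !₂[0, -1] := by
      change planeMap !₂[1, -1] !₂[0, -1] !₂[s, t] = _
      simp [planeMap_apply]
    rw [← h1, ← h2]
    simp only [L, LinearEquiv.trans_apply, LinearEquiv.symm_apply_apply]
  have w0 : twoMid v 0 = (0 : ℝ) • a1 + (-2 : ℝ) • a2 := by rw [u0, ha3]; module
  have w1 : twoMid v 1 = (2 : ℝ) • a1 + (-4 : ℝ) • a2 := by rw [u1, w0, ha0]; module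
  have w2 : twoMid v 2 = (3 : ℝ) • a1 + (-4 : ℝ) • a2 := by rw [u2, w1]; module
  have w3 : twoMid v 3 = (3 : ℝ) • a1 + (-3 : ℝ) • a2 := by rw [u3, w2]; module
  have w4 : twoMid v 4 = (2 : ℝ) • a1 + (-1 : ℝ) • a2 := by rw [u4, w3, ha3]; module
  refine ⟨L, ?_, ?_, ?_, ?_, ?_⟩
  · rw [w0, hL]; ext i; fin_cases i <;> simp
  · rw [w1, hL]; ext i; fin_cases i <;> simp <;> norm_num
  · rw [w2, hL]; ext i; fin_cases i <;> simp <;> norm_num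
  · rw [w3, hL]; ext i; fin_cases i <;> simp <;> norm_num
  · rw [w4, hL]; ext i; fin_cases i <;> simp <;> norm_num

/-- A centred decagon is at best a five-fold lattice tile, and if it is one then it is linearly
equivalent to a decagon with special edge midpoints. -/
theorem five_le_of_isKFoldLatticeTile {v : ZMod 10 → Plane} (hv : IsCenteredDecagon v) {k : ℕ}
    (hT : IsKFoldLatticeTile k (convexHull ℝ (range v))) :
    5 ≤ k ∧ (k = 5 → ∃ L : Plane ≃ₗ[ℝ] Plane, ∃ r, L (twoMid v (0 + r)) = (2 : ℝ) • !₂[0, 1] ∧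
      L (twoMid v (1 + r)) = (2 : ℝ) • !₂[1, 1] ∧
      L (twoMid v (2 + r)) = (2 : ℝ) • !₂[3 / 2, 1 / 2] ∧
      L (twoMid v (3 + r)) = (2 : ℝ) • !₂[3 / 2, 0] ∧
      L (twoMid v (4 + r)) = (2 : ℝ) • !₂[1, -1 / 2]) := by
  obtain ⟨-, Λ, _, _, hT⟩ := hT
  obtain ⟨p, q, hpq, hmem, hF⟩ := exists_lattice_basis Λ
  have H := hv.twoMid_mem_or_edge_mem hT
  have hvol := hv.sum_cross_le hT hpq hF
  have hlt : ∀ {r : ℝ}, r * cross p q < k * cross p q → r < k := fun h =>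
    lt_of_mul_lt_mul_right h hpq.le
  by_cases hall : ∀ i, twoMid v i ∈ Λ
  · have hle : 5 ≤ k := by
      by_contra! hk
      have hk' : (k : ℝ) ≤ 4 := by exact_mod_cast Nat.lt_succ_iff.1 hk
      have := (hv.diagonals_of_twoMid_mem hpq hmem hall (by nlinarith)).1
      nlinarith
    refine ⟨hle, ?_⟩
    rintro rfl
    obtain ⟨hsum, r, h⟩ := hv.diagonals_of_twoMid_mem hpq hmem hall (by exact_mod_cast hvol)
    have hw := hv.rotate r
    obtain ⟨L, hL⟩ := hw.exists_linearEquiv hpq ((sum_cross_rotate v r).trans hsum)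
      (by simpa using h.1) h.2.1 h.2.2.1 h.2.2.2.1 h.2.2.2.2
    simp only [twoMid_rotate] at hL
    exact ⟨L, r, hL⟩
  · push Not at hall
    obtain ⟨i, hi⟩ := hall
    -- Rotating makes the bad edge the edge 0; then `10 * cross p q` is less than the sum, which is
    -- at most `2 * k * cross p q`.
    have hw := hv.rotate i
    have h := hw.det_lt_of_twoMid_notMem hpq hmem (fun j => by
      simpa only [twoMid_rotate, edge_rotate] using H (j + i))
      (by simpa only [twoMid_rotate, zero_add] using hi)
    rw [sum_cross_rotate] at h
    have : (5 : ℝ) < k := hlt (by linarith)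
    have : 5 < k := by exact_mod_cast this
    exact ⟨this.le, fun h => by omega⟩

end IsCenteredDecagon

/-! ### A quadrilateral and its reflection tile with the lattice of the diagonals. -/

/-- The point with coordinates `(s, t)` in the basis of the diagonals lies in the quadrilateral whose
diagonals are cut in the ratios `α : 1 - α` and `β : 1 - β` by the origin. -/
def QuadIneq (α β s t : ℝ) : Prop :=
  0 ≤ α * t + β * s + α * β ∧ 0 ≤ (1 - α) * (t + β) - β * s ∧
    0 ≤ (1 - α) * (1 - β) - (1 - α) * t - (1 - β) * s ∧ 0 ≤ α * (1 - β) - α * t + (1 - β) * s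

/-- A quadrilateral (`true`) and its image (`false`) under reflection in an edge midpoint. -/
def QuadCopy (α β : ℝ) : Bool → ℝ → ℝ → Prop
  | true, s, t => QuadIneq α β s t
  | false, s, t => QuadIneq α β (1 - α - s) (1 - β - t)

/-- Adding the inequalities of two adjacent sides cancels one coordinate. -/
lemma QuadIneq.bounds {α β s t : ℝ} (h : QuadIneq α β s t) :
    -α ≤ s ∧ s ≤ 1 - α ∧ -β ≤ t ∧ t ≤ 1 - β := by
  obtain ⟨h1, h2, h3, h4⟩ := h
  refine ⟨?_, ?_, ?_, ?_⟩ <;> linarith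

section

variable {α β s t : ℝ} (hα : 0 < α) (hα' : α < 1) (hβ : 0 < β) (hβ' : β < 1)
  (hs : 0 < s) (hs' : s < 1) (ht : 0 < t) (ht' : t < 1)
include hα hα' hβ hβ' hs hs' ht ht'

/-- The reflected copy is inscribed in the unit square with one vertex on each side. Each corner
triangle left over is a quarter of the quadrilateral, cut by its diagonals, translated to that
corner. -/
lemma exists_quadCopy : ∃ x : Bool × ℤ × ℤ, QuadCopy α β x.1 (s - x.2.1) (t - x.2.2) := by
  by_cases h1 : α * (1 - t) + β * (1 - s) < α * β
  · have b1 : 1 - t < β := by nlinarith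
    have b2 : 1 - s < α := by nlinarith
    refine ⟨(true, 1, 1), ?_, ?_, ?_, ?_⟩ <;> push_cast <;> nlinarith
  by_cases h2 : (1 - α) * (1 - t) + β * s < (1 - α) * β
  · have b1 : 1 - t < β := by nlinarith
    have b2 : s < 1 - α := by nlinarith
    refine ⟨(true, 0, 1), ?_, ?_, ?_, ?_⟩ <;> push_cast <;> nlinarith
  by_cases h3 : (1 - α) * t + (1 - β) * s < (1 - α) * (1 - β)
  · have b1 : t < 1 - β := by nlinarith
    have b2 : s < 1 - α := by nlinarith
    refine ⟨(true, 0, 0), ?_, ?_, ?_, ?_⟩ <;> push_cast <;> nlinarith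
  by_cases h4 : α * t + (1 - β) * (1 - s) < α * (1 - β)
  · have b1 : t < 1 - β := by nlinarith
    have b2 : 1 - s < α := by nlinarith
    refine ⟨(true, 1, 0), ?_, ?_, ?_, ?_⟩ <;> push_cast <;> nlinarith
  refine ⟨(false, 0, 0), ?_, ?_, ?_, ?_⟩ <;> push_cast <;> linarith

lemma quadCopy_cases {x : Bool × ℤ × ℤ} (hx : QuadCopy α β x.1 (s - x.2.1) (t - x.2.2)) :
    x = (true, 0, 0) ∨ x = (true, 1, 0) ∨ x = (true, 0, 1) ∨ x = (true, 1, 1) ∨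
      x = (false, 0, 0) := by
  obtain ⟨τ, m, n⟩ := x
  cases τ
  · obtain ⟨b1, b2, b3, b4⟩ := QuadIneq.bounds hx
    have m1 : (m : ℝ) < 1 := by simp only at b1; linarith
    have m2 : (-1 : ℝ) < m := by simp only at b2; linarith
    have n1 : (n : ℝ) < 1 := by simp only at b3; linarith
    have n2 : (-1 : ℝ) < n := by simp only at b4; linarith
    have : m < 1 := by exact_mod_cast m1
    have : -1 < m := by exact_mod_cast m2
    have : n < 1 := by exact_mod_cast n1
    have : -1 < n := by exact_mod_cast n2
    obtain rfl : m = 0 := by omega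
    obtain rfl : n = 0 := by omega
    simp
  · obtain ⟨b1, b2, b3, b4⟩ := QuadIneq.bounds hx
    have m1 : (m : ℝ) < 2 := by simp only at b1; linarith
    have m2 : (-1 : ℝ) < m := by simp only at b2; linarith
    have n1 : (n : ℝ) < 2 := by simp only at b3; linarith
    have n2 : (-1 : ℝ) < n := by simp only at b4; linarith
    have : m < 2 := by exact_mod_cast m1
    have : -1 < m := by exact_mod_cast m2
    have : n < 2 := by exact_mod_cast n1
    have : -1 < n := by exact_mod_cast n2
    obtain rfl | rfl : m = 0 ∨ m = 1 := by omega
    · obtain rfl | rfl : n = 0 ∨ n = 1 := by omega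
      · simp
      · simp
    · obtain rfl | rfl : n = 0 ∨ n = 1 := by omega
      · simp
      · simp

/-- The unit square is the union of a reflected copy of the quadrilateral and of corners, which
are translates of its quarters. -/
lemma existsUnique_quadCopy_of_mem_Ioo
    (h1 : α * (t - 1) + β * (s - 1) + α * β ≠ 0)
    (h2 : (1 - α) * (t - 1 + β) - β * s ≠ 0)
    (h3 : (1 - α) * (1 - β) - (1 - α) * t - (1 - β) * s ≠ 0)
    (h4 : α * (1 - β) - α * t + (1 - β) * (s - 1) ≠ 0) :
    ∃! x : Bool × ℤ × ℤ, QuadCopy α β x.1 (s - x.2.1) (t - x.2.2) := by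
  refine existsUnique_of_exists_of_unique
    (exists_quadCopy hα hα' hβ hβ' hs hs' ht ht') fun x y hx hy => ?_
  have p1 : 0 < α * (1 - β) := mul_pos hα (by linarith)
  have p2 : 0 < (1 - α) * (1 - β) := mul_pos (by linarith) (by linarith)
  have main : ∀ x y : Bool × ℤ × ℤ,
      (x = (true, 0, 0) ∧ y = (true, 1, 0)) ∨ (x = (true, 0, 0) ∧ y = (true, 0, 1)) ∨
      (x = (true, 0, 0) ∧ y = (true, 1, 1)) ∨ (x = (true, 0, 0) ∧ y = (false, 0, 0)) ∨
      (x = (true, 1, 0) ∧ y = (true, 0, 1)) ∨ (x = (true, 1, 0) ∧ y = (true, 1, 1)) ∨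
      (x = (true, 1, 0) ∧ y = (false, 0, 0)) ∨ (x = (true, 0, 1) ∧ y = (true, 1, 1)) ∨
      (x = (true, 0, 1) ∧ y = (false, 0, 0)) ∨ (x = (true, 1, 1) ∧ y = (false, 0, 0)) →
      QuadCopy α β x.1 (s - x.2.1) (t - x.2.2) → QuadCopy α β y.1 (s - y.2.1) (t - y.2.2) →
      False := by
    rintro x y h hx hy
    rcases h with ⟨rfl, rfl⟩ | ⟨rfl, rfl⟩ | ⟨rfl, rfl⟩ | ⟨rfl, rfl⟩ | ⟨rfl, rfl⟩ | ⟨rfl, rfl⟩ |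
      ⟨rfl, rfl⟩ | ⟨rfl, rfl⟩ | ⟨rfl, rfl⟩ | ⟨rfl, rfl⟩ <;>
      obtain ⟨a1, a2, a3, a4⟩ := hx <;> obtain ⟨b1, b2, b3, b4⟩ := hy <;>
      push_cast at a1 a2 a3 a4 b1 b2 b3 b4
    · linarith
    · linarith
    · obtain rfl : s = 1 - α := by linarith
      obtain rfl : t = 1 - β := by linarith
      nlinarith
    · exact h3 (by linarith)
    · obtain rfl : s = 1 - α := by linarith
      obtain rfl : t = 1 - β := by linarith
      nlinarith
    · linarith
    · exact h4 (by linarith)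
    · linarith
    · exact h2 (by linarith)
    · exact h1 (by linarith)
  by_contra hne
  rcases quadCopy_cases hα hα' hβ hβ' hs hs' ht ht' hx with h | h | h | h | h <;>
    rcases quadCopy_cases hα hα' hβ hβ' hs hs' ht ht' hy with h' | h' | h' | h' | h' <;>
    first
    | exact hne (h.trans h'.symm)
    | (refine main x y ?_ hx hy; simp [h, h']; done)
    | (refine main y x ?_ hy hx; simp [h, h'])

end

/-- For a generic point of the plane there is exactly one integral translate of a quadrilateral
with unit diagonals or of its reflected copy which contains this point. -/
lemma existsUnique_quadCopy {α β s t : ℝ} (hα : 0 < α) (hα' : α < 1) (hβ : 0 < β) (hβ' : β < 1)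
    (hs : ∀ m : ℤ, s - m ≠ 0) (ht : ∀ n : ℤ, t - n ≠ 0)
    (h1 : ∀ m n : ℤ, α * (t - n) + β * (s - m) + α * β ≠ 0)
    (h2 : ∀ m n : ℤ, (1 - α) * (t - n + β) - β * (s - m) ≠ 0)
    (h3 : ∀ m n : ℤ, (1 - α) * (1 - β) - (1 - α) * (t - n) - (1 - β) * (s - m) ≠ 0)
    (h4 : ∀ m n : ℤ, α * (1 - β) - α * (t - n) + (1 - β) * (s - m) ≠ 0) :
    ∃! x : Bool × ℤ × ℤ, QuadCopy α β x.1 (s - x.2.1) (t - x.2.2) := by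
  have fs : 0 < Int.fract s := (Int.fract_nonneg s).lt_of_ne' (hs ⌊s⌋)
  have ft : 0 < Int.fract t := (Int.fract_nonneg t).lt_of_ne' (ht ⌊t⌋)
  have key := existsUnique_quadCopy_of_mem_Ioo hα hα' hβ hβ' fs (Int.fract_lt_one s) ft
    (Int.fract_lt_one t)
    (by have := h1 (⌊s⌋ + 1) (⌊t⌋ + 1)
        push_cast at this; simpa only [Int.fract, sub_add_eq_sub_sub] using this)
    (by have := h2 ⌊s⌋ (⌊t⌋ + 1)
        push_cast at this; simpa only [Int.fract, sub_add_eq_sub_sub] using this)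
    (h3 ⌊s⌋ ⌊t⌋)
    (by have := h4 (⌊s⌋ + 1) ⌊t⌋
        push_cast at this; simpa only [Int.fract, sub_add_eq_sub_sub] using this)
  have shift : ∀ (τ : Bool) (m n : ℤ), QuadCopy α β τ (Int.fract s - m) (Int.fract t - n) ↔
      QuadCopy α β τ (s - ((m + ⌊s⌋ : ℤ) : ℝ)) (t - ((n + ⌊t⌋ : ℤ) : ℝ)) := by
    intro τ m n
    rw [show Int.fract s - m = s - ((m + ⌊s⌋ : ℤ) : ℝ) by
        rw [Int.fract]; push_cast; ring,
      show Int.fract t - n = t - ((n + ⌊t⌋ : ℤ) : ℝ) by rw [Int.fract]; push_cast; ring]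
  obtain ⟨⟨τ, m, n⟩, hx, huniq⟩ := key
  refine ⟨(τ, m + ⌊s⌋, n + ⌊t⌋), (shift τ m n).1 hx, ?_⟩
  rintro ⟨τ', m', n'⟩ hx'
  have hx'' := (shift τ' (m' - ⌊s⌋) (n' - ⌊t⌋)).2 (by simpa using hx')
  have := huniq (τ', m' - ⌊s⌋, n' - ⌊t⌋) hx''
  simp only [Prod.mk.injEq] at this ⊢
  obtain ⟨e1, e2, e3⟩ := this
  exact ⟨e1, by omega, by omega⟩

/-- The ratios of the three determinants to that of the triangle are the barycentric coordinates of
`y`. -/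
lemma mem_triangle {a b c y : Plane} (habc : 0 < cross (b - a) (c - a))
    (h1 : 0 ≤ cross (b - a) (y - a)) (h2 : 0 ≤ cross (c - b) (y - b))
    (h3 : 0 ≤ cross (a - c) (y - c)) {S : Set Plane} (ha : a ∈ S) (hb : b ∈ S) (hc : c ∈ S) :
    y ∈ convexHull ℝ S := by
  have hy : y = (cross (c - b) (y - b) / cross (b - a) (c - a)) • a +
      (cross (a - c) (y - c) / cross (b - a) (c - a)) • b +
      (cross (b - a) (y - a) / cross (b - a) (c - a)) • c := by
    refine smul_right_injective _ habc.ne' ?_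
    simp only [smul_add, smul_smul, mul_div_cancel₀ _ habc.ne']
    ext i
    fin_cases i <;> simp [cross] <;> ring
  rw [hy]
  have hsum : cross (c - b) (y - b) / cross (b - a) (c - a) +
      cross (a - c) (y - c) / cross (b - a) (c - a) +
      cross (b - a) (y - a) / cross (b - a) (c - a) = 1 := by
    rw [← add_div, ← add_div, div_eq_one_iff_eq habc.ne']
    simp [cross]; ring
  have := (convex_convexHull ℝ S).sum_mem (t := Finset.univ)
    (w := ![cross (c - b) (y - b) / cross (b - a) (c - a),
      cross (a - c) (y - c) / cross (b - a) (c - a),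
      cross (b - a) (y - a) / cross (b - a) (c - a)]) (z := ![a, b, c])
    (by intro j _; fin_cases j
        · exact div_nonneg h2 habc.le
        · exact div_nonneg h3 habc.le
        · exact div_nonneg h1 habc.le)
    (by simpa [Fin.sum_univ_three] using hsum)
    (by intro j _; fin_cases j
        · exact subset_convexHull ℝ S ha
        · exact subset_convexHull ℝ S hb
        · exact subset_convexHull ℝ S hc)
  simpa [Fin.sum_univ_three] using this

lemma le_cross_of_mem_convexHull {S : Set Plane} {e : Plane} {r : ℝ} (h : ∀ z ∈ S, r ≤ cross e z)
    {y : Plane} (hy : y ∈ convexHull ℝ S) : r ≤ cross e y :=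
  convexHull_min (s := S) (t := {z | r ≤ cross e z}) h (convex_setOf_le_cross e r) hy

section Quad

variable {a b c d : Plane} (habc : 0 < cross (b - a) (c - a)) (hacd : 0 < cross (c - a) (d - a))
  (habd : 0 < cross (b - a) (d - a)) (hbcd : 0 < cross (c - b) (d - b))
include habc hacd habd hbcd

lemma mem_quad_iff (y : Plane) : y ∈ convexHull ℝ {a, b, c, d} ↔
    0 ≤ cross (b - a) (y - a) ∧ 0 ≤ cross (c - b) (y - b) ∧ 0 ≤ cross (d - c) (y - c) ∧
      0 ≤ cross (a - d) (y - d) := by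
  constructor
  · intro hy
    have key : ∀ p q : Plane, (∀ z ∈ ({a, b, c, d} : Set Plane), 0 ≤ cross (q - p) (z - p)) →
        0 ≤ cross (q - p) (y - p) := by
      intro p q h
      have := le_cross_of_mem_convexHull (e := q - p) (r := cross (q - p) p)
        (fun z hz => by have := h z hz; rw [cross_sub_right] at this; linarith) hy
      rw [cross_sub_right]; linarith
    have c1 : cross (c - b) (a - b) = cross (b - a) (c - a) := by simp [cross]; ring
    have c2 : cross (d - c) (a - c) = cross (c - a) (d - a) := by simp [cross]; ring
    have c3 : cross (d - c) (b - c) = cross (c - b) (d - b) := by simp [cross]; ring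
    have c4 : cross (a - d) (b - d) = cross (b - a) (d - a) := by simp [cross]; ring
    have c5 : cross (a - d) (c - d) = cross (c - a) (d - a) := by simp [cross]; ring
    have z : ∀ p q : Plane, cross (q - p) (q - p) = 0 := fun p q => cross_same _
    refine ⟨key _ _ ?_, key _ _ ?_, key _ _ ?_, key _ _ ?_⟩ <;>
      rintro w (rfl | rfl | rfl | rfl) <;>
      try simp only [z, sub_self, cross_zero_right, le_refl, c1, c2, c3, c4, c5]
    all_goals
      linarith
  · rintro ⟨h1, h2, h3, h4⟩
    rcases le_total 0 (cross (c - a) (y - a)) with h | h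
    · exact mem_triangle hacd h h3 h4 (by simp) (by simp) (by simp)
    · refine mem_triangle habc h1 h2 ?_ (by simp) (by simp) (by simp)
      have : cross (a - c) (y - c) = -cross (c - a) (y - a) := by simp [cross]; ring
      linarith

/-- A quadrilateral and its reflection tile the plane with the lattice of its diagonals. -/
lemma existsUnique_mem_quad {y : Plane}
    (hgen : ∀ m n : ℤ, ∀ z, z = y - ((m : ℝ) • (c - a) + (n : ℝ) • (d - b)) →
      cross (b - a) (z - a) ≠ 0 ∧ cross (c - b) (z - b) ≠ 0 ∧ cross (d - c) (z - c) ≠ 0 ∧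
      cross (a - d) (z - d) ≠ 0 ∧ cross (c - a) (z - a) ≠ 0 ∧ cross (d - b) (z - b) ≠ 0) :
    ∃! x : Bool × ℤ × ℤ,
      (if x.1 then y - ((x.2.1 : ℝ) • (c - a) + (x.2.2 : ℝ) • (d - b))
        else c + d - (y - ((x.2.1 : ℝ) • (c - a) + (x.2.2 : ℝ) • (d - b)))) ∈
        convexHull ℝ {a, b, c, d} := by
  set B := c - a with hB
  set C := d - b with hC
  set u := cross B C with hu
  have u1 : u = cross (b - a) (d - a) + cross (c - b) (d - b) := by
    simp [hu, hB, hC, cross]; ring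
  have u2 : u = cross (b - a) (c - a) + cross (c - a) (d - a) := by
    simp [hu, hB, hC, cross]; ring
  have hupos : 0 < u := by rw [u1]; exact add_pos habd hbcd
  -- `u` is twice the area, and `α`, `β` are the shares of the triangles `abd` and `abc`. They are
  -- the ratios in which the diagonals divide one another, so `a + α • B` is their intersection.
  set α := cross (b - a) (d - a) / u with hα
  set β := cross (b - a) (c - a) / u with hβ
  have hαu : α * u = cross (b - a) (d - a) := div_mul_cancel₀ _ hupos.ne'
  have hβu : β * u = cross (b - a) (c - a) := div_mul_cancel₀ _ hupos.ne'
  have hα0 : 0 < α := div_pos habd hupos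
  have hα1 : α < 1 := by rw [hα, div_lt_one hupos]; linarith
  have hβ0 : 0 < β := div_pos habc hupos
  have hβ1 : β < 1 := by rw [hβ, div_lt_one hupos]; linarith
  set o := a + α • B with ho
  have ea : a = o - α • B := by rw [ho]; abel
  have eb : b = o - β • C := by
    have h := cross_smul_eq B C (b - a)
    have k1 : cross (b - a) C = α * u := by rw [hαu, hC]; simp [cross]; ring
    have k2 : cross B (b - a) = -(β * u) := by rw [hβu, hB]; simp [cross]; ring
    rw [k1, k2] at h
    have : b - a = α • B - β • C := by
      refine smul_right_injective _ hupos.ne' (h.trans ?_)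
      module
    rw [ho, show b = a + (b - a) by abel, this]; abel
  have ec : c = o + (1 - α) • B := by rw [show c = a + B by rw [hB]; abel, ho]; module
  have ed : d = o + (1 - β) • C := by rw [show d = b + C by rw [hC]; abel, eb]; module
  clear_value o α β
  set s := cross (y - o) C / u with hs
  set t := cross B (y - o) / u with ht
  have hy : y = o + (s • B + t • C) := by
    have h := cross_smul_eq B C (y - o)
    have : y - o = s • B + t • C := by
      refine smul_right_injective _ hupos.ne' (h.trans ?_)
      simp only [smul_add, smul_smul, hs, ht, mul_div_cancel₀ _ hupos.ne']
    rw [← this]; abel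
  clear_value s t
  have cBC : cross C B = -u := cross_swap B C
  have cr : ∀ p q r w : ℝ, cross (p • B + q • C) (r • B + w • C) = (p * w - q * r) * u := by
    intro p q r w
    simp only [cross_add_left, cross_add_right, cross_smul_left, cross_smul_right, cross_same, cBC,
      ← hu]
    ring
  have cross1 : ∀ s t : ℝ, cross (b - a) (o + (s • B + t • C) - a) =
      (α * t + β * s + α * β) * u := by
    intro s t
    rw [show b - a = α • B + (-β) • C by rw [eb, ea]; module,
      show o + (s • B + t • C) - a = (s + α) • B + t • C by rw [ea]; module, cr]; ring
  have cross2 : ∀ s t : ℝ, cross (c - b) (o + (s • B + t • C) - b) =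
      ((1 - α) * (t + β) - β * s) * u := by
    intro s t
    rw [show c - b = (1 - α) • B + β • C by rw [eb, ec]; module,
      show o + (s • B + t • C) - b = s • B + (t + β) • C by rw [eb]; module, cr]
  have cross3 : ∀ s t : ℝ, cross (d - c) (o + (s • B + t • C) - c) =
      ((1 - α) * (1 - β) - (1 - α) * t - (1 - β) * s) * u := by
    intro s t
    rw [show d - c = (-(1 - α)) • B + (1 - β) • C by rw [ed, ec]; module,
      show o + (s • B + t • C) - c = (s - (1 - α)) • B + t • C by rw [ec]; module, cr]; ring
  have cross4 : ∀ s t : ℝ, cross (a - d) (o + (s • B + t • C) - d) =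
      (α * (1 - β) - α * t + (1 - β) * s) * u := by
    intro s t
    rw [show a - d = (-α) • B + (-(1 - β)) • C by rw [ed, ea]; module,
      show o + (s • B + t • C) - d = s • B + (t - (1 - β)) • C by rw [ed]; module, cr]; ring
  have cross5 : ∀ s t : ℝ, cross B (o + (s • B + t • C) - a) = t * u := by
    intro s t
    rw [show B = (1 : ℝ) • B + (0 : ℝ) • C by module,
      show o + (s • ((1 : ℝ) • B + (0 : ℝ) • C) + t • C) - a = (s + α) • B + t • C by
        rw [ea]; module, cr]; ring
  have cross6 : ∀ s t : ℝ, cross C (o + (s • B + t • C) - b) = -s * u := by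
    intro s t
    rw [show C = (0 : ℝ) • B + (1 : ℝ) • C by module,
      show o + (s • B + t • ((0 : ℝ) • B + (1 : ℝ) • C)) - b = s • B + (t + β) • C by
        rw [eb]; module, cr]; ring
  have hmem : ∀ s t : ℝ, o + (s • B + t • C) ∈ convexHull ℝ {a, b, c, d} ↔
      QuadIneq α β s t := by
    intro s t
    rw [mem_quad_iff habc hacd habd hbcd, cross1, cross2, cross3, cross4, QuadIneq]
    simp only [mul_nonneg_iff_of_pos_right hupos]
  have hyz : ∀ m n : ℤ, y - ((m : ℝ) • B + (n : ℝ) • C) =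
      o + ((s - m) • B + (t - n) • C) := fun m n => by rw [hy]; module
  have hcopy : ∀ x : Bool × ℤ × ℤ, (if x.1 then y - ((x.2.1 : ℝ) • B + (x.2.2 : ℝ) • C)
        else c + d - (y - ((x.2.1 : ℝ) • B + (x.2.2 : ℝ) • C))) ∈ convexHull ℝ {a, b, c, d} ↔
      QuadCopy α β x.1 (s - x.2.1) (t - x.2.2) := by
    rintro ⟨τ, m, n⟩
    cases τ
    · simp only [Bool.false_eq_true, if_false, QuadCopy]
      rw [← hmem, hyz, ec, ed]
      congr! 1
      module
    · simp only [if_true, QuadCopy]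
      rw [← hmem, hyz]
  simp only [hcopy]
  have g := fun m n : ℤ => hgen m n _ (hyz m n).symm
  simp only [cross1, cross2, cross3, cross4, cross5, cross6] at g
  refine existsUnique_quadCopy hα0 hα1 hβ0 hβ1 (fun m h => ?_) (fun n h => ?_) (fun m n h => ?_)
    (fun m n h => ?_) (fun m n h => ?_) (fun m n h => ?_)
  · exact (g m 0).2.2.2.2.2 (by rw [h]; ring)
  · exact (g 0 n).2.2.2.2.1 (by rw [h]; ring)
  · exact (g m n).1 (by rw [h]; ring)
  · exact (g m n).2.1 (by rw [h]; ring)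
  · exact (g m n).2.2.1 (by rw [h]; ring)
  · exact (g m n).2.2.2.1 (by rw [h]; ring)

/-- If the diagonals of a quadrilateral generate a sublattice of index `m`, then the quadrilateral
and its reflection together form an `m`-fold tiling. -/
lemma ncard_quad_add_ncard_neg {Λ : Submodule ℤ Plane} [DiscreteTopology Λ] {m : ℕ}
    (r : Fin m → Plane)
    (hr : ∀ w, w ∈ Λ ↔ ∃ j, ∃ k l : ℤ, w = r j + ((k : ℝ) • (c - a) + (l : ℝ) • (d - b)))
    (hinj : ∀ i j, ∀ k l : ℤ, r i - r j = (k : ℝ) • (c - a) + (l : ℝ) • (d - b) → i = j)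
    (hcd : c + d ∈ Λ) {y : Plane}
    (hgen : ∀ w ∈ Λ,
      cross (b - a) (y - w - a) ≠ 0 ∧ cross (c - b) (y - w - b) ≠ 0 ∧
      cross (d - c) (y - w - c) ≠ 0 ∧ cross (a - d) (y - w - d) ≠ 0 ∧
      cross (c - a) (y - w - a) ≠ 0 ∧ cross (d - b) (y - w - b) ≠ 0) :
    {w ∈ (Λ : Set Plane) | y - w ∈ convexHull ℝ {a, b, c, d}}.ncard +
      {w ∈ (Λ : Set Plane) | -(y - w) ∈ convexHull ℝ {a, b, c, d}}.ncard = m := by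
  have hK : IsCompact (convexHull ℝ {a, b, c, d}) :=
    (Set.toFinite ({a, b, c, d} : Set Plane)).isCompact_convexHull ℝ
  set X1 := {w ∈ (Λ : Set Plane) | y - w ∈ convexHull ℝ {a, b, c, d}} with hX1
  set X2 := {w ∈ (Λ : Set Plane) | -(y - w) ∈ convexHull ℝ {a, b, c, d}} with hX2
  set X3 := {w ∈ (Λ : Set Plane) | c + d - (y - w) ∈ convexHull ℝ {a, b, c, d}} with hX3
  -- Reflection in the origin and reflection in the midpoint of side `cd` differ by the lattice
  -- vector `c + d`.
  have h32 : X2 = (fun w => w + (c + d)) '' X3 := by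
    ext w
    constructor
    · rintro ⟨hw, h⟩
      refine ⟨w - (c + d), ⟨Λ.sub_mem hw hcd, ?_⟩, by simp⟩
      rwa [show c + d - (y - (w - (c + d))) = -(y - w) by abel]
    · rintro ⟨w, ⟨hw, h⟩, rfl⟩
      refine ⟨Λ.add_mem hw hcd, ?_⟩
      rwa [show -(y - (w + (c + d))) = c + d - (y - w) by abel]
  have hX1fin : X1.Finite := translates_finite Λ hK y
  have hX2fin : X2.Finite := by
    have hfin := translates_finite Λ hK.neg y
    simpa only [Set.mem_neg] using hfin
  have hX3fin : X3.Finite :=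
    Finite.of_finite_image (h32 ▸ hX2fin) (add_left_injective _).injOn
  rw [h32, ncard_image_of_injective _ (add_left_injective _)]
  have huniq := fun j => existsUnique_mem_quad habc hacd habd hbcd (y := y - r j)
    (fun k l z hz => by
      have hw : r j + ((k : ℝ) • (c - a) + (l : ℝ) • (d - b)) ∈ Λ := (hr _).2 ⟨j, k, l, rfl⟩
      have := hgen _ hw
      rwa [← sub_sub, ← hz] at this)
  choose x hx hxu using huniq
  -- Each coset of the lattice of the diagonals contributes exactly one copy containing `y`; the
  -- Boolean records whether it is reflected. Hence the two counts add up to the number of cosets.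
  let g : Fin m → Bool × Plane := fun j =>
    ((x j).1, r j + (((x j).2.1 : ℝ) • (c - a) + ((x j).2.2 : ℝ) • (d - b)))
  have hg : Function.Injective g := by
    intro i j hij
    have h2 := congrArg Prod.snd hij
    simp only [g] at h2
    refine hinj i j ((x j).2.1 - (x i).2.1) ((x j).2.2 - (x i).2.2) ?_
    push_cast
    rw [show r i = r i + (((x i).2.1 : ℝ) • (c - a) + ((x i).2.2 : ℝ) • (d - b)) -
      (((x i).2.1 : ℝ) • (c - a) + ((x i).2.2 : ℝ) • (d - b)) by abel, h2]
    module
  have hrange : range g = (fun w => (true, w)) '' X1 ∪ (fun w => (false, w)) '' X3 := by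
    ext ⟨τ, w⟩
    constructor
    · rintro ⟨j, hj⟩
      have hxj := hx j
      simp only [g, Prod.mk.injEq] at hj
      obtain ⟨h1, h2⟩ := hj
      have hwΛ : w ∈ Λ := (hr _).2 ⟨j, _, _, h2.symm⟩
      beta_reduce at hxj
      rw [h1, sub_sub, h2] at hxj
      cases τ
      · right; exact ⟨w, ⟨hwΛ, by simpa using hxj⟩, rfl⟩
      · left; exact ⟨w, ⟨hwΛ, by simpa using hxj⟩, rfl⟩
    · intro h
      obtain ⟨hwΛ, hw⟩ : w ∈ Λ ∧ (if τ then y - w else c + d - (y - w)) ∈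
          convexHull ℝ {a, b, c, d} := by
        rcases h with ⟨w', ⟨h1, h2⟩, h3⟩ | ⟨w', ⟨h1, h2⟩, h3⟩
        · simp only [Prod.mk.injEq] at h3
          obtain ⟨rfl, rfl⟩ := h3
          exact ⟨h1, by simpa using h2⟩
        · simp only [Prod.mk.injEq] at h3
          obtain ⟨rfl, rfl⟩ := h3
          exact ⟨h1, by simpa using h2⟩
      obtain ⟨j, k, l, rfl⟩ := (hr w).1 hwΛ
      refine ⟨j, ?_⟩
      rw [← sub_sub] at hw
      have := hxu j (τ, k, l) hw
      simp only [g, ← this]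
  have hcard := ncard_union_eq (s := (fun w : Plane => (true, w)) '' X1)
    (t := (fun w : Plane => (false, w)) '' X3) (by
      rw [disjoint_left]
      rintro _ ⟨w, _, rfl⟩ ⟨w', _, h⟩
      simp at h) (hX1fin.image _) (hX3fin.image _)
  rw [← hrange, ncard_image_of_injective _ (Prod.mk_right_injective true),
    ncard_image_of_injective _ (Prod.mk_right_injective false)] at hcard
  rw [← hcard, ← image_univ, ncard_image_of_injective _ hg, ncard_univ, Nat.card_fin]

end Quad

lemma left_ne_zero_of_cross {a b : Plane} (h : cross a b ≠ 0) : a ≠ 0 := by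
  rintro rfl; exact h (cross_zero_left b)

lemma right_ne_zero_of_cross {a b : Plane} (h : cross a b ≠ 0) : b ≠ 0 := by
  rintro rfl; exact h (cross_zero_right a)

lemma ae_cross_sub_sub_ne_zero (Λ : Submodule ℤ Plane) [DiscreteTopology Λ] {a : Plane}
    (ha : a ≠ 0) (b : Plane) : ∀ᵐ y : Plane, ∀ w ∈ Λ, cross a (y - w - b) ≠ 0 := by
  have h : ∀ w ∈ (Λ : Set Plane), ∀ᵐ y : Plane, cross a (y - w - b) ≠ 0 := by
    intro w _
    have h := volume_setOf_cross_eq ha (cross a (w + b))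
    refine measure_mono_null (fun y hy => ?_) h
    have hy' : cross a (y - w - b) = 0 := not_not.1 hy
    rw [sub_sub, cross_sub_right] at hy'
    exact sub_eq_zero.1 hy'
  exact (ae_ball_iff (lattice_countable Λ)).2 h

/-- A compact set tiles `k`-fold as soon as almost every point is covered `k` times. -/
lemma isKFoldTiling_of_ae {Λ : Submodule ℤ Plane} [DiscreteTopology Λ] {K : Set Plane}
    (hK : IsCompact K) {k : ℕ}
    (h : ∀ᵐ y : Plane, {w ∈ (Λ : Set Plane) | y - w ∈ K}.ncard = k) :
    IsKFoldTiling k K (Λ : Set Plane) := by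
  have hdense := Measure.dense_of_ae h
  intro x
  -- A generic `y` near `x` has no more closed translates than `x`, and at least as many as there
  -- are open translates containing `x`.
  obtain ⟨y, hy, h1, h2⟩ := ((mem_closure_iff_frequently.1 (hdense x)).and_eventually
    ((eventually_translates_subset Λ hK x).and
      (eventually_subset_translates_interior Λ hK x))).exists
  have hy' : {w ∈ (Λ : Set Plane) | y - w ∈ K}.encard = k := by
    rw [← (translates_finite Λ hK y).cast_ncard_eq, hy]
  rw [← hy']
  refine ⟨encard_le_encard h1, encard_le_encard (h2.trans ?_)⟩
  exact fun w hw => ⟨hw.1, interior_subset hw.2⟩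

section Quad

variable {a b c d : Plane} (habc : 0 < cross (b - a) (c - a)) (hacd : 0 < cross (c - a) (d - a))
  (habd : 0 < cross (b - a) (d - a)) (hbcd : 0 < cross (c - b) (d - b))
include habc hacd habd hbcd

lemma ae_quad_generic (Λ : Submodule ℤ Plane) [DiscreteTopology Λ] :
    ∀ᵐ y : Plane, ∀ w ∈ Λ,
      cross (b - a) (y - w - a) ≠ 0 ∧ cross (c - b) (y - w - b) ≠ 0 ∧
      cross (d - c) (y - w - c) ≠ 0 ∧ cross (a - d) (y - w - d) ≠ 0 ∧
      cross (c - a) (y - w - a) ≠ 0 ∧ cross (d - b) (y - w - b) ≠ 0 := by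
  have h3 : d - c ≠ 0 := by
    intro h
    rw [sub_eq_zero.1 h, cross_same] at hacd
    exact hacd.false
  have h4 : a - d ≠ 0 := by
    rw [← neg_sub]; exact neg_ne_zero.2 (right_ne_zero_of_cross habd.ne')
  filter_upwards [ae_cross_sub_sub_ne_zero Λ (left_ne_zero_of_cross habc.ne') a,
    ae_cross_sub_sub_ne_zero Λ (left_ne_zero_of_cross hbcd.ne') b,
    ae_cross_sub_sub_ne_zero Λ h3 c, ae_cross_sub_sub_ne_zero Λ h4 d,
    ae_cross_sub_sub_ne_zero Λ (left_ne_zero_of_cross hacd.ne') a,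
    ae_cross_sub_sub_ne_zero Λ (right_ne_zero_of_cross hbcd.ne') b] with y h1 h2 h3 h4 h5 h6
  exact fun w hw => ⟨h1 w hw, h2 w hw, h3 w hw, h4 w hw, h5 w hw, h6 w hw⟩

end Quad

/-! ### Cutting the decagon into quadrilaterals; the five-fold tiling. -/

namespace IsCenteredDecagon

variable {v : ZMod 10 → Plane} (hv : IsCenteredDecagon v)
include hv

lemma cross_triangle_pos :
    0 < cross (v 1 - v 0) (v 2 - v 0) ∧ 0 < cross (v 2 - v 0) (v 3 - v 0) ∧
    0 < cross (v 1 - v 0) (v 3 - v 0) ∧ 0 < cross (v 2 - v 1) (v 3 - v 1) ∧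
    0 < cross (v 3 - v 0) (v 4 - v 0) ∧ 0 < cross (v 4 - v 0) (v 5 - v 0) ∧
    0 < cross (v 3 - v 0) (v 5 - v 0) ∧ 0 < cross (v 4 - v 3) (v 5 - v 3) := by
  have h01 : 0 < cross (v 1 - v 0) (v 2 - v 1) := hv.cross_edge_one 0
  have h12 : 0 < cross (v 2 - v 1) (v 3 - v 2) := hv.cross_edge_one 1
  have h23 : 0 < cross (v 3 - v 2) (v 4 - v 3) := hv.cross_edge_one 2
  have h34 : 0 < cross (v 4 - v 3) (v 5 - v 4) := hv.cross_edge_one 3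
  have h02 : 0 < cross (v 1 - v 0) (v 3 - v 2) := hv.cross_edge_two 0
  have h13 : 0 < cross (v 2 - v 1) (v 4 - v 3) := hv.cross_edge_two 1
  have h24 : 0 < cross (v 3 - v 2) (v 5 - v 4) := hv.cross_edge_two 2
  have h03 : 0 < cross (v 1 - v 0) (v 4 - v 3) := hv.cross_edge_three 0
  have h14 : 0 < cross (v 2 - v 1) (v 5 - v 4) := hv.cross_edge_three 1
  have h04 : 0 < cross (v 1 - v 0) (v 5 - v 4) := hv.cross_edge_four 0
  simp only [cross, PiLp.sub_apply] at *
  refine ⟨?_, ?_, ?_, ?_, ?_, ?_, ?_, ?_⟩ <;> linarith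

lemma mem_iff_sub (x : Plane) : x ∈ convexHull ℝ (range v) ↔
    ∀ i, 0 ≤ cross (v (i + 1) - v i) (x - v i) := by
  rw [hv.mem_iff]
  refine forall_congr' fun i => ?_
  rw [cross_sub_right, ← edge, cross_edge_self]
  constructor <;> intro h <;> linarith

/-- A half of a centred decagon is covered by two quadrilaterals. -/
lemma mem_quad_of_cross_nonneg {y : Plane} (hy : y ∈ convexHull ℝ (range v))
    (h0 : 0 ≤ cross (v 0) y) :
    y ∈ convexHull ℝ {v 0, v 1, v 2, v 3} ∨ y ∈ convexHull ℝ {v 0, v 3, v 4, v 5} := by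
  obtain ⟨t1, t2, -, -, t3, t4, -, -⟩ := hv.cross_triangle_pos
  have hy' := (hv.mem_iff_sub y).1 hy
  have e0 : 0 ≤ cross (v 1 - v 0) (y - v 0) := hy' 0
  have e1 : 0 ≤ cross (v 2 - v 1) (y - v 1) := hy' 1
  have e2 : 0 ≤ cross (v 3 - v 2) (y - v 2) := hy' 2
  have e3 : 0 ≤ cross (v 4 - v 3) (y - v 3) := hy' 3
  have e4 : 0 ≤ cross (v 5 - v 4) (y - v 4) := hy' 4
  have g5 : cross (v 5 - v 0) (y - v 0) ≤ 0 := by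
    rw [hv.vertices.1]
    simp only [cross, PiLp.sub_apply, PiLp.neg_apply] at h0 ⊢
    linarith
  have flip : ∀ b c : Plane, cross (c - b) (y - b) ≤ 0 → 0 ≤ cross (b - c) (y - c) := by
    intro b c h
    simp only [cross, PiLp.sub_apply] at h ⊢
    linarith
  rcases le_total 0 (cross (v 3 - v 0) (y - v 0)) with g3 | g3
  · right
    rcases le_total 0 (cross (v 4 - v 0) (y - v 0)) with g4 | g4
    · exact mem_triangle t4 g4 e4 (flip _ _ g5) (by simp) (by simp) (by simp)
    · exact mem_triangle t3 g3 e3 (flip _ _ g4) (by simp) (by simp) (by simp)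
  · left
    rcases le_total 0 (cross (v 2 - v 0) (y - v 0)) with g2 | g2
    · exact mem_triangle t2 g2 e2 (flip _ _ g3) (by simp) (by simp) (by simp)
    · exact mem_triangle t1 e0 e1 (flip _ _ g2) (by simp) (by simp) (by simp)

lemma cross_nonneg_of_mem_quad {y : Plane}
    (hy : y ∈ convexHull ℝ {v 0, v 1, v 2, v 3} ∨ y ∈ convexHull ℝ {v 0, v 3, v 4, v 5}) :
    0 ≤ cross (v 0) y := by
  have h1 : 0 < cross (v 0) (v 1) := hv.cross_succ_pos 0
  have h2 : 0 < cross (v 0) (v 2) := hv.cross_two_pos 0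
  have h3 : 0 < cross (v 0) (v 3) := hv.cross_three_pos 0
  have h4 : 0 < cross (v 0) (v 4) := hv.cross_four_pos 0
  have h5 : cross (v 0) (v 5) = 0 := by
    rw [hv.vertices.1, cross_neg_right, cross_same, neg_zero]
  have h0 := cross_same (v 0)
  rcases hy with hy | hy <;> refine le_cross_of_mem_convexHull ?_ hy <;>
    rintro z (rfl | rfl | rfl | rfl) <;> linarith

/-- For a generic point, a centred decagon is counted by two quadrilaterals and their
reflections. -/
lemma ncard_translates_eq {Λ : Submodule ℤ Plane} [DiscreteTopology Λ] {y : Plane}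
    (h0 : ∀ w ∈ Λ, cross (v 0) (y - w - 0) ≠ 0)
    (h1 : ∀ w ∈ Λ, cross (v 3 - v 0) (y - w - v 0) ≠ 0)
    (h2 : ∀ w ∈ Λ, cross (v 3 - v 0) (y - w - -v 0) ≠ 0) :
    {w ∈ (Λ : Set Plane) | y - w ∈ convexHull ℝ (range v)}.ncard =
      ({w ∈ (Λ : Set Plane) | y - w ∈ convexHull ℝ {v 0, v 1, v 2, v 3}}.ncard +
        {w ∈ (Λ : Set Plane) | -(y - w) ∈ convexHull ℝ {v 0, v 1, v 2, v 3}}.ncard) +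
      ({w ∈ (Λ : Set Plane) | y - w ∈ convexHull ℝ {v 0, v 3, v 4, v 5}}.ncard +
        {w ∈ (Λ : Set Plane) | -(y - w) ∈ convexHull ℝ {v 0, v 3, v 4, v 5}}.ncard) := by
  obtain ⟨t012, t023, t013, t123, t034, t045, t035, t345⟩ := hv.cross_triangle_pos
  have sep : ∀ z, z ∈ convexHull ℝ {v 0, v 1, v 2, v 3} →
      z ∈ convexHull ℝ {v 0, v 3, v 4, v 5} → cross (v 3 - v 0) (z - v 0) = 0 := by
    intro z k1 k2
    have k1 := ((mem_quad_iff t012 t023 t013 t123 z).1 k1).2.2.2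
    have k2 := ((mem_quad_iff t034 t045 t035 t345 z).1 k2).1
    refine le_antisymm ?_ k2
    simp only [cross, PiLp.sub_apply] at k1 ⊢
    linarith
  have sub1 : convexHull ℝ {v 0, v 1, v 2, v 3} ⊆ convexHull ℝ (range v) :=
    convexHull_mono (by rintro _ (rfl | rfl | rfl | rfl) <;> exact ⟨_, rfl⟩)
  have sub2 : convexHull ℝ {v 0, v 3, v 4, v 5} ⊆ convexHull ℝ (range v) :=
    convexHull_mono (by rintro _ (rfl | rfl | rfl | rfl) <;> exact ⟨_, rfl⟩)
  have hfin := translates_finite Λ (isCompact_hull v) y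
  set A1 := {w ∈ (Λ : Set Plane) | y - w ∈ convexHull ℝ {v 0, v 1, v 2, v 3}}
  set A2 := {w ∈ (Λ : Set Plane) | y - w ∈ convexHull ℝ {v 0, v 3, v 4, v 5}}
  set B1 := {w ∈ (Λ : Set Plane) | -(y - w) ∈ convexHull ℝ {v 0, v 1, v 2, v 3}}
  set B2 := {w ∈ (Λ : Set Plane) | -(y - w) ∈ convexHull ℝ {v 0, v 3, v 4, v 5}}
  have hneg : ∀ {z : Plane}, -z ∈ convexHull ℝ (range v) → z ∈ convexHull ℝ (range v) :=
    fun h => by simpa only [neg_neg] using hv.neg_mem h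
  have hunion : {w ∈ (Λ : Set Plane) | y - w ∈ convexHull ℝ (range v)} =
      (A1 ∪ A2) ∪ (B1 ∪ B2) := by
    ext w
    constructor
    · rintro ⟨hw, h⟩
      rcases le_total 0 (cross (v 0) (y - w)) with k | k
      · left
        exact (hv.mem_quad_of_cross_nonneg h k).imp (fun h => ⟨hw, h⟩) fun h => ⟨hw, h⟩
      · right
        exact (hv.mem_quad_of_cross_nonneg (hv.neg_mem h) (by rw [cross_neg_right]; linarith)).imp
          (fun h => ⟨hw, h⟩) fun h => ⟨hw, h⟩
    · rintro ((h | h) | (h | h))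
      · exact ⟨h.1, sub1 h.2⟩
      · exact ⟨h.1, sub2 h.2⟩
      · exact ⟨h.1, hneg (sub1 h.2)⟩
      · exact ⟨h.1, hneg (sub2 h.2)⟩
  have fA : (A1 ∪ A2).Finite := hfin.subset (hunion ▸ subset_union_left)
  have fB : (B1 ∪ B2).Finite := hfin.subset (hunion ▸ subset_union_right)
  -- The pieces meet only along the diagonal through `v 0` and `v 3`, its reflection, and the line
  -- through `v 0` and the centre, all avoided by hypothesis.
  have dA : Disjoint A1 A2 := by
    rw [disjoint_left]
    exact fun w k1 k2 => h1 w k1.1 (sep _ k1.2 k2.2)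
  have dB : Disjoint B1 B2 := by
    rw [disjoint_left]
    intro w k1 k2
    apply h2 w k1.1
    have := sep _ k1.2 k2.2
    rwa [show -(y - w) - v 0 = -(y - w - -v 0) by abel, cross_neg_right, neg_eq_zero] at this
  have dAB : Disjoint (A1 ∪ A2) (B1 ∪ B2) := by
    rw [disjoint_left]
    intro w k1 k2
    have m1 : 0 ≤ cross (v 0) (y - w) :=
      hv.cross_nonneg_of_mem_quad (k1.imp (fun h => h.2) fun h => h.2)
    have m2 : 0 ≤ cross (v 0) (-(y - w)) :=
      hv.cross_nonneg_of_mem_quad (k2.imp (fun h => h.2) fun h => h.2)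
    have hw : w ∈ Λ := k1.elim (fun h => h.1) fun h => h.1
    rw [cross_neg_right] at m2
    exact h0 w hw (by rw [sub_zero]; linarith)
  rw [hunion, ncard_union_eq dAB fA fB,
    ncard_union_eq dA (fA.subset subset_union_left) (fA.subset subset_union_right),
    ncard_union_eq dB (fB.subset subset_union_left) (fB.subset subset_union_right)]
  ring

/-- The special decagon is a five-fold lattice tile: it consists of two reflected pairs of
quadrilaterals, one pair tiling once, the other four times. -/
theorem isKFoldTiling_five {Λ : Submodule ℤ Plane} [DiscreteTopology Λ] {p q : Plane}
    (hpq : 0 < cross p q)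
    (hmem : ∀ x, x ∈ Λ ↔ ∃ m n : ℤ, x = (m : ℝ) • p + (n : ℝ) • q)
    (d0 : v 2 - v 0 = p) (d1 : v 3 - v 1 = q) (d2 : v 4 - v 2 = -p + (2 : ℝ) • q)
    (d3 : v 5 - v 3 = (-2 : ℝ) • p + (3 : ℝ) • q) :
    IsKFoldTiling 5 (convexHull ℝ (range v)) (Λ : Set Plane) := by
  obtain ⟨t012, t023, t013, t123, t034, t045, t035, t345⟩ := hv.cross_triangle_pos
  have hindep : ∀ m n : ℝ, m • p + n • q = 0 → m = 0 ∧ n = 0 := by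
    intro m n h
    have h1 : cross (m • p + n • q) q = 0 := by rw [h, cross_zero_left]
    have h2 : cross p (m • p + n • q) = 0 := by rw [h, cross_zero_right]
    simp only [cross_add_left, cross_add_right, cross_smul_left, cross_smul_right, cross_same,
      mul_zero, add_zero, zero_add, mul_eq_zero, hpq.ne', or_false] at h1 h2
    exact ⟨h1, h2⟩
  have d4 : v 4 - v 0 = (2 : ℝ) • q := by
    rw [show v 4 - v 0 = (v 4 - v 2) + (v 2 - v 0) by abel, d0, d2]; abel
  have s23 : v 2 + v 3 = (3 : ℝ) • p + (-3 : ℝ) • q := by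
    have : v 2 + v 3 = (v 4 - v 0) - (v 5 - v 3) - (v 4 - v 2) := by
      rw [hv.vertices.1]; abel
    rw [this, d2, d3, d4]; module
  have s45 : v 4 + v 5 = (2 : ℝ) • q := by rw [hv.vertices.1, ← sub_eq_add_neg, d4]
  refine isKFoldTiling_of_ae (isCompact_hull v) ?_
  have n0 : v 0 ≠ 0 := left_ne_zero_of_cross (hv.cross_succ_pos 0).ne'
  have n3 : v 3 - v 0 ≠ 0 := left_ne_zero_of_cross t034.ne'
  filter_upwards [ae_quad_generic t012 t023 t013 t123 Λ, ae_quad_generic t034 t045 t035 t345 Λ,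
    ae_cross_sub_sub_ne_zero Λ n0 0, ae_cross_sub_sub_ne_zero Λ n3 (v 0),
    ae_cross_sub_sub_ne_zero Λ n3 (-v 0)] with y g1 g2 k0 k1 k2
  rw [hv.ncard_translates_eq k0 k1 k2]
  have c1 := ncard_quad_add_ncard_neg t012 t023 t013 t123 (Λ := Λ) (m := 1) (fun _ => 0)
    (fun w => by
      rw [hmem, d0, d1]
      simp only [zero_add]
      exact ⟨fun h => ⟨0, h⟩, fun ⟨_, h⟩ => h⟩)
    (fun i j k l _ => Subsingleton.elim i j)
    ((hmem _).2 ⟨3, -3, by rw [s23]; push_cast; rfl⟩) g1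
  -- The diagonals `2 q` and `-2 p + 3 q` generate a sublattice of index 4, on which `m + 2 n` is
  -- divisible by 4. This residue identifies the coset, and `0, p, 2 p, 3 p` represent all of them.
  have c2 := ncard_quad_add_ncard_neg t034 t045 t035 t345 (Λ := Λ) (m := 4)
    (fun j => (j : ℝ) • p)
    (fun w => by
      rw [hmem, d3, d4]
      constructor
      · rintro ⟨m, n, rfl⟩
        obtain ⟨j, hj⟩ : ∃ j : Fin 4, (j : ℤ) = (m + 2 * n) % 4 :=
          ⟨⟨((m + 2 * n) % 4).toNat, by omega⟩, by simp only; omega⟩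
        obtain ⟨t, ht⟩ : ∃ t : ℤ, m + 2 * n = 4 * t + j := ⟨(m + 2 * n) / 4, by omega⟩
        have hm : (m : ℝ) = 4 * t + j - 2 * n := by
          rw [eq_sub_iff_add_eq]; exact_mod_cast ht
        refine ⟨j, -n + 3 * t, n - 2 * t, ?_⟩
        rw [hm]
        push_cast
        module
      · rintro ⟨j, k, l, rfl⟩
        refine ⟨j - 2 * l, 2 * k + 3 * l, ?_⟩
        push_cast
        module)
    (fun i j k l h => by
      rw [d3, d4] at h
      have h' : ((i : ℝ) - j + 2 * l) • p + (-2 * k - 3 * l : ℝ) • q = 0 := by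
        have : (i : ℝ) • p - (j : ℝ) • p -
          ((k : ℝ) • (2 : ℝ) • q + (l : ℝ) • ((-2 : ℝ) • p + (3 : ℝ) • q)) = 0 := sub_eq_zero.2 h
        rw [← this]; module
      obtain ⟨h1, h2⟩ := hindep _ _ h'
      have h1' : (i : ℤ) - j + 2 * l = 0 := by exact_mod_cast h1
      have h2' : -2 * k - 3 * l = 0 := by exact_mod_cast h2
      ext
      omega)
    ((hmem _).2 ⟨0, 2, by rw [s45]; push_cast; module⟩) g2
  rw [c1, c2]

end IsCenteredDecagon

/-! ### From the special midpoints back to the diagonals. -/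

lemma exists_lattice {p q : Plane} (hpq : cross p q ≠ 0) :
    ∃ (Λ : Submodule ℤ Plane) (_ : DiscreteTopology Λ) (_ : IsZLattice ℝ Λ),
      ∀ x, x ∈ Λ ↔ ∃ m n : ℤ, x = (m : ℝ) • p + (n : ℝ) • q := by
  have hli : LinearIndependent ℝ ![p, q] := by
    rw [LinearIndependent.pair_iff]
    intro s t h
    have h1 : cross (s • p + t • q) q = 0 := by rw [h, cross_zero_left]
    have h2 : cross p (s • p + t • q) = 0 := by rw [h, cross_zero_right]
    simp only [cross_add_left, cross_add_right, cross_smul_left, cross_smul_right, cross_same,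
      mul_zero, add_zero, zero_add, mul_eq_zero, hpq, or_false] at h1 h2
    exact ⟨h1, h2⟩
  set b := basisOfLinearIndependentOfCardEqFinrank hli (by simp)
  refine ⟨Submodule.span ℤ (range b), inferInstance, inferInstance, fun x => ?_⟩
  rw [coe_basisOfLinearIndependentOfCardEqFinrank]
  simp only [Matrix.range_cons, Matrix.range_empty, union_empty, singleton_union,
    Submodule.mem_span_pair, Int.cast_smul_eq_zsmul, eq_comm]

lemma cross_map_map (L : Plane →ₗ[ℝ] Plane) (x y : Plane) :
    cross (L x) (L y) = LinearMap.det L * cross x y := by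
  have h : planeMap (L x) (L y) = L ∘ₗ planeMap x y := by
    ext1 z
    simp [planeMap_apply]
  rw [← det_planeMap, ← det_planeMap, h, LinearMap.det_comp]

/-- A cyclic arrangement of ten vectors in antipodal pairs is determined by its elements. -/
lemma exists_rotation_of_cross_pos {U : ZMod 10 → Plane} (hU : ∀ i, U (i + 5) = -U i)
    (hpos : ∀ i, ∀ m : ℕ, 1 ≤ m → m ≤ 4 → 0 < cross (U i) (U (i + m))) {t₀ t₁ t₂ t₃ t₄ : Plane}
    (h₀ : t₀ ∈ range U) (h₁ : t₁ ∈ range U) (h₂ : t₂ ∈ range U) (h₃ : t₃ ∈ range U)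
    (h₄ : t₄ ∈ range U) (h₀₁ : 0 < cross t₀ t₁) (h₀₂ : 0 < cross t₀ t₂) (h₀₃ : 0 < cross t₀ t₃)
    (h₀₄ : 0 < cross t₀ t₄) (h₁₂ : 0 < cross t₁ t₂) (h₂₃ : 0 < cross t₂ t₃)
    (h₃₄ : 0 < cross t₃ t₄) :
    ∃ r, U r = t₀ ∧ U (r + 1) = t₁ ∧ U (r + 2) = t₂ ∧ U (r + 3) = t₃ ∧ U (r + 4) = t₄ := by
  obtain ⟨r, rfl⟩ := h₀
  -- Being to the left of `U r` leaves only the next four vectors. Four of them in strictly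
  -- increasing order must be all four in turn.
  have index : ∀ t ∈ range U, 0 < cross (U r) t → ∃ m : ℕ, 1 ≤ m ∧ m ≤ 4 ∧ U (r + m) = t := by
    rintro _ ⟨j, rfl⟩ hj
    have key : ∀ d : ZMod 10, d = 0 ∨ d = 0 + 5 ∨ (d = (1 : ℕ) ∨ d = (2 : ℕ) ∨ d = (3 : ℕ) ∨
        d = (4 : ℕ)) ∨ (d = (1 : ℕ) + 5 ∨ d = (2 : ℕ) + 5 ∨ d = (3 : ℕ) + 5 ∨ d = (4 : ℕ) + 5) := by
      decide
    obtain ⟨d, rfl⟩ : ∃ d, j = r + d := ⟨j - r, by ring⟩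
    have hneg : ∀ m : ℕ, 1 ≤ m → m ≤ 4 → ¬ 0 < cross (U r) (U (r + (m + 5))) := by
      intro m h1 h2
      rw [← add_assoc, hU, cross_neg_right]
      have := hpos r m h1 h2
      linarith
    rcases key d with rfl | rfl | h | h
    · rw [add_zero, cross_same] at hj; exact absurd hj (lt_irrefl _)
    · rw [zero_add, hU, cross_neg_right, cross_same, neg_zero] at hj
      exact absurd hj (lt_irrefl _)
    · rcases h with rfl | rfl | rfl | rfl
      · exact ⟨1, le_rfl, by norm_num, rfl⟩
      · exact ⟨2, by norm_num, by norm_num, rfl⟩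
      · exact ⟨3, by norm_num, by norm_num, rfl⟩
      · exact ⟨4, by norm_num, by norm_num, rfl⟩
    · rcases h with rfl | rfl | rfl | rfl
      · exact absurd hj (hneg 1 (by norm_num) (by norm_num))
      · exact absurd hj (hneg 2 (by norm_num) (by norm_num))
      · exact absurd hj (hneg 3 (by norm_num) (by norm_num))
      · exact absurd hj (hneg 4 (by norm_num) (by norm_num))
  have order : ∀ k l : ℕ, 1 ≤ l → k ≤ 4 → 0 < cross (U (r + k)) (U (r + l)) → k < l := by
    intro k l hl hk h
    by_contra! hlk
    obtain ⟨n, rfl⟩ := Nat.exists_eq_add_of_le hlk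
    rcases Nat.eq_zero_or_pos n with rfl | hn
    · rw [add_zero, cross_same] at h; exact h.false
    · have := hpos (r + l) n hn (by omega)
      rw [Nat.cast_add, ← add_assoc, cross_swap (U (r + l))] at h
      linarith
  obtain ⟨k₁, a₁, b₁, rfl⟩ := index t₁ h₁ h₀₁
  obtain ⟨k₂, a₂, b₂, rfl⟩ := index t₂ h₂ h₀₂
  obtain ⟨k₃, a₃, b₃, rfl⟩ := index t₃ h₃ h₀₃
  obtain ⟨k₄, a₄, b₄, rfl⟩ := index t₄ h₄ h₀₄
  have c₁ := order _ _ a₂ b₁ h₁₂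
  have c₂ := order _ _ a₃ b₂ h₂₃
  have c₃ := order _ _ a₄ b₃ h₃₄
  obtain rfl : k₁ = 1 := by omega
  obtain rfl : k₂ = 2 := by omega
  obtain rfl : k₃ = 3 := by omega
  obtain rfl : k₄ = 4 := by omega
  exact ⟨r, rfl, by norm_num, by norm_num, by norm_num, by norm_num⟩

namespace IsCenteredDecagon

variable {v : ZMod 10 → Plane} (hv : IsCenteredDecagon v)
include hv

lemma cross_twoMid_pos (i : ZMod 10) (m : ℕ) (h1 : 1 ≤ m) (h4 : m ≤ 4) :
    0 < cross (twoMid v i) (twoMid v (i + m)) := by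
  have c0 := cross_same (v (i + 1))
  have c1 := hv.cross_succ_pos i
  have c2 := hv.cross_two_pos i
  have c3 := hv.cross_three_pos i
  have c4 := hv.cross_four_pos i
  have c5 : cross (v i) (v (i + 5)) = 0 := by
    rw [hv.antipode, cross_neg_right, cross_same, neg_zero]
  have b1 := hv.cross_succ_pos (i + 1)
  have b2 := hv.cross_two_pos (i + 1)
  have b3 := hv.cross_three_pos (i + 1)
  have b4 := hv.cross_four_pos (i + 1)
  rw [show i + 1 + 1 = i + 2 by ring] at b1
  rw [show i + 1 + 2 = i + 3 by ring] at b2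
  rw [show i + 1 + 3 = i + 4 by ring] at b3
  rw [show i + 1 + 4 = i + 5 by ring] at b4
  simp only [twoMid, cross_add_left, cross_add_right]
  interval_cases m
  · rw [Nat.cast_one, show i + 1 + 1 = i + 2 by ring]; linarith
  · rw [Nat.cast_ofNat, show i + 2 + 1 = i + 3 by ring]; linarith
  · rw [Nat.cast_ofNat, show i + 3 + 1 = i + 4 by ring]; linarith
  · rw [Nat.cast_ofNat, show i + 4 + 1 = i + 5 by ring]; linarith

/-- A decagon with the given linear relations between its short diagonals is a five-fold lattice
tile. -/
lemma isKFoldLatticeTile_five_of_diagonals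
    (d2 : v 4 - v 2 = -(v 2 - v 0) + (2 : ℝ) • (v 3 - v 1))
    (d3 : v 5 - v 3 = (-2 : ℝ) • (v 2 - v 0) + (3 : ℝ) • (v 3 - v 1)) :
    IsKFoldLatticeTile 5 (convexHull ℝ (range v)) := by
  have hpq : 0 < cross (v 2 - v 0) (v 3 - v 1) := hv.cross_diagonal_pos 0
  obtain ⟨Λ, _, _, hmem⟩ := exists_lattice hpq.ne'
  exact ⟨by norm_num, Λ, inferInstance, inferInstance,
    hv.isKFoldTiling_five hpq hmem rfl rfl d2 d3⟩

/-- The hypotheses are linear relations and so can be checked after a linear map. The shift by `r +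
1`, rather than `r`, makes the differences `twoMid v (r + 2) - twoMid v (r + 1)` and `twoMid v (r +
3) - twoMid v (r + 2)` the basis of the lattice. -/
lemma isKFoldLatticeTile_five_of_twoMid {r : ZMod 10}
    (h3 : twoMid v (r + 4) - twoMid v (r + 3) = -(twoMid v (r + 2) - twoMid v (r + 1)) +
      (2 : ℝ) • (twoMid v (r + 3) - twoMid v (r + 2)))
    (h4 : -twoMid v r - twoMid v (r + 4) = (-2 : ℝ) • (twoMid v (r + 2) - twoMid v (r + 1)) +
      (3 : ℝ) • (twoMid v (r + 3) - twoMid v (r + 2))) :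
    IsKFoldLatticeTile 5 (convexHull ℝ (range v)) := by
  rw [← range_rotate v (r + 1)]
  have e0 : v (2 + (r + 1)) - v (0 + (r + 1)) = twoMid v (r + 2) - twoMid v (r + 1) := by
    rw [show r + 2 = r + 1 + 1 by ring, ← diagonal_eq, zero_add, add_comm 2]
  have e1 : v (3 + (r + 1)) - v (1 + (r + 1)) = twoMid v (r + 3) - twoMid v (r + 2) := by
    rw [show r + 3 = r + 2 + 1 by ring, ← diagonal_eq,
      show 3 + (r + 1) = r + 2 + 2 by ring, show 1 + (r + 1) = r + 2 by ring]
  have e2 : v (4 + (r + 1)) - v (2 + (r + 1)) = twoMid v (r + 4) - twoMid v (r + 3) := by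
    rw [show r + 4 = r + 3 + 1 by ring, ← diagonal_eq,
      show 4 + (r + 1) = r + 3 + 2 by ring, show 2 + (r + 1) = r + 3 by ring]
  have e3 : v (5 + (r + 1)) - v (3 + (r + 1)) = -twoMid v r - twoMid v (r + 4) := by
    rw [← hv.twoMid_add_five, show r + 5 = r + 4 + 1 by ring, ← diagonal_eq,
      show 5 + (r + 1) = r + 4 + 2 by ring, show 3 + (r + 1) = r + 4 by ring]
  exact (hv.rotate (r + 1)).isKFoldLatticeTile_five_of_diagonals (by rw [e0, e1, e2, h3])
    (by rw [e0, e1, e3, h4])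

/-- Only the set of midpoints is given, so their cyclic order is recovered from signs of
determinants. The special points `(0, 1), (1, 1), ...` run clockwise, which is the order needed when
`L` reverses orientation. -/
theorem isKFoldLatticeTile_five (L : Plane ≃ₗ[ℝ] Plane)
    (hL : ∀ s ∈ specialMidpoints, ∃ i, L (twoMid v i) = (2 : ℝ) • s) :
    IsKFoldLatticeTile 5 (convexHull ℝ (range v)) := by
  have hmem : ∀ s ∈ specialMidpoints, L.symm ((2 : ℝ) • s) ∈ range (twoMid v) := by
    intro s hs
    obtain ⟨i, hi⟩ := hL s hs
    exact ⟨i, by rw [← hi, L.symm_apply_apply]⟩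
  set D := LinearMap.det (L : Plane →ₗ[ℝ] Plane)
  have hcross : ∀ s t : Plane, D * cross (L.symm s) (L.symm t) = cross s t := by
    intro s t
    rw [← cross_map_map]
    simp
  have hD : D ≠ 0 := (LinearEquiv.isUnit_det' L).ne_zero
  rcases hD.lt_or_gt with hD | hD
  · have hpos : ∀ s t : Plane, cross s t < 0 → 0 < cross (L.symm s) (L.symm t) := by
      intro s t h
      rw [← hcross] at h
      exact pos_of_mul_neg_right h hD.le
    obtain ⟨r, e0, e1, e2, e3, e4⟩ := exists_rotation_of_cross_pos hv.twoMid_add_five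
      hv.cross_twoMid_pos (hmem !₂[0, 1] (by simp [specialMidpoints]))
      (hmem !₂[1, 1] (by simp [specialMidpoints]))
      (hmem !₂[3 / 2, 1 / 2] (by simp [specialMidpoints]))
      (hmem !₂[3 / 2, 0] (by simp [specialMidpoints]))
      (hmem !₂[1, -1 / 2] (by simp [specialMidpoints]))
      (hpos _ _ (by norm_num [cross])) (hpos _ _ (by norm_num [cross]))
      (hpos _ _ (by norm_num [cross])) (hpos _ _ (by norm_num [cross]))
      (hpos _ _ (by norm_num [cross])) (hpos _ _ (by norm_num [cross]))
      (hpos _ _ (by norm_num [cross]))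
    refine hv.isKFoldLatticeTile_five_of_twoMid (r := r) ?_ ?_ <;>
      rw [e4, e3, e2, e1] <;> try rw [e0]
    all_goals
      apply L.injective
      simp only [map_add, map_sub, map_neg, map_smul, L.apply_symm_apply]
      ext i; fin_cases i <;> norm_num
  · have hpos : ∀ s t : Plane, 0 < cross s t → 0 < cross (L.symm s) (L.symm t) := by
      intro s t h
      rw [← hcross] at h
      exact pos_of_mul_pos_right h hD.le
    -- Read counterclockwise from `(1, 1)`, the special points satisfy the same two linear
    -- relations.
    obtain ⟨r, e0, e1, e2, e3, e4⟩ := exists_rotation_of_cross_pos hv.twoMid_add_five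
      hv.cross_twoMid_pos (hmem !₂[1, 1] (by simp [specialMidpoints]))
      (hmem !₂[0, 1] (by simp [specialMidpoints]))
      (hmem (-!₂[1, -1 / 2]) (by simp [specialMidpoints]))
      (hmem (-!₂[3 / 2, 0]) (by simp [specialMidpoints]))
      (hmem (-!₂[3 / 2, 1 / 2]) (by simp [specialMidpoints]))
      (hpos _ _ (by norm_num [cross])) (hpos _ _ (by norm_num [cross]))
      (hpos _ _ (by norm_num [cross])) (hpos _ _ (by norm_num [cross]))
      (hpos _ _ (by norm_num [cross])) (hpos _ _ (by norm_num [cross]))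
      (hpos _ _ (by norm_num [cross]))
    refine hv.isKFoldLatticeTile_five_of_twoMid (r := r) ?_ ?_ <;>
      rw [e4, e3, e2, e1] <;> try rw [e0]
    all_goals
      apply L.injective
      simp only [map_add, map_sub, map_neg, map_smul, L.apply_symm_apply]
      ext i; fin_cases i <;> norm_num

end IsCenteredDecagon

/-! ### Affine normalization and the main theorem. -/

lemma abs_le_of_mem_specialMidpoints {s : Plane} (hs : s ∈ specialMidpoints) :
    |s 0| ≤ 3 / 2 ∧ |s 1| ≤ 1 := by
  rcases hs with rfl | rfl | rfl | rfl | rfl | rfl | rfl | rfl | rfl | rfl <;>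
    constructor <;> norm_num [abs_le]

/-- The only point about which the special midpoints are symmetric is the origin. -/
lemma eq_zero_of_specialMidpoints_symmetric {o : Plane}
    (h : ∀ s ∈ specialMidpoints, o + o - s ∈ specialMidpoints) : o = 0 := by
  -- Reflecting opposite extreme points of the bounding box would push one of them outside it if the
  -- centre were not the origin.
  have h1 := (abs_le.1 (abs_le_of_mem_specialMidpoints
    (h !₂[3 / 2, 0] (by simp [specialMidpoints]))).1).1
  have h2 := (abs_le.1 (abs_le_of_mem_specialMidpoints
    (h (-!₂[3 / 2, 0]) (by simp [specialMidpoints]))).1).2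
  have h3 := (abs_le.1 (abs_le_of_mem_specialMidpoints
    (h !₂[0, 1] (by simp [specialMidpoints]))).2).1
  have h4 := (abs_le.1 (abs_le_of_mem_specialMidpoints
    (h (-!₂[0, 1]) (by simp [specialMidpoints]))).2).2
  simp at h1 h2 h3 h4
  ext i
  fin_cases i <;> simp <;> linarith

lemma midpoint_map_eq (σ : Plane ≃ᵃ[ℝ] Plane) (v : ZMod 10 → Plane) (c : Plane) (i : ZMod 10) :
    midpoint ℝ (σ (v i)) (σ (v (i + 1))) =
      σ c + (1 / 2 : ℝ) • σ.linear (twoMid (fun i => v i - c) i) := by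
  have h : ∀ x, σ x = σ c + σ.linear (x - c) := by
    intro x
    have := σ.map_vadd c (x - c)
    simp only [vadd_eq_add, sub_add_cancel] at this
    rw [this, add_comm]
  rw [h (v i), h (v (i + 1)), midpoint_eq_smul_add, twoMid, map_add]
  rw [invOf_eq_inv]
  module

lemma exists_affineEquiv_of_twoMid {v : ZMod 10 → Plane} {c : Plane}
    (hv : IsCenteredDecagon fun i => v i - c) {L : Plane ≃ₗ[ℝ] Plane} {r : ZMod 10}
    (h0 : L (twoMid (fun i => v i - c) (0 + r)) = (2 : ℝ) • !₂[0, 1])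
    (h1 : L (twoMid (fun i => v i - c) (1 + r)) = (2 : ℝ) • !₂[1, 1])
    (h2 : L (twoMid (fun i => v i - c) (2 + r)) = (2 : ℝ) • !₂[3 / 2, 1 / 2])
    (h3 : L (twoMid (fun i => v i - c) (3 + r)) = (2 : ℝ) • !₂[3 / 2, 0])
    (h4 : L (twoMid (fun i => v i - c) (4 + r)) = (2 : ℝ) • !₂[1, -1 / 2]) :
    ∃ σ : Plane ≃ᵃ[ℝ] Plane, edgeMidpoints (fun i => σ (v i)) = specialMidpoints := by
  let σ : Plane ≃ᵃ[ℝ] Plane := (AffineEquiv.constVAdd ℝ Plane (-c)).trans L.toAffineEquiv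
  have hσc : σ c = 0 := by simp [σ]
  have hσ : ∀ x, σ.linear x = L x := fun x => rfl
  have hmid : ∀ i, ∀ s : Plane, L (twoMid (fun i => v i - c) i) = (2 : ℝ) • s →
      midpoint ℝ (σ (v i)) (σ (v (i + 1))) = s := by
    intro i s h
    rw [midpoint_map_eq σ v c, hσc, hσ, h]
    module
  have hmid' : ∀ i, ∀ s : Plane, L (twoMid (fun i => v i - c) i) = (2 : ℝ) • s →
      midpoint ℝ (σ (v (5 + i))) (σ (v (5 + i + 1))) = -s := by
    intro i s h
    refine hmid _ _ ?_
    rw [add_comm, hv.twoMid_add_five, map_neg, h, smul_neg]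
  have range_eq : edgeMidpoints (fun i => σ (v i)) =
      ⋃ d : ZMod 10, {midpoint ℝ (σ (v (d + r))) (σ (v (d + r + 1)))} := by
    ext x
    simp only [edgeMidpoints, mem_range, mem_iUnion, mem_singleton_iff]
    constructor
    · rintro ⟨i, rfl⟩
      exact ⟨i - r, by rw [sub_add_cancel]⟩
    · rintro ⟨d, rfl⟩
      exact ⟨d + r, rfl⟩
  refine ⟨σ, ?_⟩
  rw [range_eq]
  have k5 := hmid' _ _ h0
  have k6 := hmid' _ _ h1
  have k7 := hmid' _ _ h2
  have k8 := hmid' _ _ h3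
  have k9 := hmid' _ _ h4
  rw [← add_assoc, show (5 : ZMod 10) + 0 = 5 by rfl] at k5
  rw [← add_assoc, show (5 : ZMod 10) + 1 = 6 by rfl] at k6
  rw [← add_assoc, show (5 : ZMod 10) + 2 = 7 by rfl] at k7
  rw [← add_assoc, show (5 : ZMod 10) + 3 = 8 by rfl] at k8
  rw [← add_assoc, show (5 : ZMod 10) + 4 = 9 by rfl] at k9
  have exists_iff : ∀ Q : ZMod 10 → Prop, (∃ d, Q d) ↔
      Q 0 ∨ Q 1 ∨ Q 2 ∨ Q 3 ∨ Q 4 ∨ Q 5 ∨ Q 6 ∨ Q 7 ∨ Q 8 ∨ Q 9 := by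
    intro Q
    have key : ∀ d : ZMod 10, d = 0 ∨ d = 1 ∨ d = 2 ∨ d = 3 ∨ d = 4 ∨ d = 5 ∨ d = 6 ∨ d = 7 ∨
      d = 8 ∨ d = 9 := by decide
    constructor
    · rintro ⟨d, hd⟩
      rcases key d with rfl | rfl | rfl | rfl | rfl | rfl | rfl | rfl | rfl | rfl <;> tauto
    · rintro (h | h | h | h | h | h | h | h | h | h) <;> exact ⟨_, h⟩
  ext x
  rw [mem_iUnion, exists_iff, hmid _ _ h0, hmid _ _ h1, hmid _ _ h2, hmid _ _ h3, hmid _ _ h4,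
    k5, k6, k7, k8, k9]
  rfl

theorem lemma8 (P : Set Plane) (v : ZMod 10 → Plane) (hv : IsConvexPolygon 10 P v)
    (hP : IsCentrallySymmetric P) :
    5 ≤ tauStar P ∧
      (tauStar P = 5 ↔
        ∃ σ : Plane ≃ᵃ[ℝ] Plane, edgeMidpoints (fun i => σ (v i)) = specialMidpoints) := by
  obtain ⟨rfl, hconv⟩ := hv
  obtain ⟨c, hc⟩ := exists_isCenteredDecagon hconv hP
  have htile : ∀ k, IsKFoldLatticeTile k (convexHull ℝ (range fun i => v i - c)) ↔
      IsKFoldLatticeTile k (convexHull ℝ (range v)) := fun k => by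
    simp only [IsKFoldLatticeTile, isKFoldTiling_convexHull_range_sub]
  have hle : 5 ≤ tauStar (convexHull ℝ (range v)) := by
    refine le_sInf ?_
    rintro _ ⟨k, rfl, hk⟩
    exact_mod_cast (hc.five_le_of_isKFoldLatticeTile ((htile k).2 hk)).1
  refine ⟨hle, fun h => ?_, ?_⟩
  · have hne : {m : ℕ∞ | ∃ k : ℕ, m = (k : ℕ∞) ∧
        IsKFoldLatticeTile k (convexHull ℝ (range v))}.Nonempty := by
      by_contra hempty
      -- The infimum of the empty set is `⊤`, which is not 5.
      rw [tauStar, not_nonempty_iff_eq_empty.1 hempty, sInf_empty] at h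
      exact absurd h (by decide)
    obtain ⟨k, hk, hT⟩ := csInf_mem hne
    rw [← tauStar, h] at hk
    obtain rfl : 5 = k := by exact_mod_cast hk
    obtain ⟨L, r, h0, h1, h2, h3, h4⟩ :=
      (hc.five_le_of_isKFoldLatticeTile ((htile 5).2 hT)).2 rfl
    exact exists_affineEquiv_of_twoMid hc h0 h1 h2 h3 h4
  · rintro ⟨σ, hσ⟩
    have hmid := midpoint_map_eq σ v c
    -- The edge midpoints of the image are symmetric about `σ c`, while the special set is symmetric
    -- about the origin only.
    have ho : σ c = 0 := by
      refine eq_zero_of_specialMidpoints_symmetric fun s hs => ?_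
      rw [← hσ] at hs ⊢
      obtain ⟨i, rfl⟩ := hs
      refine ⟨i + 5, ?_⟩
      simp only
      rw [hmid, hmid, hc.twoMid_add_five, map_neg]
      module
    refine le_antisymm (sInf_le ⟨5, rfl, (htile 5).1 ?_⟩) hle
    refine hc.isKFoldLatticeTile_five σ.linear fun s hs => ?_
    rw [← hσ] at hs
    obtain ⟨i, rfl⟩ := hs
    refine ⟨i, ?_⟩
    simp only
    rw [hmid, ho]
    module
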